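/- Let $g\ge 0$ and $k\ge 1$ be integers. Let $\mathbb T^{2g}=\mathbb R^{2g}/\mathbb Z^{2g}$ have coordinates $(x,y)$ and symplectic form $\omega=\sum_j dy_j\wedge dx_j$, also viewed as the bilinear form $\omega(u,v)=\sum_j(u_{g+j}v_j-u_jv_{g+j})$ on $\mathbb R^{2g}$. For $n\in\mathbb Z$, smooth sections of $L^{n}$ are the smooth functions $s:\mathbb R^{2g}\to\mathbb C$ with $s(u+\lambda)=(-1)^{n\sum_j\lambda_j\lambda_{g+j}}e^{-n\pi i\,\omega(u,\lambda)}s(u)$ for $\lambda\in\mathbb Z^{2g}$, with connection $\nabla_\xi s=ds(\xi)-n\pi i\,s\sum_j(y_jdx_j-x_jdy_j)(\xi)$ and inner product $\langle s,s'\rangle=\int_{[0,1]^{2g}}s\overline{s'}$. Let $\Gamma^{-\infty}(L^k)$ be the continuous dual of $\Gamma^\infty(L^{-k})$ (with its $C^\infty$ topology), with the topology of pointwise convergence. It contains $\Gamma^\infty(L^k)$ via $s\mapsto(\phi\mapsto\int_{[0,1]^{2g}} s\phi)$, and on it one sets $(\nabla'_\xi\sigma)(\phi)=-\sigma((\operatorname{div}\xi)\phi+\nabla_\xi\phi)$.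 Let $\mathbb H_g$ be Siegel upper half-space, $\breve{\mathbb D}_g$ its image under $\Omega\mapsto\tau=(i-\Omega)(i+\Omega)^{-1}$, with inverse $\Omega(\tau)=i(1-\tau)(1+\tau)^{-1}$, and $\mathbb D_g$ (the closed Siegel disc) the closure of $\breve{\mathbb D}_g$ in the space of complex $g\times g$ matrices. For $\tau\in\mathbb D_g$ let $\mathcal P_\tau\subset\mathbb C^{2g}$ be the span of the vectors $\sum_l\big(-i(1-\bar\tau)_{lm}\partial_{x_l}+(1+\bar\tau)_{lm}\partial_{y_l}\big)$, $1\le m\le g$; let $\widetilde{\mathcal Q}_\tau$ be the space of $\sigma\in\Gamma^{-\infty}(L^k)$ with $\nabla'_{\bar\xi}\sigma=0$ for all smooth vector fields $\xi$ on $\mathbb T^{2g}$ with values in $\mathcal P_\tau$; and let $\mathcal Q_\tau=\widetilde{\mathcal Q}_\tau\otimes\mathbb C\sqrt{d^g(x,y)_\tau}$, where $\mathbb C\sqrt{d^g(x,y)_\tau}$ is the half-form line with generator $\sqrt{d^g(x,y)_\tau}$. The total space $\mathcal Q$ of the $\mathcal Q_\tau$ is topologized as a subspace of $\mathbb D_g\times\Gamma^{-\infty}(L^k)$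 by means of these generators. For $\tau\in\breve{\mathbb D}_g$, $\Omega=\Omega(\tau)$, put $\sqrt{d^gz_\Omega}=\det(1+\tau)^{-1/2}\sqrt{d^g(x,y)_\tau}$, where $\det(1+\tau)^{1/2}$ is the continuous branch on $\breve{\mathbb D}_g$ equal to $1$ at $\tau=0$. Half-forms over $\breve{\mathbb D}_g$ are paired sesquilinearly by $$\Big\langle\sqrt{d^gz_\Omega},\sqrt{d^gz_{\Omega'}}\Big\rangle=\Big(\det\tfrac{\Omega-\overline{\Omega'}}{2ki}\Big)^{1/2}:=\Big(\int_{\mathbb R^g}e^{-\pi\,{}^t\xi\frac{\Omega-\overline{\Omega'}}{2ki}\xi}\,d^g\xi\Big)^{-1}.$$ For $l\in\mathbb Z^g/k\mathbb Z^g$ let $$\vartheta^l_\Omega(x,y)=e^{-k\pi i\,{}^txy}\sum_{m\in\mathbb Z^g}e^{k\pi i\,{}^t(y-m-\frac lk)\Omega(y-m-\frac lk)+2\pi ik\,{}^t(m+\frac lk)x}.$$ Then: 1. There is a unique family of sesquilinear pairings $\langle\cdot,\cdot\rangle_{BKS}:\mathcal Q_\tau\times\mathcal Q_{\tau'}\to\mathbb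 C$, $\tau,\tau'\in\mathbb D_g$, that is continuous on $\mathcal Q\times\mathcal Q$ and satisfies $\langle s\otimes\mu,s'\otimes\mu'\rangle_{BKS}=\langle s,s'\rangle\langle\mu,\mu'\rangle$ for $\tau,\tau'\in\breve{\mathbb D}_g$, smooth sections $s\in\widetilde{\mathcal Q}_\tau$, $s'\in\widetilde{\mathcal Q}_{\tau'}$ and half-forms $\mu,\mu'$ over $\tau,\tau'$ (the BKS pairing). For each $\tau\in\mathbb D_g$ its restriction to $\mathcal Q_\tau\times\mathcal Q_\tau$ is a (positive definite, Hermitian) inner product $\langle\cdot,\cdot\rangle_{\mathcal Q_\tau}$. 2. For each $l$, the section $\tau\mapsto\sigma^l_\tau:=\vartheta^l_{\Omega(\tau)}\otimes\sqrt{d^gz_{\Omega(\tau)}}$ of $\mathcal Q$ over $\breve{\mathbb D}_g$ extends uniquely to a continuous section $\tau\mapsto\sigma^l_\tau\in\mathcal Q_\tau$ over $\mathbb D_g$, and $\{\sigma^l_\tau\}_{l\in\mathbb Z^g/k\mathbb Z^g}$ is a basis of $\mathcal Q_\tau$ for every $\tau\in\mathbb D_g$. 3. For all $\tau,\tau'\in\mathbb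 D_g$ (including the degenerate and real polarizations on the boundary) there is a unique linear map $B_{\tau,\tau'}:\mathcal Q_\tau\to\mathcal Q_{\tau'}$ with $\langle B_{\tau,\tau'}\sigma,\sigma'\rangle_{\mathcal Q_{\tau'}}=\langle\sigma,\sigma'\rangle_{BKS}$ for all $\sigma\in\mathcal Q_\tau$, $\sigma'\in\mathcal Q_{\tau'}$. These maps are unitary, they are transitive, $B_{\tau',\tau''}\circ B_{\tau,\tau'}=B_{\tau,\tau''}$ for all $\tau,\tau',\tau''\in\mathbb D_g$, and the indexed bases are parallel: $B_{\tau,\tau'}\sigma^l_\tau=\sigma^l_{\tau'}$ for all $l$. -/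

import Mathlib

open scoped ContDiff TensorProduct ComplexConjugate

noncomputable section

namespace TorusBKS

/-! ### The prequantum line bundle on the torus and its smooth sections -/

/-- The universal cover `ℝ^{2g}` of the torus, with points `u = (x, y)`. Only the topology, the
smooth structure and Lebesgue measure of this product are used. -/
abbrev Cover (g : ℕ) : Type := (Fin g → ℝ) × (Fin g → ℝ)

/-- The complexified tangent space `ℂ^{2g}`: `(a, b)` is the vector `∑ a_j ∂/∂x_j + b_j ∂/∂y_j`. -/
abbrev ComplexTangent (g : ℕ) : Type := (Fin g → ℂ) × (Fin g → ℂ)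

/-- The lattice `ℤ^{2g}`. -/
abbrev Lattice (g : ℕ) : Type := (Fin g → ℤ) × (Fin g → ℤ)

/-- A lattice vector as a point of `ℝ^{2g}`. -/
def latticeVec {g : ℕ} (lam : Lattice g) : Cover g :=
  (fun j => (lam.1 j : ℝ), fun j => (lam.2 j : ℝ))

/-- The symplectic form `ω = ∑ dy_j ∧ dx_j` on `ℝ^{2g}`. -/
def omega {g : ℕ} (u v : Cover g) : ℝ := ∑ j, (u.2 j * v.1 j - u.1 j * v.2 j)

/-- The canonical semi-character `α(λ) = (-1)^{∑ λ_j λ_{g+j}}`. -/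
def semichar {g : ℕ} (lam : Lattice g) : ℂ := (-1 : ℂ) ^ (∑ j, lam.1 j * lam.2 j)

/-- The factor of automorphy of the power `L^n` (where `n` may be negative). -/
def autFactor {g : ℕ} (n : ℤ) (lam : Lattice g) (u : Cover g) : ℂ :=
  semichar lam ^ n *
    Complex.exp (-(n * Real.pi * Complex.I) * (omega u (latticeVec lam) : ℝ))

/-- `Γ^∞(L^n)`: smooth sections of `L^n`, as quasi-periodic functions on `ℝ^{2g}`. -/
def SmoothSection (g : ℕ) (n : ℤ) : Submodule ℂ (Cover g → ℂ) where
  carrier := {s | ContDiff ℝ ∞ s ∧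
    ∀ (lam : Lattice g) (u : Cover g), s (u + latticeVec lam) = autFactor n lam u * s u}
  add_mem' := by
    rintro a b ⟨ha, ha'⟩ ⟨hb, hb'⟩
    refine ⟨ha.add hb, fun lam u => ?_⟩
    simp only [Pi.add_apply, ha', hb']
    ring
  zero_mem' := ⟨contDiff_const, fun lam u => by simp⟩
  smul_mem' := by
    rintro c a ⟨ha, ha'⟩
    refine ⟨contDiff_const.smul ha, fun lam u => ?_⟩
    simp only [Pi.smul_apply, ha', smul_eq_mul]
    ring

/-- The fundamental domain `[0,1]^{2g}` of the torus. -/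
def unitCube (g : ℕ) : Set (Cover g) := Set.Icc 0 1

/-- The inner product `⟨s, s'⟩ = ∫ s \bar{s'}` of smooth sections of `L^n` over the torus. -/
def sectionInner {g : ℕ} {n : ℤ} (s s' : SmoothSection g n) : ℂ :=
  ∫ u in unitCube g, s.1 u * conj (s'.1 u)

/-! ### Distributional sections -/

/-- Linear functionals on `Γ^∞(L^n)` that are continuous for the `C^∞` topology, which is given
by the suprema over the fundamental domain of the derivatives of order at most `N`. -/
def continuousFunctionals (g : ℕ) (n : ℤ) : Submodule ℂ (Module.Dual ℂ (SmoothSection g n)) where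
  carrier := {T | ∃ (N : ℕ) (C : ℝ), ∀ (φ : SmoothSection g n) (M : ℝ),
    (∀ j ≤ N, ∀ u ∈ unitCube g, ‖iteratedFDeriv ℝ j φ.1 u‖ ≤ M) → ‖T φ‖ ≤ C * M}
  add_mem' := by
    rintro S T ⟨N, C, hS⟩ ⟨N', C', hT⟩
    refine ⟨max N N', C + C', fun φ M h => ?_⟩
    have h1 := hS φ M fun j hj => h j (hj.trans (le_max_left _ _))
    have h2 := hT φ M fun j hj => h j (hj.trans (le_max_right _ _))
    calc ‖(S + T) φ‖ ≤ ‖S φ‖ + ‖T φ‖ := norm_add_le _ _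
      _ ≤ (C + C') * M := by linarith
  zero_mem' := ⟨0, 0, fun φ M _ => by simp⟩
  smul_mem' := by
    rintro c T ⟨N, C, hT⟩
    refine ⟨N, ‖c‖ * C, fun φ M h => ?_⟩
    rw [LinearMap.smul_apply, norm_smul, mul_assoc]
    exact mul_le_mul_of_nonneg_left (hT φ M h) (norm_nonneg c)

/-- `Γ^{-∞}(L^k)`: distributional sections of `L^k`, i.e. continuous linear functionals on the
test sections `Γ^∞(L^{-k})`. -/
def DistSection (g k : ℕ) : Type := continuousFunctionals g (-(k : ℤ))

instance (g k : ℕ) : AddCommGroup (DistSection g k) :=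
  inferInstanceAs (AddCommGroup (continuousFunctionals g (-(k : ℤ))))

instance (g k : ℕ) : Module ℂ (DistSection g k) :=
  inferInstanceAs (Module ℂ (continuousFunctionals g (-(k : ℤ))))

/-- Evaluation of a distributional section on a test section. -/
def DistSection.eval {g k : ℕ} (T : DistSection g k) (φ : SmoothSection g (-(k : ℤ))) : ℂ :=
  T.1 φ

/-- The topology of pointwise convergence on test sections. -/
instance (g k : ℕ) : TopologicalSpace (DistSection g k) :=
  TopologicalSpace.induced (fun T φ => DistSection.eval T φ) Pi.topologicalSpace

theorem integrableOn_mul {g : ℕ} {n m : ℤ} (s : SmoothSection g n) (φ : SmoothSection g m) :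
    MeasureTheory.IntegrableOn (fun u => s.1 u * φ.1 u) (unitCube g) :=
  (s.2.1.continuous.mul φ.2.1.continuous).continuousOn.integrableOn_compact isCompact_Icc

/-- The injection `ι : Γ^∞(L^k) → Γ^{-∞}(L^k)`, `ι s (φ) = ∫ s φ`. -/
def smoothToDist {g k : ℕ} (s : SmoothSection g (k : ℤ)) : DistSection g k :=
  ⟨{ toFun := fun φ => ∫ u in unitCube g, s.1 u * φ.1 u
     map_add' := fun φ ψ => by
      rw [← MeasureTheory.integral_add (integrableOn_mul s φ) (integrableOn_mul s ψ)]
      refine MeasureTheory.integral_congr_ae (Filter.Eventually.of_forall fun u => ?_)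
      simp [mul_add]
     map_smul' := fun c φ => by
      rw [RingHom.id_apply, smul_eq_mul, ← MeasureTheory.integral_const_mul]
      refine MeasureTheory.integral_congr_ae (Filter.Eventually.of_forall fun u => ?_)
      simp [mul_left_comm] },
   by
    refine ⟨0, ∫ u in unitCube g, ‖s.1 u‖, fun φ M h => ?_⟩
    rw [← MeasureTheory.integral_mul_const]
    have hc : IsCompact (unitCube g) := isCompact_Icc
    refine MeasureTheory.norm_integral_le_of_norm_le ?_ ?_
    · exact (s.2.1.continuous.norm.mul continuous_const).continuousOn.integrableOn_compact hc
    · refine (MeasureTheory.ae_restrict_iff' hc.measurableSet).2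
        (Filter.Eventually.of_forall fun u hu => ?_)
      rw [norm_mul]
      have := h 0 le_rfl u hu
      rw [norm_iteratedFDeriv_zero] at this
      exact mul_le_mul_of_nonneg_left this (norm_nonneg _)⟩

/-! ### Vector fields and covariant differentiation -/

/-- Smooth complex vector fields on the torus. -/
structure VectorField (g : ℕ) where
  toFun : Cover g → ComplexTangent g
  smooth : ContDiff ℝ ∞ toFun
  periodic : ∀ (lam : Lattice g) (u : Cover g), toFun (u + latticeVec lam) = toFun u

/-- Complex conjugation on `ℂ^{2g}`. -/
def conjTangent {g : ℕ} (v : ComplexTangent g) : ComplexTangent g :=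
  (fun j => conj (v.1 j), fun j => conj (v.2 j))

/-- The conjugate vector field. -/
def VectorField.conj {g : ℕ} (ξ : VectorField g) : VectorField g where
  toFun u := conjTangent (ξ.toFun u)
  smooth := by
    have h := ξ.smooth
    refine ContDiff.prodMk (contDiff_pi.2 fun j => ?_) (contDiff_pi.2 fun j => ?_)
    · exact Complex.conjCLE.contDiff.comp ((contDiff_apply ℝ ℂ j).comp h.fst)
    · exact Complex.conjCLE.contDiff.comp ((contDiff_apply ℝ ℂ j).comp h.snd)
  periodic lam u := by rw [ξ.periodic]

/-- The coordinate vectors `∂/∂x_j` and `∂/∂y_j`. -/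
def dX {g : ℕ} (j : Fin g) : Cover g := (Pi.single j 1, 0)

/-- See `dX`. -/
def dY {g : ℕ} (j : Fin g) : Cover g := (0, Pi.single j 1)

/-- The divergence of a vector field. -/
def VectorField.div {g : ℕ} (ξ : VectorField g) (u : Cover g) : ℂ :=
  ∑ j, ((fderiv ℝ ξ.toFun u (dX j)).1 j + (fderiv ℝ ξ.toFun u (dY j)).2 j)

/-- The derivative `df · v` of a complex function along a complex tangent vector. -/
def dirDeriv {g : ℕ} (f : Cover g → ℂ) (u : Cover g) (v : ComplexTangent g) : ℂ :=
  ∑ j, (v.1 j * fderiv ℝ f u (dX j) + v.2 j * fderiv ℝ f u (dY j))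

/-- The real one-form `∑ (y_j dx_j - x_j dy_j)` at `u`, extended complex linearly. -/
def connForm {g : ℕ} (u : Cover g) (v : ComplexTangent g) : ℂ :=
  ∑ j, ((u.2 j : ℂ) * v.1 j - (u.1 j : ℂ) * v.2 j)

theorem fderiv_translate {g : ℕ} {n : ℤ} (s : SmoothSection g n) (lam : Lattice g)
    (u v : Cover g) :
    fderiv ℝ s.1 (u + latticeVec lam) v =
      autFactor n lam u * (fderiv ℝ s.1 u v
        - n * Real.pi * Complex.I * (omega v (latticeVec lam) : ℝ) * s.1 u) := by
  have hs : Differentiable ℝ s.1 := s.2.1.differentiable (by simp)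
  have hE : (fun w : Cover g => s.1 (w + latticeVec lam)) =
      fun w => autFactor n lam w * s.1 w := funext fun w => s.2.2 lam w
  let l : Cover g →L[ℝ] ℝ := LinearMap.toContinuousLinearMap
    { toFun := fun w => omega w (latticeVec lam)
      map_add' := fun a b => by
        simp only [omega, Prod.fst_add, Prod.snd_add, Pi.add_apply, ← Finset.sum_add_distrib]
        exact Finset.sum_congr rfl fun j _ => by ring
      map_smul' := fun c a => by
        simp only [omega, Prod.smul_fst, Prod.smul_snd, Pi.smul_apply, smul_eq_mul,
          RingHom.id_apply, Finset.mul_sum]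
        exact Finset.sum_congr rfl fun j _ => by ring }
  have hl : ∀ w, l w = omega w (latticeVec lam) := fun w => rfl
  have hlc : HasFDerivAt (fun w : Cover g => ((omega w (latticeVec lam) : ℝ) : ℂ))
      (Complex.ofRealCLM.comp l) u := Complex.ofRealCLM.hasFDerivAt.comp u l.hasFDerivAt
  have he := ((hlc.const_mul (-(n * Real.pi * Complex.I))).cexp).const_mul (semichar lam ^ n)
  have hp := he.mul (hs u).hasFDerivAt
  have h1 : fderiv ℝ (fun w : Cover g => s.1 (w + latticeVec lam)) u =
      fderiv ℝ s.1 (u + latticeVec lam) := fderiv_comp_add_right _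
  rw [← h1, hE]
  have h2 : fderiv ℝ (fun w => autFactor n lam w * s.1 w) u = _ := hp.fderiv
  rw [h2]
  simp only [add_apply, smul_apply, smul_eq_mul,
    ContinuousLinearMap.comp_apply, Complex.ofRealCLM_apply, hl, autFactor]
  ring

theorem contDiff_fst_apply {g : ℕ} (ξ : VectorField g) (j : Fin g) :
    ContDiff ℝ ∞ fun u => (ξ.toFun u).1 j := (contDiff_apply ℝ ℂ j).comp ξ.smooth.fst

theorem contDiff_snd_apply {g : ℕ} (ξ : VectorField g) (j : Fin g) :
    ContDiff ℝ ∞ fun u => (ξ.toFun u).2 j := (contDiff_apply ℝ ℂ j).comp ξ.smooth.snd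

theorem contDiff_fderiv_apply {g : ℕ} {E : Type*} [NormedAddCommGroup E] [NormedSpace ℝ E]
    {f : Cover g → E} (hf : ContDiff ℝ ∞ f) (v : Cover g) :
    ContDiff ℝ ∞ fun u => fderiv ℝ f u v :=
  (hf.fderiv_right (m := ∞) (by simp)).clm_apply contDiff_const

theorem omega_dX {g : ℕ} (j : Fin g) (v : Cover g) : omega (dX j) v = -v.2 j := by
  simp [omega, dX, Pi.single_apply]

theorem omega_dY {g : ℕ} (j : Fin g) (v : Cover g) : omega (dY j) v = v.1 j := by
  simp [omega, dY, Pi.single_apply]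

/-- The covariant derivative on `L^n`,
`∇_ξ s = ds · ξ - n π i s ∑ (y_j dx_j - x_j dy_j) · ξ`. -/
def covDeriv {g : ℕ} {n : ℤ} (ξ : VectorField g) (s : SmoothSection g n) : SmoothSection g n :=
  ⟨fun u => dirDeriv s.1 u (ξ.toFun u)
      - n * Real.pi * Complex.I * s.1 u * connForm u (ξ.toFun u), by
    constructor
    · refine ContDiff.sub (ContDiff.sum fun j _ => ?_) (ContDiff.mul ?_ (ContDiff.sum fun j _ => ?_))
      · exact ((contDiff_fst_apply ξ j).mul (contDiff_fderiv_apply s.2.1 _)).add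
          ((contDiff_snd_apply ξ j).mul (contDiff_fderiv_apply s.2.1 _))
      · exact contDiff_const.mul s.2.1
      · refine ContDiff.sub (ContDiff.mul ?_ (contDiff_fst_apply ξ j))
          (ContDiff.mul ?_ (contDiff_snd_apply ξ j))
        · exact Complex.ofRealCLM.contDiff.comp ((contDiff_apply ℝ ℝ j).comp contDiff_snd)
        · exact Complex.ofRealCLM.contDiff.comp ((contDiff_apply ℝ ℝ j).comp contDiff_fst)
    · intro lam u
      simp only [dirDeriv, connForm, ξ.periodic, s.2.2, fderiv_translate, omega_dX, omega_dY]
      simp only [Finset.mul_sum, mul_sub, ← Finset.sum_sub_distrib]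
      refine Finset.sum_congr rfl fun j _ => ?_
      simp only [latticeVec, Prod.fst_add, Prod.snd_add, Pi.add_apply]
      push_cast
      ring⟩

theorem div_periodic {g : ℕ} (ξ : VectorField g) (lam : Lattice g) (u : Cover g) :
    ξ.div (u + latticeVec lam) = ξ.div u := by
  have h : fderiv ℝ ξ.toFun (u + latticeVec lam) = fderiv ℝ ξ.toFun u := by
    rw [← fderiv_comp_add_right]
    congr 1
    exact funext fun w => ξ.periodic lam w
  simp only [VectorField.div, h]

/-- The section `(div ξ) s`. -/
def divMul {g : ℕ} {n : ℤ} (ξ : VectorField g) (s : SmoothSection g n) : SmoothSection g n :=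
  ⟨fun u => ξ.div u * s.1 u, by
    constructor
    · refine ContDiff.mul (ContDiff.sum fun j _ => ContDiff.add ?_ ?_) s.2.1
      · exact (contDiff_apply ℝ ℂ j).comp (contDiff_fderiv_apply ξ.smooth _).fst
      · exact (contDiff_apply ℝ ℂ j).comp (contDiff_fderiv_apply ξ.smooth _).snd
    · intro lam u
      simp only [div_periodic, s.2.2]
      ring⟩

/-- The weak covariant derivative of a distributional section, evaluated on a test section:
`(∇'_ξ σ)(φ) = -σ((div ξ) φ + ∇_ξ φ)`, with the connection of `L^{-k}` on the right. -/
def weakCovDeriv {g k : ℕ} (ξ : VectorField g) (σ : DistSection g k)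
    (φ : SmoothSection g (-(k : ℤ))) : ℂ :=
  -σ.eval (divMul ξ φ + covDeriv ξ φ)

theorem eval_add {g k : ℕ} (σ τ : DistSection g k) (φ : SmoothSection g (-(k : ℤ))) :
    (σ + τ).eval φ = σ.eval φ + τ.eval φ := rfl

theorem eval_smul {g k : ℕ} (c : ℂ) (σ : DistSection g k) (φ : SmoothSection g (-(k : ℤ))) :
    (c • σ).eval φ = c * σ.eval φ := rfl

/-! ### Invariant polarizations and the Siegel disc -/

/-- Siegel upper half-space: symmetric matrices with positive definite imaginary part. -/
def siegelUpper (g : ℕ) : Set (Matrix (Fin g) (Fin g) ℂ) :=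
  {Ω | Ω.transpose = Ω ∧ (Ω.map Complex.im).PosDef}

/-- The Cayley transform `Ω ↦ (i - Ω)(i + Ω)⁻¹`. -/
def cayley {g : ℕ} (Ω : Matrix (Fin g) (Fin g) ℂ) : Matrix (Fin g) (Fin g) ℂ :=
  (Complex.I • 1 - Ω) * (Complex.I • 1 + Ω)⁻¹

/-- The inverse Cayley transform `τ ↦ i (1 - τ)(1 + τ)⁻¹`. -/
def period {g : ℕ} (τ : Matrix (Fin g) (Fin g) ℂ) : Matrix (Fin g) (Fin g) ℂ :=
  Complex.I • ((1 - τ) * (1 + τ)⁻¹)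

/-- The open Siegel disc. -/
def openDisc (g : ℕ) : Set (Matrix (Fin g) (Fin g) ℂ) := cayley '' siegelUpper g

/-- The closed Siegel disc. -/
def closedDisc (g : ℕ) : Set (Matrix (Fin g) (Fin g) ℂ) := closure (openDisc g)

/-- The invariant polarization `P_τ ⊆ ℂ^{2g}`, spanned for `m = 1, …, g` by
`∑_l (-i (1 - \bar τ)_{lm} ∂/∂x_l + (1 + \bar τ)_{lm} ∂/∂y_l)`. -/
def polarization {g : ℕ} (τ : Matrix (Fin g) (Fin g) ℂ) : Submodule ℂ (ComplexTangent g) :=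
  Submodule.span ℂ (Set.range fun m : Fin g =>
    ((fun l => -Complex.I * (1 - τ.map conj) l m, fun l => (1 + τ.map conj) l m) :
      ComplexTangent g))

/-- Distributional sections of `L^k` that are covariantly constant, in the weak sense, along the
conjugates of the vector fields in `P_τ`. -/
def covConstSections (g k : ℕ) (τ : Matrix (Fin g) (Fin g) ℂ) : Submodule ℂ (DistSection g k) where
  carrier := {σ | ∀ ξ : VectorField g, (∀ u, ξ.toFun u ∈ polarization τ) →
    ∀ φ, weakCovDeriv ξ.conj σ φ = 0}
  add_mem' := by
    intro a b ha hb ξ hξ φ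
    have h1 := ha ξ hξ φ
    have h2 := hb ξ hξ φ
    simp only [weakCovDeriv, eval_add, neg_add] at *
    rw [h1, h2, add_zero]
  zero_mem' := fun ξ _ φ => neg_eq_zero.2 rfl
  smul_mem' := by
    intro c a ha ξ hξ φ
    have h1 := ha ξ hξ φ
    simp only [weakCovDeriv, eval_smul, neg_eq_zero] at *
    rw [h1, mul_zero]

/-! ### Half-forms -/

/-- The Gaussian integral `∫ exp(-π ᵗξ A ξ) dξ` over `ℝ^g`. For symmetric `A` with positive
definite real part this is the standard branch of `(det A)^{-1/2}`. -/
def gaussInt {g : ℕ} (A : Matrix (Fin g) (Fin g) ℂ) : ℂ :=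
  ∫ t : Fin g → ℝ, Complex.exp (-Real.pi * ((fun j => (t j : ℂ)) ⬝ᵥ A.mulVec fun j => (t j : ℂ)))

/-- The branch of `(det (1 + τ))^{1/2}` on the open Siegel disc with value `1` at `τ = 0`. -/
def sqrtDetOneAdd {g : ℕ} (τ : Matrix (Fin g) (Fin g) ℂ) : ℂ := (gaussInt (1 + τ))⁻¹

/-- `(det ((Ω - \bar Ω') / (2 k i)))^{1/2}`, the branch being given by the Gaussian integral. -/
def sqrtDetDiff {g : ℕ} (k : ℕ) (Ω Ω' : Matrix (Fin g) (Fin g) ℂ) : ℂ :=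
  (gaussInt ((1 / (2 * k * Complex.I) : ℂ) • (Ω - Ω'.map conj)))⁻¹

/-- The half-form line over `τ`: the complex line with generator `√(d^g(x,y)_τ)`. A half-form is
given by its coefficient with respect to this generator. -/
def HalfForm {g : ℕ} (_τ : Matrix (Fin g) (Fin g) ℂ) : Type := ℂ

instance {g : ℕ} (τ : Matrix (Fin g) (Fin g) ℂ) : AddCommGroup (HalfForm τ) :=
  inferInstanceAs (AddCommGroup ℂ)

instance {g : ℕ} (τ : Matrix (Fin g) (Fin g) ℂ) : Module ℂ (HalfForm τ) :=
  inferInstanceAs (Module ℂ ℂ)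

/-- The coefficient of a half-form with respect to `√(d^g(x,y)_τ)`. -/
def HalfForm.coeff {g : ℕ} (τ : Matrix (Fin g) (Fin g) ℂ) : HalfForm τ ≃ₗ[ℂ] ℂ :=
  LinearEquiv.refl ℂ ℂ

/-- For `τ` in the open disc and `Ω = Ω(τ)`: the half-form
`√(d^g z_Ω) = (det (1 + τ))^{-1/2} √(d^g(x,y)_τ)`. -/
def sqrtDz {g : ℕ} (τ : Matrix (Fin g) (Fin g) ℂ) : HalfForm τ :=
  (HalfForm.coeff τ).symm (sqrtDetOneAdd τ)⁻¹

/-- The pairing of half-forms over two points of the open disc, normalized by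
`⟨√(d^g z_Ω), √(d^g z_Ω')⟩ = (det ((Ω - \bar Ω') / (2 k i)))^{1/2}`; note
`√(d^g(x,y)_τ) = (det (1 + τ))^{1/2} √(d^g z_Ω)`. -/
def halfFormPairing {g : ℕ} (k : ℕ) {τ τ' : Matrix (Fin g) (Fin g) ℂ}
    (μ : HalfForm τ) (μ' : HalfForm τ') : ℂ :=
  (HalfForm.coeff τ μ * sqrtDetOneAdd τ) * conj (HalfForm.coeff τ' μ' * sqrtDetOneAdd τ') *
    sqrtDetDiff k (period τ) (period τ')

/-! ### The quantum bundle -/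

/-- The quantum space `Q_τ = \tilde Q_τ ⊗ ℂ √(d^g(x,y)_τ)`. -/
abbrev QuantumSpace (g k : ℕ) (τ : Matrix (Fin g) (Fin g) ℂ) : Type :=
  (covConstSections g k τ) ⊗[ℂ] (HalfForm τ)

/-- The distributional section `σ` in `σ √(d^g(x,y)_τ)`. -/
def QuantumSpace.toDist {g k : ℕ} {τ : Matrix (Fin g) (Fin g) ℂ} :
    QuantumSpace g k τ →ₗ[ℂ] DistSection g k :=
  (covConstSections g k τ).subtype ∘ₗ (TensorProduct.rid ℂ (covConstSections g k τ)).toLinearMap ∘ₗ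
    (TensorProduct.map LinearMap.id (HalfForm.coeff τ).toLinearMap)

/-- The total space of the quantum bundle over the closed Siegel disc. -/
structure QuantumBundle (g k : ℕ) where
  base : closedDisc g
  vec : QuantumSpace g k base.1

/-- The quantum bundle is topologized as a subspace of
`closedDisc × Γ^{-∞}(L^k) √(d^g(x,y)_.)`. -/
instance (g k : ℕ) : TopologicalSpace (QuantumBundle g k) :=
  TopologicalSpace.induced (fun q => (q.base, QuantumSpace.toDist q.vec))
    (inferInstanceAs (TopologicalSpace (closedDisc g × DistSection g k)))

/-- Families of sesquilinear pairings (linear in the first variable, conjugate linear in the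
second one) `Q_τ × Q_τ' → ℂ`, for `τ, τ'` in the closed disc. -/
abbrev PairingFamily (g k : ℕ) : Type :=
  ∀ τ τ' : closedDisc g, QuantumSpace g k τ.1 →ₗ[ℂ] QuantumSpace g k τ'.1 →ₗ⋆[ℂ] ℂ

/-- The BKS pairing: over the open disc it is the product of the inner product of sections and the
pairing of half-forms, and it is continuous on the quantum bundle over the closed disc. -/
structure IsBKSPairing {g k : ℕ} (P : PairingFamily g k) : Prop where
  interior : ∀ τ τ' : closedDisc g, τ.1 ∈ openDisc g → τ'.1 ∈ openDisc g →
    ∀ (s s' : SmoothSection g (k : ℤ)) (hs : smoothToDist s ∈ covConstSections g k τ.1)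
      (hs' : smoothToDist s' ∈ covConstSections g k τ'.1) (μ : HalfForm τ.1) (μ' : HalfForm τ'.1),
      P τ τ' (⟨smoothToDist s, hs⟩ ⊗ₜ[ℂ] μ) (⟨smoothToDist s', hs'⟩ ⊗ₜ[ℂ] μ') =
        sectionInner s s' * halfFormPairing k μ μ'
  continuous : Continuous fun q : QuantumBundle g k × QuantumBundle g k =>
    P q.1.base q.2.base q.1.vec q.2.vec

/-- The theta function `ϑ^l_Ω(x, y)` of level `k`, where `0 ≤ l_j < k` represents a class in
`ℤ^g / k ℤ^g`. -/
def thetaFun {g k : ℕ} (l : Fin g → Fin k) (Ω : Matrix (Fin g) (Fin g) ℂ) (u : Cover g) : ℂ :=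
  Complex.exp (-(k * Real.pi * Complex.I) * ∑ j, (u.1 j : ℂ) * (u.2 j : ℂ)) *
    ∑' m : Fin g → ℤ,
      let w : Fin g → ℂ := fun j => (u.2 j : ℂ) - (m j : ℂ) - ((l j : ℕ) : ℂ) / k
      Complex.exp (k * Real.pi * Complex.I * (w ⬝ᵥ Ω.mulVec w) +
        k * (2 * Real.pi * Complex.I) * ∑ j, ((m j : ℂ) + ((l j : ℕ) : ℂ) / k) * (u.1 j : ℂ))

/-- The frame `σ^l_τ`: over the open disc `σ^l_τ = ϑ^l_Ω √(d^g z_Ω)` with `Ω = Ω(τ)`, and each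
`τ ↦ σ^l_τ` is a continuous section of the quantum bundle over the closed disc. -/
structure IsThetaFrame {g k : ℕ}
    (σ : (Fin g → Fin k) → ∀ τ : closedDisc g, QuantumSpace g k τ.1) : Prop where
  interior : ∀ (l : Fin g → Fin k) (τ : closedDisc g), τ.1 ∈ openDisc g →
    ∃ (s : SmoothSection g (k : ℤ)) (hs : smoothToDist s ∈ covConstSections g k τ.1),
      (∀ u, s.1 u = thetaFun l (period τ.1) u) ∧ σ l τ = ⟨smoothToDist s, hs⟩ ⊗ₜ[ℂ] sqrtDz τ.1
  continuous : ∀ l, Continuous fun τ : closedDisc g => (⟨τ, σ l τ⟩ : QuantumBundle g k)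

/-- The maps `B_{τ,τ'} : Q_τ → Q_τ'` are the pairing maps of `P`:
`⟨B_{τ,τ'} a, b⟩_{Q_τ'} = ⟨a, b⟩_{BKS}`, where the inner product of `Q_τ'` is the pairing of
`Q_τ'` with itself. -/
def IsPairingMap {g k : ℕ} (P : PairingFamily g k)
    (B : ∀ τ τ' : closedDisc g, QuantumSpace g k τ.1 →ₗ[ℂ] QuantumSpace g k τ'.1) : Prop :=
  ∀ (τ τ' : closedDisc g) (a : QuantumSpace g k τ.1) (b : QuantumSpace g k τ'.1),
    P τ' τ' (B τ τ' a) b = P τ τ' a b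

end TorusBKS

end

/-! The proof finds finitely many test sections that determine a covariantly constant distribution
for every `τ` in the closed disc at once. They are the `k^g` vacua `classVacuum`, the conjugates of
the theta functions at `Ω = i`, that is, at `τ = 0`. They are annihilated by covariant
differentiation along all vectors `(-i q, q)`.

Every real vector `v` is the sum of an antiholomorphic vector for `τ` and a vector `(-i q, q)`. If
`T` is covariantly constant for `τ` and `φ` is a vacuum, then `T` kills derivatives of the first
kind, while derivatives of the second kind act on the transports of `φ` along `t v` by a curvature
scalar. So `t ↦ T (transport (t v) φ)` solves a scalar linear equation, and `eval_transport` gives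
`T (transport v φ) = T φ * exp (-(π k / 2) (|z|² - z·τz))` with `z = y - i x`. Since `τ` is a
contraction, this factor has modulus at most `1`, also on the boundary.

Multiplying a vacuum by a character of the torus is, up to a phase, transporting another vacuum by a
vector of `k⁻¹ ℤ^{2g}`. Finitely many transports of one vacuum have no common zero, so every test
section is a finite sum of periodic functions times transported vacua. Expanding the periodic
functions in Fourier series, which a distribution respects term by term, gives `T = ∑ l, T
(classVacuum l) • K l τ`, with kernels `K l τ` that are continuous in `τ` on the closed disc
(`exists_kernel`).

Over the open disc, integration over `x` makes theta functions of different classes orthogonal, and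
unfolding the integral over `y` turns the pairing of equal classes into a Gaussian integral
(`sectionInner_thetaSection`). Against the vacua this gives `(2k)^{-g/2} det(1+τ)^{1/2}`, hence `ϑ^l
= (2k)^{-g/2} det(1+τ)^{1/2} K l τ`. The factor `det(1+τ)^{-1/2}` of the half-form cancels the only
part that degenerates at the boundary, so `(2k)^{-g/2} K l τ` is the continuous extension of `σ^l`.
Covariant constancy and duality to the vacua pass to the closed disc by density (`exists_frame`).

The Gaussian in the pairing of `ϑ^l_Ω` with `ϑ^l_Ω'` is, up to a constant, the inverse of the
half-form pairing, by `gaussInt_pairingMatrix_mul_sqrtDetDiff`. Thus the frames satisfy `⟨σ^l_τ,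
σ^m_τ'⟩ = δ_{lm} (2k²)^{-g/2}` for all `τ`, `τ'`. In frame coordinates the pairing is a fixed
positive multiple of the standard Hermitian form, and the pairing maps are the identity, which gives
positivity, unitarity, transitivity and parallelism. -/

namespace TorusBKS

open Matrix MeasureTheory

/-! ### Gaussian integrals -/

/-- Symmetric complex matrices with positive definite real part. -/
def rightHalf (g : ℕ) : Set (Matrix (Fin g) (Fin g) ℂ) :=
  {A | A.transpose = A ∧ (A.map Complex.re).PosDef}

/-- A real vector as a complex vector. -/
def ofRealVec {g : ℕ} (t : Fin g → ℝ) : Fin g → ℂ := fun j => (t j : ℂ)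

theorem ofRealVec_mulVec {g : ℕ} (C : Matrix (Fin g) (Fin g) ℝ) (t : Fin g → ℝ) :
    ofRealVec (C *ᵥ t) = C.map Complex.ofReal *ᵥ ofRealVec t := by
  ext j
  simp [ofRealVec, mulVec, dotProduct]

/-- Factor `X = Bᵀ B` and diagonalize the symmetric matrix `B⁻ᵀ Y B⁻¹` by an orthogonal `V`. Then `C
= Vᵀ B` works for both, since `V` drops out of `Cᵀ C`. -/
theorem exists_simultaneous_diagonalization {g : ℕ} {X Y : Matrix (Fin g) (Fin g) ℝ}
    (hX : X.PosDef) (hY : Yᵀ = Y) :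
    ∃ (C : Matrix (Fin g) (Fin g) ℝ) (e : Fin g → ℝ), C.det ≠ 0 ∧
      X = Cᵀ * C ∧ Y = Cᵀ * diagonal e * C := by
  obtain ⟨B, hB⟩ : ∃ B : Matrix (Fin g) (Fin g) ℝ, X = Bᵀ * B := by
    open scoped MatrixOrder in
    obtain ⟨B, hB⟩ := CStarAlgebra.nonneg_iff_eq_star_mul_self.mp hX.posSemidef.nonneg
    exact ⟨B, hB⟩
  have hdet : B.det ≠ 0 := by
    have h := hX.det_pos.ne'
    rw [hB, det_mul, det_transpose] at h
    exact left_ne_zero_of_mul h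
  have hu : IsUnit B.det := isUnit_iff_ne_zero.2 hdet
  have hH : ((B⁻¹)ᵀ * Y * B⁻¹).IsHermitian := by
    simp [IsHermitian, conjTranspose_eq_transpose_of_trivial, transpose_mul, hY, mul_assoc]
  set V : Matrix (Fin g) (Fin g) ℝ := hH.eigenvectorUnitary.1 with hV
  have hVV : V * Vᵀ = 1 := by
    have := Matrix.mem_unitaryGroup_iff.1 hH.eigenvectorUnitary.2
    simpa [star_eq_conjTranspose, conjTranspose_eq_transpose_of_trivial] using this
  have hspec : (B⁻¹)ᵀ * Y * B⁻¹ = V * diagonal hH.eigenvalues * Vᵀ := by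
    conv_lhs => rw [hH.spectral_theorem]
    simp [star_eq_conjTranspose, conjTranspose_eq_transpose_of_trivial, hV]
  refine ⟨Vᵀ * B, hH.eigenvalues, ?_, ?_, ?_⟩
  · rw [det_mul, det_transpose]
    refine mul_ne_zero ?_ hdet
    intro h0
    have := congrArg det hVV
    simp [h0] at this
  · rw [hB, transpose_mul, transpose_transpose]
    calc Bᵀ * B = Bᵀ * (V * Vᵀ) * B := by rw [hVV, mul_one]
      _ = _ := by simp only [mul_assoc]
  · rw [transpose_mul, transpose_transpose]
    calc Y = Bᵀ * ((B⁻¹)ᵀ * Y * B⁻¹) * B := by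
          have h1 : Bᵀ * (B⁻¹)ᵀ = 1 := by
            rw [← transpose_mul, nonsing_inv_mul _ hu, transpose_one]
          calc Y = (Bᵀ * (B⁻¹)ᵀ) * Y * (B⁻¹ * B) := by
                rw [h1, nonsing_inv_mul _ hu, one_mul, mul_one]
            _ = _ := by simp only [mul_assoc]
      _ = Bᵀ * (V * diagonal hH.eigenvalues * Vᵀ) * B := congrArg (fun Z => Bᵀ * Z * B) hspec
      _ = _ := by simp only [mul_assoc]

/-- Normalizing the real part to the identity leaves diagonal entries `1 + i e_j`, whose real part
is positive. That `C` is real matters: it serves as a change of variables in the Gaussian integral.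
-/
theorem exists_diagonalization {g : ℕ} {A : Matrix (Fin g) (Fin g) ℂ} (hA : A ∈ rightHalf g) :
    ∃ (C : Matrix (Fin g) (Fin g) ℝ) (d : Fin g → ℂ), C.det ≠ 0 ∧ (∀ j, 0 < (d j).re) ∧
      A = (C.map Complex.ofReal)ᵀ * diagonal d * C.map Complex.ofReal := by
  have hY : (A.map Complex.im)ᵀ = A.map Complex.im := by
    rw [← transpose_map, hA.1]
  obtain ⟨C, e, hC, hX, hYe⟩ := exists_simultaneous_diagonalization hA.2 hY
  refine ⟨C, fun j => 1 + e j * Complex.I, hC, fun j => by simp, ?_⟩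
  have h1 : (diagonal fun j => (1 + e j * Complex.I : ℂ)) =
      1 + Complex.I • (diagonal e).map Complex.ofReal := by
    ext i j
    by_cases h : i = j
    · subst h; simp [mul_comm]
    · simp [h]
  have h2 : A = (A.map Complex.re).map Complex.ofReal +
      Complex.I • (A.map Complex.im).map Complex.ofReal := by
    ext i j
    simp [mul_comm Complex.I, Complex.re_add_im]
  have hm : ∀ M N : Matrix (Fin g) (Fin g) ℝ,
      (M * N).map Complex.ofReal = M.map Complex.ofReal * N.map Complex.ofReal :=
    fun M N => Matrix.map_mul (f := Complex.ofRealHom)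
  rw [h1, h2, hX, hYe, hm, hm, hm, mul_add, add_mul, mul_one, mul_smul_comm, smul_mul_assoc,
    transpose_map]

theorem integral_comp_mulVec {g : ℕ} {C : Matrix (Fin g) (Fin g) ℝ} (hC : C.det ≠ 0)
    (f : (Fin g → ℝ) → ℂ) : ∫ t, f (C *ᵥ t) = (|C.det|⁻¹ : ℝ) * ∫ t, f t := by
  have hu : IsUnit C.det := isUnit_iff_ne_zero.2 hC
  have hcont : ∀ M : Matrix (Fin g) (Fin g) ℝ, Measurable (toLin' M) := fun M =>
    (LinearMap.continuous_on_pi _).measurable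
  let e : (Fin g → ℝ) ≃ᵐ (Fin g → ℝ) :=
    { toFun := toLin' C
      invFun := toLin' C⁻¹
      left_inv := fun t => by simp [nonsing_inv_mul _ hu]
      right_inv := fun t => by simp [mul_nonsing_inv _ hu]
      measurable_toFun := hcont C
      measurable_invFun := hcont C⁻¹ }
  have h := integral_map_equiv (μ := (volume : Measure (Fin g → ℝ))) e f
  have h2 : Measure.map e volume = ENNReal.ofReal (abs (det C)⁻¹) • volume :=
    Real.map_matrix_volume_pi_eq_smul_volume_pi hC
  rw [h2, integral_smul_measure, ENNReal.toReal_ofReal (abs_nonneg _), abs_inv] at h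
  rw [← Complex.real_smul, h]
  rfl

/-- The substitution `s = C t` splits the integral into one-dimensional Gaussians. This identifies
the branch: a product of principal square roots. -/
theorem gaussInt_diagonalization {g : ℕ} {C : Matrix (Fin g) (Fin g) ℝ} (hC : C.det ≠ 0)
    {d : Fin g → ℂ} (hd : ∀ j, 0 < (d j).re) :
    gaussInt ((C.map Complex.ofReal)ᵀ * diagonal d * C.map Complex.ofReal) =
      (|C.det|⁻¹ : ℝ) * ∏ j, (1 / d j) ^ (1 / 2 : ℂ) := by
  have h1 : ∀ t : Fin g → ℝ, ofRealVec t ⬝ᵥ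
      (((C.map Complex.ofReal)ᵀ * diagonal d * C.map Complex.ofReal) *ᵥ ofRealVec t) =
      ∑ j, d j * (((C *ᵥ t) j : ℝ) : ℂ) ^ 2 := by
    intro t
    rw [mul_assoc, ← mulVec_mulVec, ← mulVec_mulVec, ← ofRealVec_mulVec, mulVec_transpose,
      dotProduct_comm, ← dotProduct_mulVec, ← ofRealVec_mulVec]
    simp only [dotProduct, mulVec_diagonal, ofRealVec]
    exact Finset.sum_congr rfl fun j _ => by ring
  have h2 : gaussInt ((C.map Complex.ofReal)ᵀ * diagonal d * C.map Complex.ofReal) =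
      ∫ t : Fin g → ℝ, (fun s : Fin g → ℝ =>
        ∏ j, Complex.exp (-(Real.pi * d j) * ((s j : ℝ) : ℂ) ^ 2)) (C *ᵥ t) := by
    refine integral_congr_ae (Filter.Eventually.of_forall fun t => ?_)
    change Complex.exp (-Real.pi * (ofRealVec t ⬝ᵥ _ *ᵥ ofRealVec t)) = _
    rw [h1]
    simp only
    rw [← Complex.exp_sum, Finset.mul_sum]
    congr 1
    exact Finset.sum_congr rfl fun j _ => by ring
  rw [h2, integral_comp_mulVec hC (fun s : Fin g → ℝ =>
    ∏ j, Complex.exp (-(Real.pi * d j) * ((s j : ℝ) : ℂ) ^ 2))]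
  congr 1
  rw [integral_fintype_prod_volume_eq_prod (fun j (x : ℝ) =>
    Complex.exp (-(Real.pi * d j) * (x : ℂ) ^ 2))]
  refine Finset.prod_congr rfl fun j _ => ?_
  rw [integral_gaussian_complex (by simpa using mul_pos Real.pi_pos (hd j))]
  congr 1
  have : d j ≠ 0 := fun h => by simpa [h] using hd j
  have hp : (Real.pi : ℂ) ≠ 0 := by exact_mod_cast Real.pi_ne_zero
  field_simp

theorem one_div_cpow_half_sq {d : ℂ} : ((1 / d) ^ (1 / 2 : ℂ)) ^ 2 = d⁻¹ := by
  rw [← Complex.cpow_nat_mul]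
  simp

theorem gaussInt_sq {g : ℕ} {A : Matrix (Fin g) (Fin g) ℂ} (hA : A ∈ rightHalf g) :
    gaussInt A ^ 2 = A.det⁻¹ := by
  obtain ⟨C, d, hC, hd, rfl⟩ := exists_diagonalization hA
  rw [gaussInt_diagonalization hC hd, mul_pow, ← Finset.prod_pow]
  have h1 : (C.map Complex.ofReal).det = ((C.det : ℝ) : ℂ) := (RingHom.map_det Complex.ofRealHom C).symm
  have h2 : ((|C.det|⁻¹ : ℝ) : ℂ) ^ 2 = ((C.det : ℝ) : ℂ)⁻¹ * ((C.det : ℝ) : ℂ)⁻¹ := by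
    rw [← Complex.ofReal_pow, inv_pow, sq_abs]
    push_cast
    rw [sq, mul_inv]
  simp only [one_div_cpow_half_sq, det_mul, det_transpose, det_diagonal, h1, h2, mul_inv,
    Finset.prod_inv_distrib]
  ring

theorem det_ne_zero_of_mem_rightHalf {g : ℕ} {A : Matrix (Fin g) (Fin g) ℂ}
    (hA : A ∈ rightHalf g) : A.det ≠ 0 := by
  obtain ⟨C, d, hC, hd, rfl⟩ := exists_diagonalization hA
  have h1 : (C.map Complex.ofReal).det = ((C.det : ℝ) : ℂ) := (RingHom.map_det Complex.ofRealHom C).symm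
  simp only [det_mul, det_transpose, det_diagonal, h1]
  have : ∀ j, d j ≠ 0 := fun j h => by simpa [h] using hd j
  have h2 : ((C.det : ℝ) : ℂ) ≠ 0 := by exact_mod_cast hC
  exact mul_ne_zero (mul_ne_zero h2 (Finset.prod_ne_zero_iff.2 fun j _ => this j)) h2

theorem gaussInt_ne_zero {g : ℕ} {A : Matrix (Fin g) (Fin g) ℂ} (hA : A ∈ rightHalf g) :
    gaussInt A ≠ 0 := by
  intro h
  have := gaussInt_sq hA
  rw [h] at this
  exact inv_ne_zero (det_ne_zero_of_mem_rightHalf hA) (by simpa using this.symm)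

theorem one_div_half_mul {d : ℂ} (hd : 0 < d.re) :
    (1 / d⁻¹) ^ (1 / 2 : ℂ) * (1 / d) ^ (1 / 2 : ℂ) = 1 := by
  have h0 : d ≠ 0 := fun h => by simp [h] at hd
  have harg : d.arg ≠ Real.pi := by
    intro h
    rw [Complex.arg_eq_pi_iff] at h
    linarith [h.1]
  rw [one_div, inv_inv, one_div d, Complex.inv_cpow _ _ harg,
    mul_inv_cancel₀ (by simp [Complex.cpow_eq_zero_iff, h0])]

/-- Determinants alone give this only up to sign. The inverse matrix is diagonalized by `C⁻ᵀ` with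
entries `1 / d_j`, and the principal roots of `d_j` and `1 / d_j` are reciprocal because `d_j` has
positive real part. -/
theorem gaussInt_inv_mul {g : ℕ} {A : Matrix (Fin g) (Fin g) ℂ} (hA : A ∈ rightHalf g) :
    gaussInt A⁻¹ * gaussInt A = 1 := by
  obtain ⟨C, d, hC, hd, rfl⟩ := exists_diagonalization hA
  have hu : IsUnit C.det := isUnit_iff_ne_zero.2 hC
  have hd0 : ∀ j, d j ≠ 0 := fun j h => by simpa [h] using hd j
  set D : Matrix (Fin g) (Fin g) ℝ := (C⁻¹)ᵀ with hD
  have hm : ∀ M N : Matrix (Fin g) (Fin g) ℝ,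
      (M * N).map Complex.ofReal = M.map Complex.ofReal * N.map Complex.ofReal :=
    fun M N => Matrix.map_mul (f := Complex.ofRealHom)
  have h1 : (1 : Matrix (Fin g) (Fin g) ℝ).map Complex.ofReal = 1 := by
    ext i j; simp [one_apply]; split_ifs <;> simp
  have hDC : (D.map Complex.ofReal)ᵀ * (C.map Complex.ofReal) = 1 := by
    rw [← transpose_map, ← hm, hD, transpose_transpose, nonsing_inv_mul _ hu, h1]
  have hCD : (C.map Complex.ofReal)ᵀ * (D.map Complex.ofReal) = 1 := by
    rw [← transpose_one, ← hDC, transpose_mul, transpose_transpose]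
  have hCD' : (C.map Complex.ofReal) * (D.map Complex.ofReal)ᵀ = 1 :=
    mul_eq_one_comm.1 hDC
  have hinv : ((C.map Complex.ofReal)ᵀ * diagonal d * C.map Complex.ofReal)⁻¹ =
      (D.map Complex.ofReal)ᵀ * diagonal (fun j => (d j)⁻¹) * D.map Complex.ofReal := by
    refine inv_eq_right_inv ?_
    calc _ = (C.map Complex.ofReal)ᵀ * diagonal d * (C.map Complex.ofReal * (D.map Complex.ofReal)ᵀ) *
          diagonal (fun j => (d j)⁻¹) * D.map Complex.ofReal := by simp only [mul_assoc]
      _ = (C.map Complex.ofReal)ᵀ * (diagonal d * diagonal (fun j => (d j)⁻¹)) *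
          D.map Complex.ofReal := by rw [hCD', mul_one]; simp only [mul_assoc]
      _ = 1 := by
        rw [diagonal_mul_diagonal]
        simp only [mul_inv_cancel₀ (hd0 _), diagonal_one, mul_one, hCD]
  have hDdet : D.det = (C.det)⁻¹ := by
    rw [hD, det_transpose, det_nonsing_inv, Ring.inverse_eq_inv']
  have hdi : ∀ j, 0 < ((d j)⁻¹).re := fun j => by
    rw [Complex.inv_re]
    exact div_pos (hd j) (Complex.normSq_pos.2 (hd0 j))
  rw [hinv, gaussInt_diagonalization (by rw [hDdet]; exact inv_ne_zero hC) hdi,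
    gaussInt_diagonalization hC hd, mul_mul_mul_comm, ← Finset.prod_mul_distrib,
    Finset.prod_congr rfl fun j _ => one_div_half_mul (hd j), Finset.prod_const_one, mul_one,
    hDdet, abs_inv, inv_inv, ← Complex.ofReal_mul, mul_inv_cancel₀ (abs_ne_zero.2 hC),
    Complex.ofReal_one]

theorem gaussInt_smul {g : ℕ} {A : Matrix (Fin g) (Fin g) ℂ} {c : ℝ} (hc : 0 < c) :
    gaussInt ((c : ℂ) • A) = ((Real.sqrt c ^ g)⁻¹ : ℝ) * gaussInt A := by
  have h := Measure.integral_comp_smul_of_nonneg (volume : Measure (Fin g → ℝ))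
    (fun t : Fin g → ℝ => Complex.exp (-Real.pi * (ofRealVec t ⬝ᵥ A *ᵥ ofRealVec t)))
    (Real.sqrt c) (hR := Real.sqrt_nonneg c)
  rw [Module.finrank_fin_fun, Complex.real_smul] at h
  refine Eq.trans ?_ h
  refine integral_congr_ae (Filter.Eventually.of_forall fun t => ?_)
  have hs : ofRealVec (Real.sqrt c • t) = (Real.sqrt c : ℂ) • ofRealVec t := by
    ext j; simp [ofRealVec]
  have hcc : (Real.sqrt c : ℂ) * (Real.sqrt c : ℂ) = c := by
    rw [← Complex.ofReal_mul, Real.mul_self_sqrt hc.le]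
  change Complex.exp (-Real.pi * (ofRealVec t ⬝ᵥ ((c : ℂ) • A) *ᵥ ofRealVec t)) = _
  simp only
  rw [hs, smul_mulVec, mulVec_smul, dotProduct_smul, smul_dotProduct, dotProduct_smul, smul_smul,
    hcc]

theorem one_mem_rightHalf (g : ℕ) : (1 : Matrix (Fin g) (Fin g) ℂ) ∈ rightHalf g := by
  refine ⟨transpose_one, ?_⟩
  have : (1 : Matrix (Fin g) (Fin g) ℂ).map Complex.re = 1 := by
    ext i j; simp [one_apply]; split_ifs <;> simp
  rw [this]
  exact PosDef.one

theorem gaussInt_one (g : ℕ) : gaussInt (1 : Matrix (Fin g) (Fin g) ℂ) = 1 := by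
  have h := gaussInt_diagonalization (g := g) (C := 1) (d := fun _ => 1) (by simp) (by simp)
  have h1 : (1 : Matrix (Fin g) (Fin g) ℝ).map Complex.ofReal = 1 := by
    ext i j; simp [one_apply]; split_ifs <;> simp
  simpa [h1] using h


/-- Coercivity: with `M = Bᵀ B` the form is `|B t|²`, and `|t|² ≤ F |B t|²` where `F` is the squared
Frobenius norm of `B⁻¹`. -/
theorem exists_mul_sum_sq_le {g : ℕ} {M : Matrix (Fin g) (Fin g) ℝ} (hM : M.PosDef) :
    ∃ c : ℝ, 0 < c ∧ ∀ t : Fin g → ℝ, c * ∑ j, t j ^ 2 ≤ t ⬝ᵥ M *ᵥ t := by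
  obtain ⟨B, e, hdet, hB, -⟩ := exists_simultaneous_diagonalization hM (transpose_zero (α := ℝ))
  have hu : IsUnit B.det := isUnit_iff_ne_zero.2 hdet
  set F : ℝ := ∑ j, ∑ i, (B⁻¹ j i) ^ 2 with hF
  have hF0 : 0 ≤ F := Finset.sum_nonneg fun j _ => Finset.sum_nonneg fun i _ => sq_nonneg _
  -- The summand `1` covers `g = 0`, where `F = 0`.
  refine ⟨(F + 1)⁻¹, by positivity, fun t => ?_⟩
  have h1 : t ⬝ᵥ M *ᵥ t = ∑ i, (B *ᵥ t) i ^ 2 := by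
    rw [hB, ← mulVec_mulVec, mulVec_transpose, dotProduct_comm, ← dotProduct_mulVec]
    simp only [dotProduct, sq]
  have h2 : ∑ j, t j ^ 2 ≤ F * ∑ i, (B *ᵥ t) i ^ 2 := by
    have ht : t = B⁻¹ *ᵥ (B *ᵥ t) := by rw [mulVec_mulVec, nonsing_inv_mul _ hu, one_mulVec]
    calc ∑ j, t j ^ 2 = ∑ j, (∑ i, B⁻¹ j i * (B *ᵥ t) i) ^ 2 := by
          refine Finset.sum_congr rfl fun j _ => ?_
          conv_lhs => rw [ht]
          rfl
      _ ≤ ∑ j, (∑ i, B⁻¹ j i ^ 2) * ∑ i, (B *ᵥ t) i ^ 2 :=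
          Finset.sum_le_sum fun j _ => Finset.sum_mul_sq_le_sq_mul_sq _ _ _
      _ = _ := by rw [← Finset.sum_mul]
  have h3 : 0 ≤ ∑ i, (B *ᵥ t) i ^ 2 := Finset.sum_nonneg fun i _ => sq_nonneg _
  rw [h1, inv_mul_le_iff₀ (by positivity)]
  linarith

theorem re_ofRealVec_dotProduct_mulVec {g : ℕ} (A : Matrix (Fin g) (Fin g) ℂ) (t : Fin g → ℝ) :
    (ofRealVec t ⬝ᵥ A *ᵥ ofRealVec t).re = t ⬝ᵥ A.map Complex.re *ᵥ t := by
  simp [ofRealVec, dotProduct, mulVec]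

theorem im_ofRealVec_dotProduct_mulVec {g : ℕ} (A : Matrix (Fin g) (Fin g) ℂ) (t : Fin g → ℝ) :
    (ofRealVec t ⬝ᵥ A *ᵥ ofRealVec t).im = t ⬝ᵥ A.map Complex.im *ᵥ t := by
  simp [ofRealVec, dotProduct, mulVec]

theorem mem_rightHalf_iff {g : ℕ} {A : Matrix (Fin g) (Fin g) ℂ} : A ∈ rightHalf g ↔
    Aᵀ = A ∧ ∀ t : Fin g → ℝ, t ≠ 0 → 0 < (ofRealVec t ⬝ᵥ A *ᵥ ofRealVec t).re := by
  refine and_congr_right fun h => ⟨fun hA t ht => ?_, fun hA => ?_⟩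
  · rw [re_ofRealVec_dotProduct_mulVec]
    simpa using hA.dotProduct_mulVec_pos ht
  · refine PosDef.of_dotProduct_mulVec_pos ?_ fun t ht => ?_
    · rw [IsHermitian, conjTranspose_eq_transpose_of_trivial, ← transpose_map, h]
    · rw [star_trivial, ← re_ofRealVec_dotProduct_mulVec]
      exact hA t ht

theorem integrable_exp_neg_mul_sum_sq {g : ℕ} {c : ℝ} (hc : 0 < c) :
    Integrable fun t : Fin g → ℝ => Real.exp (-c * ∑ j, t j ^ 2) := by
  have h : Integrable (fun t : Fin g → ℝ => ∏ j, Real.exp (-c * t j ^ 2)) :=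
    Integrable.fintype_prod (f := fun _ x => Real.exp (-c * x ^ 2))
      fun _ => integrable_exp_neg_mul_sq hc
  refine h.congr (Filter.Eventually.of_forall fun t => ?_)
  simp only
  rw [← Real.exp_sum, Finset.mul_sum]

theorem norm_dotProduct_mulVec_le {g : ℕ} {A : Matrix (Fin g) (Fin g) ℂ} {ε : ℝ}
    (hA : ∀ i j, ‖A i j‖ ≤ ε) (t : Fin g → ℝ) :
    ‖ofRealVec t ⬝ᵥ A *ᵥ ofRealVec t‖ ≤ ε * g * ∑ j, t j ^ 2 := by
  have h1 : ‖ofRealVec t ⬝ᵥ A *ᵥ ofRealVec t‖ ≤ ∑ i, ∑ j, ε * (|t i| * |t j|) := by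
    simp only [dotProduct, mulVec, Finset.mul_sum]
    refine (norm_sum_le _ _).trans (Finset.sum_le_sum fun i _ => (norm_sum_le _ _).trans
      (Finset.sum_le_sum fun j _ => ?_))
    simp only [norm_mul, ofRealVec, Complex.norm_real, Real.norm_eq_abs]
    nlinarith [mul_le_mul_of_nonneg_right (hA i j)
      (mul_nonneg (abs_nonneg (t i)) (abs_nonneg (t j)))]
  refine h1.trans ?_
  rcases isEmpty_or_nonempty (Fin g) with h | ⟨⟨i⟩⟩
  · simp
  have hε : 0 ≤ ε := (norm_nonneg _).trans (hA i i)
  have h2 : (∑ i, |t i|) ^ 2 ≤ g * ∑ j, t j ^ 2 := by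
    have := sq_sum_le_card_mul_sum_sq (s := Finset.univ) (f := fun i => |t i|)
    simpa using this
  have h3 : ∑ i, ∑ j, ε * (|t i| * |t j|) = ε * (∑ i, |t i|) ^ 2 := by
    rw [sq, Finset.sum_mul_sum, Finset.mul_sum]
    simp only [Finset.mul_sum]
  rw [h3, mul_assoc]
  exact mul_le_mul_of_nonneg_left h2 hε

theorem continuous_quadratic {g : ℕ} (A : Matrix (Fin g) (Fin g) ℂ) :
    Continuous fun t : Fin g → ℝ => ofRealVec t ⬝ᵥ A *ᵥ ofRealVec t := by
  simp only [ofRealVec, dotProduct, mulVec]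
  fun_prop

theorem norm_exp_quadratic {g : ℕ} (A : Matrix (Fin g) (Fin g) ℂ) (t : Fin g → ℝ) :
    ‖Complex.exp (-Real.pi * (ofRealVec t ⬝ᵥ A *ᵥ ofRealVec t))‖ =
      Real.exp (-Real.pi * (ofRealVec t ⬝ᵥ A *ᵥ ofRealVec t).re) := by
  rw [Complex.norm_exp]
  simp

theorem integrable_exp_quadratic {g : ℕ} {A : Matrix (Fin g) (Fin g) ℂ} (hA : A ∈ rightHalf g) :
    Integrable fun t : Fin g → ℝ =>
      Complex.exp (-Real.pi * (ofRealVec t ⬝ᵥ A *ᵥ ofRealVec t)) := by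
  obtain ⟨c, hc, h⟩ := exists_mul_sum_sq_le hA.2
  refine (integrable_exp_neg_mul_sum_sq (g := g) (mul_pos Real.pi_pos hc)).mono'
    ((continuous_const.mul (continuous_quadratic A)).cexp.aestronglyMeasurable)
    (Filter.Eventually.of_forall fun t => ?_)
  rw [norm_exp_quadratic, Real.exp_le_exp, re_ofRealVec_dotProduct_mulVec]
  nlinarith [mul_le_mul_of_nonneg_left (h t) Real.pi_pos.le]

/-- Dominated convergence. A small entrywise perturbation of `A` costs at most half of the
coercivity constant `c`, so the other half gives a common Gaussian majorant. -/
theorem continuousOn_gaussInt (g : ℕ) : ContinuousOn (gaussInt (g := g)) (rightHalf g) := by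
  intro A hA
  refine ContinuousAt.continuousWithinAt ?_
  obtain ⟨c, hc, h⟩ := exists_mul_sum_sq_le hA.2
  -- A form with entries at most `ε` is bounded by `ε g |t|²`, which has to stay below `(c / 2)
  -- |t|²`; `g + 1` avoids dividing by zero.
  set ε : ℝ := c / (2 * (g + 1)) with hε
  have hε0 : 0 < ε := by positivity
  have hεg : ε * g ≤ c / 2 := by
    rw [hε, div_mul_eq_mul_div, div_le_div_iff₀ (by positivity) (by positivity)]
    nlinarith
  have hnear : ∀ᶠ B in nhds A, ∀ i j, ‖(B - A) i j‖ ≤ ε := by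
    refine Filter.eventually_all.2 fun i => Filter.eventually_all.2 fun j => ?_
    have hcont : Continuous fun B : Matrix (Fin g) (Fin g) ℂ => ‖(B - A) i j‖ := by
      simp only [Matrix.sub_apply]
      fun_prop
    have := hcont.continuousAt (x := A)
    have h0 : ‖(A - A) i j‖ < ε := by simpa using hε0
    exact (this.eventually (gt_mem_nhds h0)).mono fun B hB => le_of_lt hB
  have : FirstCountableTopology (Matrix (Fin g) (Fin g) ℂ) :=
    inferInstanceAs (FirstCountableTopology (Fin g → Fin g → ℂ))
  refine continuousAt_of_dominated
    (bound := fun t => Real.exp (-(Real.pi * (c / 2)) * ∑ j, t j ^ 2)) ?_ ?_ ?_ ?_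
  · exact Filter.Eventually.of_forall fun B =>
      ((continuous_const.mul (continuous_quadratic B)).cexp.aestronglyMeasurable)
  · filter_upwards [hnear] with B hB
    refine Filter.Eventually.of_forall fun t => ?_
    refine (norm_exp_quadratic B t).trans_le ?_
    rw [Real.exp_le_exp]
    have h1 := norm_dotProduct_mulVec_le hB t
    have h2 : ofRealVec t ⬝ᵥ B *ᵥ ofRealVec t = ofRealVec t ⬝ᵥ A *ᵥ ofRealVec t +
        ofRealVec t ⬝ᵥ (B - A) *ᵥ ofRealVec t := by
      rw [← dotProduct_add, ← add_mulVec, add_sub_cancel]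
    have h3 := (Complex.abs_re_le_norm _).trans h1
    have h4 := h t
    rw [← re_ofRealVec_dotProduct_mulVec] at h4
    have hS : 0 ≤ ∑ j, t j ^ 2 := Finset.sum_nonneg fun i _ => sq_nonneg _
    have h5 : (c / 2) * ∑ j, t j ^ 2 ≤ (ofRealVec t ⬝ᵥ B *ᵥ ofRealVec t).re := by
      rw [h2, Complex.add_re]
      have := (abs_le.1 h3).1
      nlinarith [mul_le_mul_of_nonneg_right hεg hS]
    nlinarith [mul_le_mul_of_nonneg_left h5 Real.pi_pos.le]
  · exact integrable_exp_neg_mul_sum_sq (mul_pos Real.pi_pos (by positivity))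
  · refine Filter.Eventually.of_forall fun t => ?_
    refine Continuous.continuousAt ?_
    simp only [dotProduct, mulVec]
    fun_prop

end TorusBKS

namespace TorusBKS

open Matrix

/-! ### The Siegel disc -/

theorem neg_I_smul_mem_rightHalf {g : ℕ} {Ω : Matrix (Fin g) (Fin g) ℂ} (hΩ : Ω ∈ siegelUpper g) :
    -Complex.I • Ω ∈ rightHalf g := by
  refine ⟨by rw [transpose_smul, hΩ.1], ?_⟩
  have : (-Complex.I • Ω).map Complex.re = Ω.map Complex.im := by
    ext i j; simp
  rw [this]
  exact hΩ.2

theorem add_mem_rightHalf {g : ℕ} {A B : Matrix (Fin g) (Fin g) ℂ} (hA : A ∈ rightHalf g)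
    (hB : B ∈ rightHalf g) : A + B ∈ rightHalf g := by
  refine ⟨by rw [transpose_add, hA.1, hB.1], ?_⟩
  have : (A + B).map Complex.re = A.map Complex.re + B.map Complex.re := by
    ext i j; simp
  rw [this]
  exact hA.2.add hB.2

theorem conj_mem_rightHalf {g : ℕ} {A : Matrix (Fin g) (Fin g) ℂ} (hA : A ∈ rightHalf g) :
    A.map conj ∈ rightHalf g := by
  refine ⟨by rw [← transpose_map, hA.1], ?_⟩
  have : (A.map conj).map Complex.re = A.map Complex.re := by
    ext i j; simp
  rw [this]
  exact hA.2

theorem I_smul_one_mem_siegelUpper (g : ℕ) :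
    (Complex.I • 1 : Matrix (Fin g) (Fin g) ℂ) ∈ siegelUpper g := by
  refine ⟨by rw [transpose_smul, transpose_one], ?_⟩
  have : (Complex.I • 1 : Matrix (Fin g) (Fin g) ℂ).map Complex.im = 1 := by
    ext i j; simp [one_apply]; split_ifs <;> simp
  rw [this]
  exact PosDef.one

theorem isUnit_det_I_add {g : ℕ} {Ω : Matrix (Fin g) (Fin g) ℂ} (hΩ : Ω ∈ siegelUpper g) :
    IsUnit (Complex.I • 1 + Ω).det := by
  have h := det_ne_zero_of_mem_rightHalf
    (add_mem_rightHalf (one_mem_rightHalf g) (neg_I_smul_mem_rightHalf hΩ))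
  have h2 : Complex.I • 1 + Ω = Complex.I • (1 + -Complex.I • Ω) := by
    rw [smul_add, smul_smul]; simp
  rw [h2, det_smul]
  exact isUnit_iff_ne_zero.2 (mul_ne_zero (pow_ne_zero _ Complex.I_ne_zero) h)

theorem cayley_mul {g : ℕ} {Ω : Matrix (Fin g) (Fin g) ℂ} (hΩ : Ω ∈ siegelUpper g) :
    cayley Ω * (Complex.I • 1 + Ω) = Complex.I • 1 - Ω := by
  rw [cayley, mul_assoc, nonsing_inv_mul _ (isUnit_det_I_add hΩ), mul_one]

theorem one_add_cayley_mul {g : ℕ} {Ω : Matrix (Fin g) (Fin g) ℂ} (hΩ : Ω ∈ siegelUpper g) :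
    (1 + cayley Ω) * (Complex.I • 1 + Ω) = (2 * Complex.I) • 1 := by
  rw [add_mul, one_mul, cayley_mul hΩ, two_mul, add_smul]
  abel

theorem one_sub_cayley_mul {g : ℕ} {Ω : Matrix (Fin g) (Fin g) ℂ} (hΩ : Ω ∈ siegelUpper g) :
    (1 - cayley Ω) * (Complex.I • 1 + Ω) = (2 : ℂ) • Ω := by
  rw [sub_mul, one_mul, cayley_mul hΩ, two_smul]
  abel

theorem one_add_cayley_inv {g : ℕ} {Ω : Matrix (Fin g) (Fin g) ℂ} (hΩ : Ω ∈ siegelUpper g) :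
    (1 + cayley Ω)⁻¹ = (2 * Complex.I)⁻¹ • (Complex.I • 1 + Ω) := by
  refine inv_eq_right_inv ?_
  rw [mul_smul_comm, one_add_cayley_mul hΩ, smul_smul, inv_mul_cancel₀ (by simp), one_smul]

theorem period_cayley {g : ℕ} {Ω : Matrix (Fin g) (Fin g) ℂ} (hΩ : Ω ∈ siegelUpper g) :
    period (cayley Ω) = Ω := by
  rw [period, one_add_cayley_inv hΩ, mul_smul_comm, one_sub_cayley_mul hΩ, smul_smul, smul_smul]
  have : Complex.I * ((2 * Complex.I)⁻¹ * 2) = 1 := by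
    have := Complex.I_ne_zero
    field_simp
  rw [mul_assoc, this, one_smul]

theorem period_mem_siegelUpper {g : ℕ} {τ : Matrix (Fin g) (Fin g) ℂ} (hτ : τ ∈ openDisc g) :
    period τ ∈ siegelUpper g := by
  obtain ⟨Ω, hΩ, rfl⟩ := hτ
  rwa [period_cayley hΩ]

theorem isUnit_det_one_add {g : ℕ} {τ : Matrix (Fin g) (Fin g) ℂ} (hτ : τ ∈ openDisc g) :
    IsUnit (1 + τ).det := by
  obtain ⟨Ω, hΩ, rfl⟩ := hτ
  have h := congrArg det (one_add_cayley_mul hΩ)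
  rw [det_mul, det_smul, det_one, mul_one] at h
  refine isUnit_iff_ne_zero.2 fun h0 => ?_
  rw [h0, zero_mul] at h
  exact pow_ne_zero (Fintype.card (Fin g)) (show (2 * Complex.I : ℂ) ≠ 0 by simp) h.symm

theorem period_mul_one_add {g : ℕ} {τ : Matrix (Fin g) (Fin g) ℂ} (hτ : τ ∈ openDisc g) :
    period τ * (1 + τ) = Complex.I • (1 - τ) := by
  rw [period, smul_mul_assoc, mul_assoc, nonsing_inv_mul _ (isUnit_det_one_add hτ), mul_one]

/-- Up to the factor `k`, the left side is the Gaussian matrix of a theta function paired with the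
vacuum at `Ω = i`. This is how `det (1 + τ)` enters. -/
theorem one_add_neg_I_smul_period {g : ℕ} {τ : Matrix (Fin g) (Fin g) ℂ} (hτ : τ ∈ openDisc g) :
    1 + -Complex.I • period τ = (2 : ℂ) • (1 + τ)⁻¹ := by
  obtain ⟨Ω, hΩ, rfl⟩ := hτ
  rw [period_cayley hΩ, one_add_cayley_inv hΩ, smul_smul, smul_add, smul_smul]
  have h : 2 * (2 * Complex.I)⁻¹ = -Complex.I := by
    rw [mul_inv, Complex.inv_I]; ring
  rw [h]
  simp

/-- The two factors of the Cayley transform are symmetric and commute. -/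
theorem transpose_of_mem_openDisc {g : ℕ} {τ : Matrix (Fin g) (Fin g) ℂ} (hτ : τ ∈ openDisc g) :
    τᵀ = τ := by
  obtain ⟨Ω, hΩ, rfl⟩ := hτ
  have hu := isUnit_det_I_add hΩ
  have hT : (Complex.I • 1 + Ω)ᵀ = Complex.I • 1 + Ω := by
    rw [transpose_add, transpose_smul, transpose_one, hΩ.1]
  have hT' : (Complex.I • 1 - Ω)ᵀ = Complex.I • 1 - Ω := by
    rw [transpose_sub, transpose_smul, transpose_one, hΩ.1]
  have hc : (Complex.I • 1 + Ω) * (Complex.I • 1 - Ω) = (Complex.I • 1 - Ω) * (Complex.I • 1 + Ω) := by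
    have hI : Complex.I • (1 : Matrix (Fin g) (Fin g) ℂ) * Ω = Ω * Complex.I • 1 := by simp
    rw [add_mul, mul_sub, mul_sub, sub_mul, mul_add, mul_add, hI]
    abel
  have h1 : (Complex.I • 1 + Ω) * (cayley Ω)ᵀ = Complex.I • 1 - Ω := by
    rw [← hT', ← cayley_mul hΩ, transpose_mul, hT]
  calc (cayley Ω)ᵀ = ((Complex.I • 1 + Ω)⁻¹ * (Complex.I • 1 + Ω)) * (cayley Ω)ᵀ := by
        rw [nonsing_inv_mul _ hu, one_mul]
    _ = (Complex.I • 1 + Ω)⁻¹ * (Complex.I • 1 - Ω) * ((Complex.I • 1 + Ω) * (Complex.I • 1 + Ω)⁻¹) := by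
        rw [mul_assoc, h1, mul_nonsing_inv _ hu, mul_one]
    _ = (Complex.I • 1 + Ω)⁻¹ * ((Complex.I • 1 - Ω) * (Complex.I • 1 + Ω)) * (Complex.I • 1 + Ω)⁻¹ := by
        simp only [mul_assoc]
    _ = cayley Ω := by
        rw [← hc, ← mul_assoc, nonsing_inv_mul _ hu, one_mul, cayley]

/-- The squared Hermitian norm of a complex vector. -/
def normSqVec {g : ℕ} (v : Fin g → ℂ) : ℝ := ∑ j, Complex.normSq (v j)

/-- The difference of squared norms is `4 x* (Im Ω) x`. The terms with `Re Ω` cancel by the symmetry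
of `Ω`. Positivity of `Im Ω` thereby becomes the contraction property of `τ`. -/
theorem normSqVec_sub_normSqVec {g : ℕ} {Ω : Matrix (Fin g) (Fin g) ℂ} (hΩ : Ωᵀ = Ω)
    (x : Fin g → ℂ) :
    normSqVec ((Complex.I • 1 + Ω) *ᵥ x) - normSqVec ((Complex.I • 1 - Ω) *ᵥ x) =
      4 * ((fun j => (x j).re) ⬝ᵥ Ω.map Complex.im *ᵥ (fun j => (x j).re) +
        (fun j => (x j).im) ⬝ᵥ Ω.map Complex.im *ᵥ (fun j => (x j).im)) := by
  have hsym : ∑ i, ∑ j, (Ω i j).re * ((x i).re * (x j).im) =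
      ∑ i, ∑ j, (Ω i j).re * ((x i).im * (x j).re) := by
    rw [Finset.sum_comm]
    refine Finset.sum_congr rfl fun i _ => Finset.sum_congr rfl fun j _ => ?_
    have : Ω j i = Ω i j := congrFun (congrFun hΩ i) j
    rw [this]
    ring
  have h1 : ∀ i, Complex.normSq (((Complex.I • 1 + Ω) *ᵥ x) i) -
      Complex.normSq (((Complex.I • 1 - Ω) *ᵥ x) i) =
      ∑ j, (4 * ((x i).re * ((Ω i j).im * (x j).re)) + 4 * ((x i).im * ((Ω i j).im * (x j).im)) +
        4 * ((Ω i j).re * ((x i).re * (x j).im)) - 4 * ((Ω i j).re * ((x i).im * (x j).re))) := by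
    intro i
    have e1 : ((Complex.I • 1 + Ω) *ᵥ x) i = Complex.I * x i + (Ω *ᵥ x) i := by
      simp [add_mulVec, smul_mulVec]
    have e2 : ((Complex.I • 1 - Ω) *ᵥ x) i = Complex.I * x i - (Ω *ᵥ x) i := by
      simp [sub_mulVec, smul_mulVec]
    have e3 : ((Ω *ᵥ x) i).re = ∑ j, ((Ω i j).re * (x j).re - (Ω i j).im * (x j).im) := by
      simp [mulVec, dotProduct]
    have e4 : ((Ω *ᵥ x) i).im = ∑ j, ((Ω i j).re * (x j).im + (Ω i j).im * (x j).re) := by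
      simp [mulVec, dotProduct]
    have e5 : Complex.normSq (Complex.I * x i + (Ω *ᵥ x) i) -
        Complex.normSq (Complex.I * x i - (Ω *ᵥ x) i) =
        4 * (x i).re * ((Ω *ᵥ x) i).im - 4 * (x i).im * ((Ω *ᵥ x) i).re := by
      simp [Complex.normSq_apply]
      ring
    rw [e1, e2, e5, e3, e4, Finset.mul_sum, Finset.mul_sum, ← Finset.sum_sub_distrib]
    exact Finset.sum_congr rfl fun j _ => by ring
  have hq : ∀ a : Fin g → ℝ, a ⬝ᵥ Ω.map Complex.im *ᵥ a =
      ∑ i, ∑ j, a i * ((Ω i j).im * a j) := fun a => by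
    simp only [dotProduct, mulVec, map_apply, Finset.mul_sum]
  rw [normSqVec, normSqVec, ← Finset.sum_sub_distrib, Finset.sum_congr rfl fun i _ => h1 i, hq, hq]
  simp only [Finset.sum_sub_distrib, Finset.sum_add_distrib, ← Finset.mul_sum]
  simp only [Finset.mul_sum] at hsym ⊢
  simp only [← Finset.mul_sum] at hsym ⊢
  rw [hsym]
  ring

/-- With `y = (i + Ω) x` one has `τ y = (i - Ω) x`, so the preceding identity applies. -/
theorem normSqVec_mulVec_lt {g : ℕ} {τ : Matrix (Fin g) (Fin g) ℂ} (hτ : τ ∈ openDisc g)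
    {y : Fin g → ℂ} (hy : y ≠ 0) : normSqVec (τ *ᵥ y) < normSqVec y := by
  obtain ⟨Ω, hΩ, rfl⟩ := hτ
  set x := (Complex.I • 1 + Ω)⁻¹ *ᵥ y with hx
  have hyx : y = (Complex.I • 1 + Ω) *ᵥ x := by
    rw [hx, mulVec_mulVec, mul_nonsing_inv _ (isUnit_det_I_add hΩ), one_mulVec]
  have hx0 : x ≠ 0 := by
    intro h
    rw [h, mulVec_zero] at hyx
    exact hy hyx
  rw [hyx, mulVec_mulVec, cayley_mul hΩ, ← sub_pos, normSqVec_sub_normSqVec hΩ.1]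
  have hnn : ∀ a : Fin g → ℝ, 0 ≤ a ⬝ᵥ Ω.map Complex.im *ᵥ a := fun a => by
    simpa using hΩ.2.posSemidef.dotProduct_mulVec_nonneg a
  have hpos : ∀ a : Fin g → ℝ, a ≠ 0 → 0 < a ⬝ᵥ Ω.map Complex.im *ᵥ a := fun a ha => by
    simpa using hΩ.2.dotProduct_mulVec_pos ha
  by_cases h : (fun j => (x j).re) = 0
  · have h' : (fun j => (x j).im) ≠ 0 := by
      intro h'
      exact hx0 (funext fun j => Complex.ext (congrFun h j) (congrFun h' j))
    linarith [hnn fun j => (x j).re, hpos _ h']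
  · linarith [hnn fun j => (x j).im, hpos _ h]

theorem normSqVec_nonneg {g : ℕ} (v : Fin g → ℂ) : 0 ≤ normSqVec v :=
  Finset.sum_nonneg fun _ _ => Complex.normSq_nonneg _

theorem norm_dotProduct_sq_le {g : ℕ} (v w : Fin g → ℂ) :
    ‖v ⬝ᵥ w‖ ^ 2 ≤ normSqVec v * normSqVec w := by
  have h1 : ‖v ⬝ᵥ w‖ ≤ ∑ j, ‖v j‖ * ‖w j‖ :=
    (norm_sum_le _ _).trans (Finset.sum_le_sum fun j _ => (norm_mul _ _).le)
  calc ‖v ⬝ᵥ w‖ ^ 2 ≤ (∑ j, ‖v j‖ * ‖w j‖) ^ 2 := by gcongr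
    _ ≤ (∑ j, ‖v j‖ ^ 2) * ∑ j, ‖w j‖ ^ 2 := Finset.sum_mul_sq_le_sq_mul_sq _ _ _
    _ = _ := by simp only [normSqVec, Complex.normSq_eq_norm_sq]

theorem norm_dotProduct_mulVec_le_normSqVec {g : ℕ} {τ : Matrix (Fin g) (Fin g) ℂ}
    {z : Fin g → ℂ} (h : normSqVec (τ *ᵥ z) ≤ normSqVec z) : ‖z ⬝ᵥ τ *ᵥ z‖ ≤ normSqVec z := by
  refine abs_le_of_sq_le_sq' ?_ (normSqVec_nonneg z) |>.2
  refine (norm_dotProduct_sq_le _ _).trans ?_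
  rw [sq]
  exact mul_le_mul_of_nonneg_left h (normSqVec_nonneg z)

/-- Strict contraction and Cauchy–Schwarz give `|t·τt| < |t|²` for real `t ≠ 0`. -/
theorem one_add_mem_rightHalf {g : ℕ} {τ : Matrix (Fin g) (Fin g) ℂ} (hτ : τ ∈ openDisc g) :
    1 + τ ∈ rightHalf g := by
  refine mem_rightHalf_iff.2 ⟨?_, fun t ht => ?_⟩
  · rw [transpose_add, transpose_one, transpose_of_mem_openDisc hτ]
  have ht' : ofRealVec t ≠ 0 := by
    intro h
    exact ht (funext fun j => by simpa [ofRealVec] using congrFun h j)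
  have h1 := normSqVec_mulVec_lt hτ ht'
  have hpos : 0 < normSqVec (ofRealVec t) := (normSqVec_nonneg _).trans_lt h1
  have h2 : ‖ofRealVec t ⬝ᵥ τ *ᵥ ofRealVec t‖ < normSqVec (ofRealVec t) := by
    refine lt_of_pow_lt_pow_left₀ 2 hpos.le ?_
    refine (norm_dotProduct_sq_le _ _).trans_lt ?_
    rw [sq]
    exact mul_lt_mul_of_pos_left h1 hpos
  have h3 : (ofRealVec t ⬝ᵥ ofRealVec t).re = normSqVec (ofRealVec t) := by
    simp [ofRealVec, dotProduct, normSqVec, Complex.normSq_apply]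
  rw [add_mulVec, one_mulVec, dotProduct_add, Complex.add_re, h3]
  have := (abs_le.1 (Complex.abs_re_le_norm (ofRealVec t ⬝ᵥ τ *ᵥ ofRealVec t))).1
  linarith

/-- The weak inequality is a closed condition, so it survives on the boundary, where the strict one
may fail. It is what bounds the weights of the kernels. -/
theorem normSqVec_mulVec_le {g : ℕ} {τ : Matrix (Fin g) (Fin g) ℂ} (hτ : τ ∈ closedDisc g)
    (y : Fin g → ℂ) : normSqVec (τ *ᵥ y) ≤ normSqVec y := by
  have hc : IsClosed {τ : Matrix (Fin g) (Fin g) ℂ | normSqVec (τ *ᵥ y) ≤ normSqVec y} := by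
    refine isClosed_le ?_ continuous_const
    simp only [normSqVec, mulVec, dotProduct]
    exact continuous_finsetSum _ fun i _ => Complex.continuous_normSq.comp (by fun_prop)
  refine closure_minimal (fun σ hσ => ?_) hc hτ
  by_cases hy : y = 0
  · simp [hy]
  · exact (normSqVec_mulVec_lt hσ hy).le

theorem continuousOn_sqrtDetOneAdd (g : ℕ) : ContinuousOn (sqrtDetOneAdd (g := g)) (openDisc g) := by
  refine ContinuousOn.inv₀ ?_ fun τ hτ => gaussInt_ne_zero (one_add_mem_rightHalf hτ)
  exact (continuousOn_gaussInt g).comp (continuous_const.add continuous_id).continuousOn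
    fun τ hτ => one_add_mem_rightHalf hτ

theorem sqrtDetOneAdd_sq {g : ℕ} {τ : Matrix (Fin g) (Fin g) ℂ} (hτ : τ ∈ openDisc g) :
    sqrtDetOneAdd τ ^ 2 = (1 + τ).det := by
  rw [sqrtDetOneAdd, inv_pow, gaussInt_sq (one_add_mem_rightHalf hτ), inv_inv]

theorem sqrtDetOneAdd_zero (g : ℕ) : sqrtDetOneAdd (0 : Matrix (Fin g) (Fin g) ℂ) = 1 := by
  rw [sqrtDetOneAdd, add_zero, gaussInt_one, inv_one]

theorem sqrtDetOneAdd_ne_zero {g : ℕ} {τ : Matrix (Fin g) (Fin g) ℂ} (hτ : τ ∈ openDisc g) :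
    sqrtDetOneAdd τ ≠ 0 := inv_ne_zero (gaussInt_ne_zero (one_add_mem_rightHalf hτ))

end TorusBKS

namespace TorusBKS

open Matrix

/-! ### Series of exponentials -/

/-- A finite set of multi-indices lies in the product of its projections, so partial sums are
bounded by the product of the one-dimensional sums. -/
theorem summable_pi_prod {ι α : Type*} [Fintype ι] [DecidableEq ι] [DecidableEq α] {f : ι → α → ℝ}
    (hf : ∀ i a, 0 ≤ f i a) (hs : ∀ i, Summable (f i)) :
    Summable fun m : ι → α => ∏ i, f i (m i) := by
  refine summable_of_sum_le (c := ∏ i, ∑' a, f i a)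
    (fun m => Finset.prod_nonneg fun i _ => hf i _) fun s => ?_
  calc ∑ m ∈ s, ∏ i, f i (m i)
      ≤ ∑ m ∈ Fintype.piFinset fun i => s.image fun m => m i, ∏ i, f i (m i) :=
        Finset.sum_le_sum_of_subset_of_nonneg
          (fun m hm => Fintype.mem_piFinset.2 fun i => Finset.mem_image_of_mem _ hm)
          fun m _ _ => Finset.prod_nonneg fun i _ => hf i _
    _ = ∏ i, ∑ a ∈ s.image fun m => m i, f i a := (Finset.prod_univ_sum _ _).symm
    _ ≤ ∏ i, ∑' a, f i a := Finset.prod_le_prod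
        (fun i _ => Finset.sum_nonneg fun a _ => hf i a)
        fun i _ => (hs i).sum_le_tsum _ fun a _ => hf i a

theorem summable_exp_neg_sum_abs (g : ℕ) :
    Summable fun m : Fin g → ℤ => Real.exp (-∑ j, |(m j : ℝ)|) := by
  have h1 : Summable fun n : ℤ => Real.exp (-|(n : ℝ)|) := by
    have hN : Summable fun n : ℕ => Real.exp (-(n : ℝ)) := by
      simpa using Real.summable_exp_neg_nat
    refine Summable.of_nat_of_neg ?_ ?_ <;> simpa using hN
  refine (summable_pi_prod (fun (_ : Fin g) (n : ℤ) => (Real.exp_pos (-|(n : ℝ)|)).le)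
    fun _ => h1).congr fun m => ?_
  rw [← Real.exp_sum, Finset.sum_neg_distrib]

section ExpSeries

variable {ι : Type*} {g : ℕ} {E : Type*} [NormedAddCommGroup E] [NormedSpace ℝ E]

/-- The coefficients `c i` decay faster than any exponential in `N i`. -/
def RapidDecay (N : ι → Fin g → ℝ) (c : ι → ℂ) : Prop :=
  ∀ R : ℝ, Summable fun i => ‖c i‖ * Real.exp (R * ∑ j, |N i j|)

/-- The series of exponentials `∑ c_i exp (∑_j N_{ij} Λ_j u)`. -/
noncomputable def expSeries (N : ι → Fin g → ℝ) (Λ : Fin g → E →L[ℝ] ℂ) (c : ι → ℂ) (u : E) : ℂ :=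
  ∑' i, c i * Complex.exp (∑ j, (N i j : ℂ) * Λ j u)

/-- The new factor is at most `exp (∑ |N_j|)`, which raises `R` by one. Differentiating a series
therefore stays within the class. -/
theorem RapidDecay.mul_index {N : ι → Fin g → ℝ} {c : ι → ℂ} (h : RapidDecay N c) (j : Fin g) :
    RapidDecay N fun i => c i * N i j := by
  intro R
  refine (h (R + 1)).of_nonneg_of_le (fun i => by positivity) fun i => ?_
  rw [norm_mul, Complex.norm_real, Real.norm_eq_abs, add_mul, one_mul, Real.exp_add, mul_assoc,
    mul_comm (Real.exp _)]
  have h1 : |N i j| ≤ ∑ j, |N i j| :=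
    Finset.single_le_sum (f := fun j => |N i j|) (fun _ _ => abs_nonneg _) (Finset.mem_univ j)
  have h2 : |N i j| ≤ Real.exp (∑ j, |N i j|) := by
    linarith [Real.add_one_le_exp (∑ j, |N i j|)]
  gcongr

theorem norm_sum_mul_le (N : Fin g → ℝ) (Λ : Fin g → E →L[ℝ] ℂ) (u : E) :
    ‖∑ j, (N j : ℂ) * Λ j u‖ ≤ (∑ j, ‖Λ j‖) * ‖u‖ * ∑ j, |N j| := by
  refine (norm_sum_le _ _).trans ?_
  rw [Finset.mul_sum]
  refine Finset.sum_le_sum fun j _ => ?_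
  rw [norm_mul, Complex.norm_real, Real.norm_eq_abs, mul_comm]
  have h1 : ‖Λ j u‖ ≤ (∑ j, ‖Λ j‖) * ‖u‖ := ((Λ j).le_opNorm u).trans
    (mul_le_mul_of_nonneg_right (Finset.single_le_sum (f := fun j => ‖Λ j‖)
      (fun _ _ => norm_nonneg _) (Finset.mem_univ j)) (norm_nonneg _))
  exact mul_le_mul_of_nonneg_right h1 (abs_nonneg _)

theorem RapidDecay.norm_term_le (N : ι → Fin g → ℝ) (c : ι → ℂ)
    (Λ : Fin g → E →L[ℝ] ℂ) {u : E} {r : ℝ} (hu : ‖u‖ ≤ r) (i : ι) :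
    ‖c i * Complex.exp (∑ j, (N i j : ℂ) * Λ j u)‖ ≤
      ‖c i‖ * Real.exp ((∑ j, ‖Λ j‖) * r * ∑ j, |N i j|) := by
  rw [norm_mul]
  refine mul_le_mul_of_nonneg_left ?_ (norm_nonneg _)
  rw [Complex.norm_exp, Real.exp_le_exp]
  refine (Complex.re_le_norm _).trans ((norm_sum_mul_le (N i) Λ u).trans ?_)
  have : 0 ≤ ∑ j, ‖Λ j‖ := Finset.sum_nonneg fun _ _ => norm_nonneg _
  have : 0 ≤ ∑ j, |N i j| := Finset.sum_nonneg fun _ _ => abs_nonneg _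
  gcongr

theorem RapidDecay.summable {N : ι → Fin g → ℝ} {c : ι → ℂ} (h : RapidDecay N c)
    (Λ : Fin g → E →L[ℝ] ℂ) (u : E) :
    Summable fun i => c i * Complex.exp (∑ j, (N i j : ℂ) * Λ j u) :=
  Summable.of_norm_bounded (h ((∑ j, ‖Λ j‖) * ‖u‖)) fun i =>
    RapidDecay.norm_term_le N c Λ le_rfl i

/-- Termwise differentiation on a ball around the origin containing `u`. The derivative is again
built from such series, with coefficients `c i * N i j`, so smoothness follows by induction. -/
theorem hasFDerivAt_expSeries {N : ι → Fin g → ℝ} {c : ι → ℂ} (h : RapidDecay N c)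
    (Λ : Fin g → E →L[ℝ] ℂ) (u : E) :
    HasFDerivAt (expSeries N Λ c)
      (∑ j, expSeries N Λ (fun i => c i * N i j) u • Λ j) u := by
  set r := ‖u‖ + 1
  set M := ∑ j, ‖Λ j‖ with hM
  let L : ι → E →L[ℝ] ℂ := fun i => ∑ j, (N i j : ℂ) • Λ j
  have hL : ∀ i v, L i v = ∑ j, (N i j : ℂ) * Λ j v := fun i v => by
    simp [L, _root_.sum_apply]
  have hM0 : 0 ≤ M := Finset.sum_nonneg fun _ _ => norm_nonneg _
  have hLn : ∀ i, ‖L i‖ ≤ M * ∑ j, |N i j| := fun i =>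
    ContinuousLinearMap.opNorm_le_bound _
      (mul_nonneg hM0 (Finset.sum_nonneg fun _ _ => abs_nonneg _)) fun v => by
        rw [hL]
        exact (norm_sum_mul_le (N i) Λ v).trans_eq (by ring)
  have hterm : ∀ i v, HasFDerivAt (fun v => c i * Complex.exp (∑ j, (N i j : ℂ) * Λ j v))
      ((c i * Complex.exp (L i v)) • L i) v := by
    intro i v
    have := ((L i).hasFDerivAt (x := v)).cexp.const_mul (c i)
    rw [smul_smul] at this
    simpa only [hL] using this
  have key := hasFDerivAt_tsum_of_isPreconnected (𝕜 := ℝ)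
    -- The exponent `M * r` bounds the exponential on the ball; the extra `1` absorbs the linear
    -- factor `∑ |N i j|` coming from `‖L i‖`.
    (u := fun i => M * (‖c i‖ * Real.exp ((M * r + 1) * ∑ j, |N i j|)))
    ((h (M * r + 1)).mul_left M) Metric.isOpen_ball
    (convex_ball (0 : E) r).isPreconnected (fun i v _ => hterm i v) ?_
    (x₀ := u) (by simp [r]) (h.summable Λ u) (x := u) (by simp [r])
  · have hsum : (∑' i, (c i * Complex.exp (L i u)) • L i) =
        ∑ j, expSeries N Λ (fun i => c i * N i j) u • Λ j := by
      have h1 : ∀ i, (c i * Complex.exp (L i u)) • L i =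
          ∑ j, (c i * N i j * Complex.exp (∑ j, (N i j : ℂ) * Λ j u)) • Λ j := fun i => by
        simp only [L, Finset.smul_sum, smul_smul]
        refine Finset.sum_congr rfl fun j _ => ?_
        rw [← hL]
        congr 1
        simp only [L]
        ring
      simp only [h1]
      rw [Summable.tsum_finsetSum]
      · refine Finset.sum_congr rfl fun j _ => ?_
        rw [Summable.tsum_smul_const ((h.mul_index j).summable Λ u)]
        rfl
      · exact fun j _ => ((h.mul_index j).summable Λ u).smul_const _
    rw [← hsum]
    exact key
  · intro i v hv
    have hv' : ‖v‖ ≤ r := (mem_ball_zero_iff.1 hv).le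
    rw [norm_smul]
    have h1 := RapidDecay.norm_term_le N c Λ hv' i
    rw [← hL] at h1
    set S := ∑ j, |N i j| with hS
    have hS0 : 0 ≤ S := Finset.sum_nonneg fun _ _ => abs_nonneg _
    have h2 : ‖L i‖ ≤ M * Real.exp S :=
      (hLn i).trans (mul_le_mul_of_nonneg_left (by linarith [Real.add_one_le_exp S]) hM0)
    calc _ ≤ (‖c i‖ * Real.exp (M * r * S)) * (M * Real.exp S) := by gcongr
      _ = _ := by rw [add_mul, one_mul, Real.exp_add]; ring

theorem contDiff_expSeries {N : ι → Fin g → ℝ} {c : ι → ℂ} (h : RapidDecay N c)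
    (Λ : Fin g → E →L[ℝ] ℂ) : ContDiff ℝ ∞ (expSeries N Λ c) := by
  refine contDiff_infty.2 fun n => ?_
  induction n generalizing c with
  | zero =>
    exact contDiff_zero.2 (continuous_iff_continuousAt.2 fun u =>
      (hasFDerivAt_expSeries h Λ u).continuousAt)
  | succ n ih =>
    have h1 : fderiv ℝ (expSeries N Λ c) =
        fun u => ∑ j, expSeries N Λ (fun i => c i * N i j) u • Λ j :=
      funext fun u => (hasFDerivAt_expSeries h Λ u).fderiv
    have : ((n + 1 : ℕ) : WithTop ℕ∞) = n + 1 := by push_cast; rfl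
    rw [this, contDiff_succ_iff_fderiv]
    refine ⟨fun u => (hasFDerivAt_expSeries h Λ u).differentiableAt, by simp, ?_⟩
    rw [h1]
    exact ContDiff.sum fun j _ => (ih (h.mul_index j)).smul contDiff_const

end ExpSeries

/-! ### Theta functions with integral characteristics -/

/-- The vector `m + l / k`. -/
noncomputable def thetaIndex {g : ℕ} (k : ℕ) (l m : Fin g → ℤ) : Fin g → ℝ :=
  fun j => m j + l j / k

/-- The theta function of level `k` for an arbitrary representative `l` of a class modulo `k`. -/
noncomputable def thetaInt {g : ℕ} (k : ℕ) (l : Fin g → ℤ) (Ω : Matrix (Fin g) (Fin g) ℂ)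
    (u : Cover g) : ℂ :=
  Complex.exp (-(k * Real.pi * Complex.I) * ∑ j, (u.1 j : ℂ) * (u.2 j : ℂ)) *
    ∑' m : Fin g → ℤ, Complex.exp (k * Real.pi * Complex.I *
        (ofRealVec (u.2 - thetaIndex k l m) ⬝ᵥ Ω *ᵥ ofRealVec (u.2 - thetaIndex k l m)) +
      k * (2 * Real.pi * Complex.I) * ∑ j, (thetaIndex k l m j : ℂ) * (u.1 j : ℂ))

theorem thetaFun_eq_thetaInt {g k : ℕ} (l : Fin g → Fin k) (Ω : Matrix (Fin g) (Fin g) ℂ) :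
    thetaFun l Ω = thetaInt k (fun j => ((l j : ℕ) : ℤ)) Ω := by
  funext u
  simp only [thetaFun, thetaInt]
  congr 1
  refine tsum_congr fun m => ?_
  have : ofRealVec (u.2 - thetaIndex k (fun j => ((l j : ℕ) : ℤ)) m) =
      fun j => (u.2 j : ℂ) - (m j : ℂ) - ((l j : ℕ) : ℂ) / k := by
    ext j
    simp [ofRealVec, thetaIndex, sub_sub]
  rw [this]
  simp [thetaIndex]

/-- Shifting the representative by `k b` only reindexes the series by `m ↦ m + b`. -/
theorem thetaInt_add_mul {g k : ℕ} (hk : k ≠ 0) (l b : Fin g → ℤ)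
    (Ω : Matrix (Fin g) (Fin g) ℂ) (u : Cover g) :
    thetaInt k (fun j => l j + k * b j) Ω u = thetaInt k l Ω u := by
  have h : ∀ m, thetaIndex k (fun j => l j + k * b j) m = thetaIndex k l (m + b) := fun m => by
    have hk' : (k : ℝ) ≠ 0 := by exact_mod_cast hk
    ext j
    simp only [thetaIndex, Pi.add_apply]
    push_cast
    field_simp
    ring
  simp only [thetaInt, h]
  congr 1
  exact (Equiv.addRight b).tsum_eq fun m => Complex.exp (k * Real.pi * Complex.I *
        (ofRealVec (u.2 - thetaIndex k l m) ⬝ᵥ Ω *ᵥ ofRealVec (u.2 - thetaIndex k l m)) +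
      k * (2 * Real.pi * Complex.I) * ∑ j, (thetaIndex k l m j : ℂ) * (u.1 j : ℂ))

/-- The point `(a, b) / k` of `ℝ^{2g}`. -/
noncomputable def fracVec {g : ℕ} (k : ℕ) (lam : Lattice g) : Cover g :=
  (fun j => (lam.1 j : ℝ) / k, fun j => (lam.2 j : ℝ) / k)

theorem exp_two_pi_I_mul_sum_int {ι : Type*} (s : Finset ι) (m a : ι → ℤ) :
    Complex.exp (2 * Real.pi * Complex.I * ∑ j ∈ s, (m j : ℂ) * (a j : ℂ)) = 1 := by
  have := Complex.exp_int_mul_two_pi_mul_I (∑ j ∈ s, m j * a j)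
  rw [← this]
  congr 1
  push_cast
  ring

/-- The finite Heisenberg group acts on theta functions: translation by `(a, b) / k` shifts the
class by `b` and multiplies by a phase. Both the automorphy under the lattice and the effect of
characters on the vacuum are instances. -/
theorem thetaInt_add_fracVec {g k : ℕ} (hk : k ≠ 0) (l : Fin g → ℤ) (lam : Lattice g)
    (Ω : Matrix (Fin g) (Fin g) ℂ) (u : Cover g) :
    thetaInt k l Ω (u + fracVec k lam) =
      Complex.exp (-(Real.pi * Complex.I) * ((k * omega u (fracVec k lam) : ℝ) : ℂ) +
        Real.pi * Complex.I *
          (∑ j, (2 * (l j : ℂ) * (lam.1 j : ℂ) / k - (lam.1 j : ℂ) * (lam.2 j : ℂ) / k))) *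
      thetaInt k (l - lam.2) Ω u := by
  have hk' : (k : ℂ) ≠ 0 := by exact_mod_cast hk
  have hk'' : (k : ℝ) ≠ 0 := by exact_mod_cast hk
  simp only [thetaInt]
  rw [← tsum_mul_left, ← tsum_mul_left, ← tsum_mul_left]
  refine tsum_congr fun m => ?_
  have h1 : (u + fracVec k lam).2 - thetaIndex k l m = u.2 - thetaIndex k (l - lam.2) m := by
    ext j
    simp only [fracVec, thetaIndex, Prod.snd_add, Pi.add_apply, Pi.sub_apply]
    push_cast
    ring
  rw [h1, ← Complex.exp_add, ← Complex.exp_add, ← Complex.exp_add]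
  -- The translation produces a factor `exp (2 π i m·a)` depending on the summation index; it equals
  -- `1` because `m` and `a` are integral.
  have h2 := exp_two_pi_I_mul_sum_int Finset.univ m lam.1
  refine Eq.trans ?_ (mul_one _)
  rw [← h2, ← Complex.exp_add]
  congr 1
  generalize (ofRealVec (u.2 - thetaIndex k (l - lam.2) m) ⬝ᵥ
    Ω *ᵥ ofRealVec (u.2 - thetaIndex k (l - lam.2) m)) = q
  simp only [omega, thetaIndex, fracVec, Prod.fst_add, Prod.snd_add, Pi.add_apply, Pi.sub_apply]
  push_cast
  have h4 : -(k * Real.pi * Complex.I) * ∑ j, ((u.1 j : ℂ) + lam.1 j / k) * ((u.2 j : ℂ) + lam.2 j / k) +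
      k * (2 * Real.pi * Complex.I) * ∑ j, ((m j : ℂ) + l j / k) * ((u.1 j : ℂ) + lam.1 j / k) =
      -(Real.pi * Complex.I) * (k * ∑ j, ((u.2 j : ℂ) * (lam.1 j / k) - u.1 j * (lam.2 j / k))) +
      Real.pi * Complex.I *
          (∑ j, (2 * (l j : ℂ) * (lam.1 j : ℂ) / k - (lam.1 j : ℂ) * (lam.2 j : ℂ) / k)) +
      -(k * Real.pi * Complex.I) * ∑ j, (u.1 j : ℂ) * u.2 j +
      k * (2 * Real.pi * Complex.I) * ∑ j, ((m j : ℂ) + ((l j : ℂ) - lam.2 j) / k) * (u.1 j : ℂ) +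
      2 * Real.pi * Complex.I * ∑ j, (m j : ℂ) * (lam.1 j : ℂ) := by
    simp only [Finset.mul_sum, ← Finset.sum_add_distrib]
    refine Finset.sum_congr rfl fun j _ => ?_
    field_simp
    ring
  linear_combination h4

/-- A lattice vector is `(k a, k b) / k`; the shift of the class by `k b` is trivial, and the
remaining phase is the factor of automorphy up to `exp (2 π i l·a) = 1`. -/
theorem thetaInt_add_latticeVec {g k : ℕ} (hk : k ≠ 0) (l : Fin g → ℤ) (lam : Lattice g)
    (Ω : Matrix (Fin g) (Fin g) ℂ) (u : Cover g) :
    thetaInt k l Ω (u + latticeVec lam) = autFactor (k : ℤ) lam u * thetaInt k l Ω u := by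
  have hk' : (k : ℝ) ≠ 0 := by exact_mod_cast hk
  have hk'' : (k : ℂ) ≠ 0 := by exact_mod_cast hk
  have h1 : latticeVec lam = fracVec k ((fun j => k * lam.1 j, fun j => k * lam.2 j) : Lattice g) := by
    ext j <;> simp only [latticeVec, fracVec] <;> push_cast <;> field_simp
  have h2 := thetaInt_add_mul hk (fun j => l j - k * lam.2 j) lam.2 Ω u
  have h3 : (fun j => l j - k * lam.2 j + k * lam.2 j) = l := by ext j; ring
  rw [h3] at h2
  conv_lhs => rw [h1, thetaInt_add_fracVec hk]
  rw [h2, ← h1]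
  change _ * thetaInt k (fun j => l j - k * lam.2 j) Ω u = _
  congr 1
  have h4 : semichar lam ^ (k : ℤ) = Complex.exp (-(Real.pi * Complex.I) *
      (k * ∑ j, (lam.1 j : ℂ) * (lam.2 j : ℂ))) := by
    have h5 : (-1 : ℂ) = Complex.exp (-(Real.pi * Complex.I)) := by
      rw [Complex.exp_neg, Complex.exp_pi_mul_I]; norm_num
    rw [semichar, h5, ← Complex.exp_int_mul, ← Complex.exp_int_mul]
    congr 1
    push_cast
    ring
  have h6 := exp_two_pi_I_mul_sum_int Finset.univ l lam.1
  rw [autFactor, h4, ← Complex.exp_add, ← mul_one (Complex.exp (-(Real.pi * Complex.I) *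
      (k * ∑ j, (lam.1 j : ℂ) * (lam.2 j : ℂ)) + _)), ← h6, ← Complex.exp_add]
  congr 1
  push_cast
  have h7 : ∑ j, (2 * (l j : ℂ) * (k * (lam.1 j : ℂ)) / k - (k * (lam.1 j : ℂ)) * (k * (lam.2 j : ℂ)) / k) =
      2 * ∑ j, (l j : ℂ) * (lam.1 j : ℂ) - k * ∑ j, (lam.1 j : ℂ) * (lam.2 j : ℂ) := by
    rw [Finset.mul_sum, Finset.mul_sum, ← Finset.sum_sub_distrib]
    refine Finset.sum_congr rfl fun j _ => ?_
    field_simp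
  rw [h7]
  ring

end TorusBKS

namespace TorusBKS

open Matrix

/-! ### Directional derivatives -/

section DirDeriv

variable {g : ℕ}

theorem dirDeriv_mul {f h : Cover g → ℂ} {u : Cover g} (hf : DifferentiableAt ℝ f u)
    (hh : DifferentiableAt ℝ h u) (w : ComplexTangent g) :
    dirDeriv (fun v => f v * h v) u w = f u * dirDeriv h u w + h u * dirDeriv f u w := by
  simp only [dirDeriv, fderiv_fun_mul hf hh, _root_.add_apply, _root_.smul_apply, smul_eq_mul]
  rw [Finset.mul_sum, Finset.mul_sum, ← Finset.sum_add_distrib]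
  exact Finset.sum_congr rfl fun j _ => by ring

theorem dirDeriv_add {f h : Cover g → ℂ} {u : Cover g} (hf : DifferentiableAt ℝ f u)
    (hh : DifferentiableAt ℝ h u) (w : ComplexTangent g) :
    dirDeriv (fun v => f v + h v) u w = dirDeriv f u w + dirDeriv h u w := by
  simp only [dirDeriv, fderiv_fun_add hf hh, _root_.add_apply]
  rw [← Finset.sum_add_distrib]
  exact Finset.sum_congr rfl fun j _ => by ring

theorem dirDeriv_const (c : ℂ) (u : Cover g) (w : ComplexTangent g) :
    dirDeriv (fun _ => c) u w = 0 := by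
  simp [dirDeriv]

theorem dirDeriv_const_mul {f : Cover g → ℂ} {u : Cover g} (hf : DifferentiableAt ℝ f u) (c : ℂ)
    (w : ComplexTangent g) : dirDeriv (fun v => c * f v) u w = c * dirDeriv f u w := by
  rw [dirDeriv_mul (differentiableAt_const c) hf, dirDeriv_const, mul_zero, add_zero]

theorem dirDeriv_sum {ι : Type*} (s : Finset ι) {f : ι → Cover g → ℂ} {u : Cover g}
    (hf : ∀ i ∈ s, DifferentiableAt ℝ (f i) u) (w : ComplexTangent g) :
    dirDeriv (fun v => ∑ i ∈ s, f i v) u w = ∑ i ∈ s, dirDeriv (f i) u w := by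
  simp only [dirDeriv, fderiv_fun_sum hf, _root_.sum_apply]
  rw [Finset.sum_comm]
  refine Finset.sum_congr rfl fun j _ => ?_
  rw [Finset.mul_sum, Finset.mul_sum, ← Finset.sum_add_distrib]

theorem dirDeriv_cexp {f : Cover g → ℂ} {u : Cover g} (hf : DifferentiableAt ℝ f u)
    (w : ComplexTangent g) :
    dirDeriv (fun v => Complex.exp (f v)) u w = Complex.exp (f u) * dirDeriv f u w := by
  simp only [dirDeriv, hf.hasFDerivAt.cexp.fderiv, _root_.smul_apply, smul_eq_mul]
  rw [Finset.mul_sum]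
  exact Finset.sum_congr rfl fun j _ => by ring

theorem dirDeriv_conj {f : Cover g → ℂ} {u : Cover g} (hf : DifferentiableAt ℝ f u)
    (w : ComplexTangent g) :
    dirDeriv (fun v => conj (f v)) u w = conj (dirDeriv f u (conjTangent w)) := by
  have h : HasFDerivAt (fun v => conj (f v))
      ((Complex.conjCLE : ℂ →L[ℝ] ℂ).comp (fderiv ℝ f u)) u :=
    (Complex.conjCLE : ℂ →L[ℝ] ℂ).hasFDerivAt.comp u hf.hasFDerivAt
  simp only [dirDeriv, h.fderiv, map_sum, map_add, map_mul, conjTangent, Complex.conj_conj]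
  rfl

theorem dirDeriv_clm (L : Cover g →L[ℝ] ℂ) (u : Cover g) (w : ComplexTangent g) :
    dirDeriv (fun v => L v) u w = ∑ j, (w.1 j * L (dX j) + w.2 j * L (dY j)) := by
  simp only [dirDeriv, ContinuousLinearMap.fderiv]

/-- The coordinate function `x_j`, with values in `ℂ`. -/
noncomputable def coordX (j : Fin g) : Cover g →L[ℝ] ℂ :=
  Complex.ofRealCLM.comp ((ContinuousLinearMap.proj j).comp (ContinuousLinearMap.fst ℝ _ _))

/-- The coordinate function `y_j`, with values in `ℂ`. -/
noncomputable def coordY (j : Fin g) : Cover g →L[ℝ] ℂ :=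
  Complex.ofRealCLM.comp ((ContinuousLinearMap.proj j).comp (ContinuousLinearMap.snd ℝ _ _))

theorem coordX_apply (j : Fin g) (u : Cover g) : coordX j u = (u.1 j : ℂ) := rfl

theorem coordY_apply (j : Fin g) (u : Cover g) : coordY j u = (u.2 j : ℂ) := rfl

theorem dirDeriv_coordX (j : Fin g) (u : Cover g) (w : ComplexTangent g) :
    dirDeriv (fun v => coordX j v) u w = w.1 j := by
  rw [dirDeriv_clm]
  simp [coordX_apply, dX, dY, Pi.single_apply, apply_ite Complex.ofReal]

theorem dirDeriv_coordY (j : Fin g) (u : Cover g) (w : ComplexTangent g) :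
    dirDeriv (fun v => coordY j v) u w = w.2 j := by
  rw [dirDeriv_clm]
  simp [coordY_apply, dX, dY, Pi.single_apply, apply_ite Complex.ofReal]

end DirDeriv

/-! ### Theta functions as holomorphic sections -/

section Theta

variable {g k : ℕ}

/-- The Gaussian coefficients of the theta series. -/
noncomputable def thetaCoeff (k : ℕ) (l : Fin g → ℤ) (Ω : Matrix (Fin g) (Fin g) ℂ)
    (m : Fin g → ℤ) : ℂ :=
  Complex.exp (k * Real.pi * Complex.I *
    (ofRealVec (thetaIndex k l m) ⬝ᵥ Ω *ᵥ ofRealVec (thetaIndex k l m)))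

/-- Coercivity of `Im Ω` gives decay `exp (-a |N|²)`, and completing the square absorbs `R |N|`
while sparing `-|N|` for summability. -/
theorem rapidDecay_thetaCoeff (hk : k ≠ 0) (l : Fin g → ℤ) {Ω : Matrix (Fin g) (Fin g) ℂ}
    (hΩ : Ω ∈ siegelUpper g) : RapidDecay (thetaIndex k l) (thetaCoeff k l Ω) := by
  intro R
  obtain ⟨c, hc, h⟩ := exists_mul_sum_sq_le hΩ.2
  have hk0 : (0 : ℝ) < k := by exact_mod_cast Nat.pos_of_ne_zero hk
  set a : ℝ := k * Real.pi * c with ha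
  have ha0 : 0 < a := by positivity
  have hkey : ∀ s : ℝ, -a * s ^ 2 + R * |s| ≤ (R + 1) ^ 2 / (4 * a) - |s| := by
    intro s
    have h1 : (R + 1) ^ 2 / (4 * a) - |s| - (-a * s ^ 2 + R * |s|) =
        (2 * a * |s| - (R + 1)) ^ 2 / (4 * a) := by
      rw [← sq_abs s]
      field_simp
      ring
    have h2 : 0 ≤ (2 * a * |s| - (R + 1)) ^ 2 / (4 * a) := by positivity
    linarith
  -- The terms `|l_j / k|` pay for replacing `|m_j + l_j / k|` by `|m_j|`.
  set K : ℝ := ∑ j : Fin g, ((R + 1) ^ 2 / (4 * a) + |(l j : ℝ) / k|) with hK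
  refine ((summable_exp_neg_sum_abs g).mul_left (Real.exp K)).of_nonneg_of_le
    (fun m => by positivity) fun m => ?_
  rw [thetaCoeff, Complex.norm_exp, ← Real.exp_add, ← Real.exp_add, Real.exp_le_exp]
  have h1 : (k * Real.pi * Complex.I *
      (ofRealVec (thetaIndex k l m) ⬝ᵥ Ω *ᵥ ofRealVec (thetaIndex k l m))).re =
      -(k * Real.pi * (thetaIndex k l m ⬝ᵥ Ω.map Complex.im *ᵥ thetaIndex k l m)) := by
    rw [← im_ofRealVec_dotProduct_mulVec]
    simp
  rw [h1]
  have h2 : a * ∑ j, thetaIndex k l m j ^ 2 ≤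
      k * Real.pi * (thetaIndex k l m ⬝ᵥ Ω.map Complex.im *ᵥ thetaIndex k l m) := by
    rw [ha, mul_assoc]
    exact mul_le_mul_of_nonneg_left (h _) (by positivity)
  have h3 : ∑ j, (-a * thetaIndex k l m j ^ 2 + R * |thetaIndex k l m j|) ≤
      ∑ j, ((R + 1) ^ 2 / (4 * a) + |(l j : ℝ) / k| - |(m j : ℝ)|) := by
    refine Finset.sum_le_sum fun j _ => (hkey _).trans ?_
    have : |(m j : ℝ)| ≤ |thetaIndex k l m j| + |(l j : ℝ) / k| := by
      have := abs_sub (thetaIndex k l m j) ((l j : ℝ) / k)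
      simpa [thetaIndex] using this
    linarith
  rw [Finset.sum_add_distrib, Finset.sum_sub_distrib, ← hK, ← Finset.mul_sum, ← Finset.mul_sum] at h3
  linarith

/-- The linear functions `2 π i k (x_j - (Ω y)_j)`. -/
noncomputable def thetaLin (k : ℕ) (Ω : Matrix (Fin g) (Fin g) ℂ) (j : Fin g) : Cover g →L[ℝ] ℂ :=
  (2 * Real.pi * Complex.I * k : ℂ) • (coordX j - ∑ i, Ω j i • coordY i)

theorem thetaLin_apply (Ω : Matrix (Fin g) (Fin g) ℂ) (j : Fin g) (u : Cover g) :
    thetaLin k Ω j u = 2 * Real.pi * Complex.I * k * ((u.1 j : ℂ) - (Ω *ᵥ ofRealVec u.2) j) := by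
  simp [thetaLin, _root_.sum_apply, coordX_apply, coordY_apply, mulVec, dotProduct, ofRealVec]

/-- The quadratic exponent in front of the theta series. -/
noncomputable def thetaExponent (k : ℕ) (Ω : Matrix (Fin g) (Fin g) ℂ) (u : Cover g) : ℂ :=
  k * Real.pi * Complex.I * (∑ j, ∑ i, Ω j i * (coordY j u * coordY i u) -
    ∑ j, coordX j u * coordY j u)

/-- Expanding `(y - N) Ω (y - N)` moves the part quadratic in `u` out of the series, which leaves
exponents linear in `u`. -/
theorem thetaInt_eq_expSeries {l : Fin g → ℤ} {Ω : Matrix (Fin g) (Fin g) ℂ} (hΩ : Ωᵀ = Ω)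
    (u : Cover g) : thetaInt k l Ω u = Complex.exp (thetaExponent k Ω u) *
      expSeries (thetaIndex k l) (thetaLin k Ω) (thetaCoeff k l Ω) u := by
  simp only [thetaInt, expSeries, thetaCoeff]
  rw [← tsum_mul_left, ← tsum_mul_left]
  refine tsum_congr fun m => ?_
  rw [← Complex.exp_add, ← Complex.exp_add, ← Complex.exp_add]
  congr 1
  set N := thetaIndex k l m
  have h0 : ofRealVec (u.2 - N) = ofRealVec u.2 - ofRealVec N := by
    ext j; simp [ofRealVec]
  have h1 : ofRealVec N ⬝ᵥ Ω *ᵥ ofRealVec u.2 = ofRealVec u.2 ⬝ᵥ Ω *ᵥ ofRealVec N := by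
    rw [dotProduct_mulVec, ← mulVec_transpose, hΩ, dotProduct_comm]
  have h2 : ∑ j, ∑ i, Ω j i * (coordY j u * coordY i u) = ofRealVec u.2 ⬝ᵥ Ω *ᵥ ofRealVec u.2 := by
    simp only [dotProduct, mulVec, Finset.mul_sum, coordY_apply, ofRealVec]
    exact Finset.sum_congr rfl fun j _ => Finset.sum_congr rfl fun i _ => by ring
  have h3 : ∑ j, (N j : ℂ) * thetaLin k Ω j u = 2 * Real.pi * Complex.I * k *
      (∑ j, (N j : ℂ) * (u.1 j : ℂ) - ofRealVec N ⬝ᵥ Ω *ᵥ ofRealVec u.2) := by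
    simp only [thetaLin_apply, dotProduct]
    rw [← Finset.sum_sub_distrib, Finset.mul_sum]
    exact Finset.sum_congr rfl fun j _ => by simp only [ofRealVec]; ring
  rw [h3, thetaExponent, h2, h0, mulVec_sub, dotProduct_sub, sub_dotProduct, sub_dotProduct, h1]
  simp only [coordX_apply, coordY_apply]
  ring

theorem contDiff_thetaExponent (Ω : Matrix (Fin g) (Fin g) ℂ) :
    ContDiff ℝ ∞ (thetaExponent k Ω) := by
  refine contDiff_const.mul (ContDiff.sub ?_ ?_)
  · exact ContDiff.sum fun j _ => ContDiff.sum fun i _ =>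
      contDiff_const.mul ((coordY j).contDiff.mul (coordY i).contDiff)
  · exact ContDiff.sum fun j _ => (coordX j).contDiff.mul (coordY j).contDiff

theorem contDiff_thetaInt (hk : k ≠ 0) (l : Fin g → ℤ) {Ω : Matrix (Fin g) (Fin g) ℂ}
    (hΩ : Ω ∈ siegelUpper g) : ContDiff ℝ ∞ (thetaInt k l Ω) := by
  rw [funext fun u => thetaInt_eq_expSeries (k := k) (l := l) hΩ.1 u]
  exact (contDiff_thetaExponent Ω).cexp.mul
    (contDiff_expSeries (rapidDecay_thetaCoeff hk l hΩ) _)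

/-- The vectors `w` with `w.1 = Ω w.2` are those annihilating the coordinates `x - Ω y`. Along them
the prefactor alone accounts for the connection form. -/
theorem dirDeriv_thetaExponent {Ω : Matrix (Fin g) (Fin g) ℂ} (hΩ : Ωᵀ = Ω) (u : Cover g)
    {w : ComplexTangent g} (hw : w.1 = Ω *ᵥ w.2) :
    dirDeriv (thetaExponent k Ω) u w = k * Real.pi * Complex.I * connForm u w := by
  have hX : ∀ j, DifferentiableAt ℝ (fun v : Cover g => coordX j v) u :=
    fun j => (coordX j).differentiableAt
  have hY : ∀ j, DifferentiableAt ℝ (fun v : Cover g => coordY j v) u :=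
    fun j => (coordY j).differentiableAt
  have hXY : ∀ j, DifferentiableAt ℝ (fun v : Cover g => -1 * (coordX j v * coordY j v)) u :=
    fun j => ((hX j).fun_mul (hY j)).const_mul _
  have hYY : ∀ j i, DifferentiableAt ℝ (fun v : Cover g => Ω j i * (coordY j v * coordY i v)) u :=
    fun j i => ((hY j).fun_mul (hY i)).const_mul _
  have hYY' : ∀ j, DifferentiableAt ℝ
      (fun v : Cover g => ∑ i, Ω j i * (coordY j v * coordY i v)) u :=
    fun j => DifferentiableAt.fun_sum fun i _ => hYY j i
  have h1 : thetaExponent k Ω = fun u : Cover g => (k * Real.pi * Complex.I) *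
      (∑ j, (∑ i, Ω j i * (coordY j u * coordY i u)) + ∑ j, -1 * (coordX j u * coordY j u)) := by
    funext u
    rw [thetaExponent, sub_eq_add_neg, ← Finset.sum_neg_distrib]
    simp only [neg_one_mul]
  rw [h1, dirDeriv_const_mul ((DifferentiableAt.fun_sum fun j _ => hYY' j).fun_add
    (DifferentiableAt.fun_sum fun j _ => hXY j)), dirDeriv_add
    (DifferentiableAt.fun_sum fun j _ => hYY' j) (DifferentiableAt.fun_sum fun j _ => hXY j),
    dirDeriv_sum _ fun j _ => hYY' j, dirDeriv_sum _ fun j _ => hXY j]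
  congr 1
  have h2 : ∀ j, dirDeriv (fun v : Cover g => ∑ i, Ω j i * (coordY j v * coordY i v)) u w =
      ∑ i, (Ω j i * (u.2 j * w.2 i) + Ω j i * (u.2 i * w.2 j)) := by
    intro j
    rw [dirDeriv_sum _ fun i _ => hYY j i]
    refine Finset.sum_congr rfl fun i _ => ?_
    rw [dirDeriv_const_mul ((hY j).fun_mul (hY i)), dirDeriv_mul (hY j) (hY i), dirDeriv_coordY,
      dirDeriv_coordY, coordY_apply, coordY_apply]
    ring
  have h3 : ∀ j, dirDeriv (fun v : Cover g => -1 * (coordX j v * coordY j v)) u w =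
      -(u.1 j * w.2 j + u.2 j * w.1 j) := by
    intro j
    rw [dirDeriv_const_mul ((hX j).fun_mul (hY j)), dirDeriv_mul (hX j) (hY j), dirDeriv_coordY,
      dirDeriv_coordX, coordX_apply, coordY_apply]
    ring
  have hsym : ∑ j, ∑ i, Ω j i * (u.2 i * w.2 j) = ∑ j, ∑ i, Ω j i * ((u.2 j : ℂ) * w.2 i) := by
    rw [Finset.sum_comm]
    refine Finset.sum_congr rfl fun i _ => Finset.sum_congr rfl fun j _ => ?_
    have : Ω j i = Ω i j := congrFun (congrFun hΩ i) j
    rw [this]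
  simp only [h2, h3, Finset.sum_add_distrib, hsym]
  have h4 : ∑ j, ∑ i, Ω j i * ((u.2 j : ℂ) * w.2 i) = ∑ j, (u.2 j : ℂ) * w.1 j := by
    refine Finset.sum_congr rfl fun j _ => ?_
    rw [hw]
    simp only [mulVec, dotProduct, Finset.mul_sum]
    exact Finset.sum_congr rfl fun i _ => by ring
  rw [h4, connForm, ← Finset.sum_add_distrib, ← Finset.sum_add_distrib]
  exact Finset.sum_congr rfl fun j _ => by ring

/-- The series depends on `u` only through `x - Ω y`, which `w` annihilates. -/
theorem dirDeriv_expSeries_theta (hk : k ≠ 0) (l : Fin g → ℤ) {Ω : Matrix (Fin g) (Fin g) ℂ}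
    (hΩ : Ω ∈ siegelUpper g) (u : Cover g) {w : ComplexTangent g} (hw : w.1 = Ω *ᵥ w.2) :
    dirDeriv (expSeries (thetaIndex k l) (thetaLin k Ω) (thetaCoeff k l Ω)) u w = 0 := by
  simp only [dirDeriv, (hasFDerivAt_expSeries (rapidDecay_thetaCoeff hk l hΩ)
    (thetaLin k Ω) u).fderiv, _root_.sum_apply, _root_.smul_apply, smul_eq_mul, Finset.mul_sum,
    ← Finset.sum_add_distrib]
  rw [Finset.sum_comm]
  refine Finset.sum_eq_zero fun i _ => ?_
  have h1 : ∑ j, (w.1 j * thetaLin k Ω i (dX j) + w.2 j * thetaLin k Ω i (dY j)) = 0 := by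
    rw [← dirDeriv_clm (thetaLin k Ω i) u w]
    have h2 : (fun v => thetaLin k Ω i v) = fun v : Cover g => (2 * Real.pi * Complex.I * k : ℂ) *
        (coordX i v + ∑ j, -Ω i j * coordY j v) := by
      funext v
      rw [thetaLin_apply, sub_eq_add_neg]
      simp [mulVec, dotProduct, coordX_apply, coordY_apply, ofRealVec]
    have hX : DifferentiableAt ℝ (fun v : Cover g => coordX i v) u := (coordX i).differentiableAt
    have hY : ∀ j, DifferentiableAt ℝ (fun v : Cover g => coordY j v) u :=
      fun j => (coordY j).differentiableAt
    rw [h2, dirDeriv_const_mul (hX.fun_add (DifferentiableAt.fun_sum fun j _ => (hY j).const_mul _)),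
      dirDeriv_add hX (DifferentiableAt.fun_sum fun j _ => (hY j).const_mul _),
      dirDeriv_sum _ fun j _ => (hY j).const_mul _, dirDeriv_coordX, hw]
    simp only [dirDeriv_const_mul (hY _), dirDeriv_coordY, mulVec, dotProduct,
      ← Finset.sum_add_distrib]
    simp
  rw [← mul_zero (expSeries (thetaIndex k l) (thetaLin k Ω)
    (fun m => thetaCoeff k l Ω m * thetaIndex k l m i) u), ← h1, Finset.mul_sum]
  exact Finset.sum_congr rfl fun j _ => by ring

/-- The theta function as a smooth section of `L^k`. -/
noncomputable def thetaSection (hk : k ≠ 0) (l : Fin g → ℤ) {Ω : Matrix (Fin g) (Fin g) ℂ}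
    (hΩ : Ω ∈ siegelUpper g) : SmoothSection g (k : ℤ) :=
  ⟨thetaInt k l Ω, contDiff_thetaInt hk l hΩ, fun lam u => thetaInt_add_latticeVec hk l lam Ω u⟩

/-- The constant vector field. -/
def constField (w : ComplexTangent g) : VectorField g where
  toFun _ := w
  smooth := contDiff_const
  periodic _ _ := rfl

theorem covDeriv_apply {n : ℤ} (ξ : VectorField g) (s : SmoothSection g n) (u : Cover g) :
    (covDeriv ξ s).1 u = dirDeriv s.1 u (ξ.toFun u)
      - n * Real.pi * Complex.I * s.1 u * connForm u (ξ.toFun u) := rfl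

theorem differentiable_section {n : ℤ} (s : SmoothSection g n) : Differentiable ℝ s.1 :=
  s.2.1.differentiable (by simp)

theorem covDeriv_thetaSection (hk : k ≠ 0) (l : Fin g → ℤ) {Ω : Matrix (Fin g) (Fin g) ℂ}
    (hΩ : Ω ∈ siegelUpper g) {w : ComplexTangent g} (hw : w.1 = Ω *ᵥ w.2) :
    covDeriv (constField w) (thetaSection hk l hΩ) = 0 := by
  refine Subtype.ext (funext fun u => ?_)
  rw [covDeriv_apply]
  change dirDeriv (thetaInt k l Ω) u w - _ * thetaInt k l Ω u * connForm u w = 0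
  have h1 : DifferentiableAt ℝ (thetaExponent k Ω) u :=
    (contDiff_thetaExponent Ω).differentiable (by simp) u
  have h2 := (hasFDerivAt_expSeries (rapidDecay_thetaCoeff hk l hΩ)
    (thetaLin k Ω) u).differentiableAt
  rw [thetaInt_eq_expSeries hΩ.1, funext fun u => thetaInt_eq_expSeries (k := k) (l := l) hΩ.1 u,
    dirDeriv_mul h1.cexp h2, dirDeriv_expSeries_theta hk l hΩ u hw, dirDeriv_cexp h1,
    dirDeriv_thetaExponent hΩ.1 u hw]
  push_cast
  ring

/-! ### Conjugation of sections -/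

theorem conj_semichar (lam : Lattice g) : conj (semichar lam) = semichar lam := by
  simp [semichar]

theorem semichar_inv (lam : Lattice g) : (semichar lam)⁻¹ = semichar lam := by
  rw [semichar, ← _root_.inv_zpow]
  norm_num

theorem conj_autFactor (n : ℤ) (lam : Lattice g) (u : Cover g) :
    conj (autFactor n lam u) = autFactor (-n) lam u := by
  simp only [autFactor, map_mul, map_zpow₀, conj_semichar, ← Complex.exp_conj]
  rw [_root_.zpow_neg, ← _root_.inv_zpow, semichar_inv]
  congr 2
  simp

/-- The complex conjugate of a section of `L^n` is a section of `L^{-n}`. -/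
noncomputable def conjSection {n : ℤ} (s : SmoothSection g n) : SmoothSection g (-n) :=
  ⟨fun u => conj (s.1 u), Complex.conjCLE.contDiff.comp s.2.1, fun lam u => by
    simp only [s.2.2, map_mul, conj_autFactor]⟩

theorem conjSection_apply {n : ℤ} (s : SmoothSection g n) (u : Cover g) :
    (conjSection s).1 u = conj (s.1 u) := rfl

theorem conjTangent_conjTangent (w : ComplexTangent g) : conjTangent (conjTangent w) = w := by
  simp [conjTangent]

theorem covDeriv_conjSection {n : ℤ} (w : ComplexTangent g) (s : SmoothSection g n) :
    covDeriv (constField w) (conjSection s) =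
      conjSection (covDeriv (constField (conjTangent w)) s) := by
  refine Subtype.ext (funext fun u => ?_)
  rw [covDeriv_apply, conjSection_apply, conjSection_apply, covDeriv_apply]
  change dirDeriv (fun u => conj (s.1 u)) u w - _ * connForm u w = _
  rw [dirDeriv_conj (differentiable_section s u)]
  have : conj (connForm u (conjTangent w)) = connForm u w := by
    simp [connForm, conjTangent]
  change _ = conj (dirDeriv s.1 u (conjTangent w) - n * Real.pi * Complex.I * s.1 u *
    connForm u (conjTangent w))
  rw [map_sub, map_mul, map_mul, map_mul, map_mul, this]
  simp

end Theta

end TorusBKS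

namespace TorusBKS

open Matrix MeasureTheory

/-! ### Inner products of theta functions -/

section Unfolding

variable {g : ℕ}

/-- An integral vector as a real vector. -/
def ofIntVec (m : Fin g → ℤ) : Fin g → ℝ := fun j => (m j : ℝ)

/-- The unit cube with integral corner `m`. -/
def floorCell (m : Fin g → ℤ) : Set (Fin g → ℝ) := {y | ∀ j, ⌊y j⌋ = m j}

theorem measurableSet_floorCell (m : Fin g → ℤ) : MeasurableSet (floorCell m) := by
  have : floorCell m = ⋂ j, (fun y : Fin g → ℝ => ⌊y j⌋) ⁻¹' {m j} := by
    ext y; simp [floorCell]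
  rw [this]
  exact MeasurableSet.iInter fun j =>
    (Int.measurable_floor.comp (measurable_pi_apply j)) (measurableSet_singleton _)

theorem floorCell_zero_ae_eq : floorCell (0 : Fin g → ℤ) =ᵐ[volume] Set.Icc (0 : Fin g → ℝ) 1 := by
  have : floorCell (0 : Fin g → ℤ) = Set.pi Set.univ fun j => Set.Ico ((0 : Fin g → ℝ) j) ((1 : Fin g → ℝ) j) := by
    ext y
    simp [floorCell, Int.floor_eq_zero_iff]
  rw [this]
  exact Measure.univ_pi_Ico_ae_eq_Icc

theorem setIntegral_floorCell {E : Type*} [NormedAddCommGroup E] [NormedSpace ℝ E]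
    (h : (Fin g → ℝ) → E) (m : Fin g → ℤ) :
    ∫ y in floorCell m, h y = ∫ y in Set.Icc (0 : Fin g → ℝ) 1, h (y + ofIntVec m) := by
  rw [← setIntegral_congr_set floorCell_zero_ae_eq,
    ← (measurePreserving_add_right volume (ofIntVec m)).setIntegral_preimage_emb
      (measurableEmbedding_addRight (ofIntVec m)) h (floorCell m)]
  congr 2
  ext y
  simp [floorCell, ofIntVec]

theorem hasSum_setIntegral_Icc {E : Type*} [NormedAddCommGroup E] [NormedSpace ℝ E] [CompleteSpace E]
    {h : (Fin g → ℝ) → E} (hh : Integrable h) :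
    HasSum (fun m : Fin g → ℤ => ∫ y in Set.Icc (0 : Fin g → ℝ) 1, h (y + ofIntVec m)) (∫ y, h y) := by
  have h1 := hasSum_integral_iUnion (μ := volume) (f := h)
    (fun m : Fin g → ℤ => measurableSet_floorCell m) (fun m n hmn => by
      refine Set.disjoint_left.2 fun y hy hy' => hmn (funext fun j => ?_)
      rw [← hy j, hy' j]) hh.integrableOn
  have h2 : (⋃ m : Fin g → ℤ, floorCell m) = Set.univ :=
    Set.eq_univ_of_forall fun y => Set.mem_iUnion.2 ⟨fun j => ⌊y j⌋, fun j => rfl⟩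
  rw [h2, setIntegral_univ] at h1
  simpa only [setIntegral_floorCell] using h1

/-- Unfolding: the integral translates of the half-open unit cell tile the space and differ from
closed cubes by null sets. Integrability of `h` justifies exchanging sum and integral. -/
theorem setIntegral_Icc_tsum {h : (Fin g → ℝ) → ℂ} (hh : Integrable h) :
    ∫ y in Set.Icc (0 : Fin g → ℝ) 1, ∑' m : Fin g → ℤ, h (y + ofIntVec m) = ∫ y, h y := by
  have h1 := hasSum_integral_of_summable_integral_norm
    (μ := volume.restrict (Set.Icc (0 : Fin g → ℝ) 1))
    (F := fun (m : Fin g → ℤ) y => h (y + ofIntVec m))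
    (fun m => (hh.comp_add_right (ofIntVec m)).integrableOn)
    (hasSum_setIntegral_Icc hh.norm).summable
  exact h1.unique (hasSum_setIntegral_Icc hh)

/-- The character `exp (2 π i n·x)` of the torus `ℝ^g / ℤ^g`. -/
noncomputable def xChar (n : Fin g → ℤ) (x : Fin g → ℝ) : ℂ :=
  Complex.exp (2 * Real.pi * Complex.I * ∑ j, (n j : ℂ) * (x j : ℂ))

theorem setIntegral_exp_two_pi_I (n : ℤ) :
    ∫ x in Set.Icc (0 : ℝ) 1, Complex.exp (2 * Real.pi * Complex.I * ((n : ℂ) * (x : ℂ))) =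
      if n = 0 then 1 else 0 := by
  rw [integral_Icc_eq_integral_Ioc, ← intervalIntegral.integral_of_le zero_le_one]
  split_ifs with h
  · simp [h]
  · have hc : (2 * Real.pi * Complex.I * n : ℂ) ≠ 0 := by
      simp [h, Real.pi_ne_zero]
    have h1 := integral_exp_mul_complex (a := 0) (b := 1) hc
    simp only [← mul_assoc]
    rw [h1]
    have h2 : Complex.exp (2 * Real.pi * Complex.I * n * ((1 : ℝ) : ℂ)) = 1 := by
      rw [← Complex.exp_int_mul_two_pi_mul_I n]
      congr 1
      push_cast
      ring
    rw [h2]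
    simp

theorem integral_xChar (n : Fin g → ℤ) :
    ∫ x in Set.Icc (0 : Fin g → ℝ) 1, xChar n x = if n = 0 then 1 else 0 := by
  have h1 : Set.Icc (0 : Fin g → ℝ) 1 = Set.pi Set.univ fun _ => Set.Icc (0 : ℝ) 1 := by
    rw [← Set.pi_univ_Icc]; rfl
  have h2 : (volume : Measure (Fin g → ℝ)).restrict (Set.Icc (0 : Fin g → ℝ) 1) =
      Measure.pi fun _ => (volume : Measure ℝ).restrict (Set.Icc (0 : ℝ) 1) := by
    rw [h1, volume_pi, Measure.restrict_pi_pi]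
  have h3 : ∀ x, xChar n x =
      ∏ j, Complex.exp (2 * Real.pi * Complex.I * ((n j : ℂ) * (x j : ℂ))) := fun x => by
    rw [xChar, Finset.mul_sum, Complex.exp_sum]
  simp only [h3]
  rw [h2, integral_fintype_prod_eq_prod (fun j (x : ℝ) =>
    Complex.exp (2 * Real.pi * Complex.I * ((n j : ℂ) * (x : ℂ))))]
  simp only [setIntegral_exp_two_pi_I]
  split_ifs with h
  · simp [h]
  · obtain ⟨j, hj⟩ := Function.ne_iff.1 h
    exact Finset.prod_eq_zero (Finset.mem_univ j) (by simpa using hj)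

theorem norm_xChar (n : Fin g → ℤ) (x : Fin g → ℝ) : ‖xChar n x‖ = 1 := by
  have : 2 * Real.pi * Complex.I * ∑ j, (n j : ℂ) * (x j : ℂ) =
      ((2 * Real.pi * ∑ j, (n j : ℝ) * x j : ℝ) : ℂ) * Complex.I := by
    push_cast; ring
  rw [xChar, this, Complex.norm_exp_ofReal_mul_I]

theorem continuous_xChar (n : Fin g → ℤ) : Continuous (xChar n) := by
  unfold xChar
  fun_prop

theorem xChar_mul_conj (n n' : Fin g → ℤ) (x : Fin g → ℝ) :
    xChar n x * conj (xChar n' x) = xChar (n - n') x := by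
  simp only [xChar]
  rw [← Complex.exp_conj, ← Complex.exp_add]
  congr 1
  simp only [map_mul, map_sum, Complex.conj_I, Complex.conj_ofReal, map_ofNat, map_intCast,
    Pi.sub_apply, Int.cast_sub, sub_mul, Finset.sum_sub_distrib]
  ring

/-- Orthogonality of characters, applied to an absolutely convergent double series. -/
theorem integral_tsum_xChar_mul_conj {ι : Type*} [Countable ι] {a b : ι → ℂ} (ha : Summable a)
    (hb : Summable b) (p q : ι → Fin g → ℤ) :
    ∫ x in Set.Icc (0 : Fin g → ℝ) 1, (∑' i, a i * xChar (p i) x) * conj (∑' i, b i * xChar (q i) x) =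
      ∑' z : ι × ι, if p z.1 = q z.2 then a z.1 * conj (b z.2) else 0 := by
  have hs : Summable fun z : ι × ι => ‖a z.1‖ * ‖b z.2‖ :=
    ha.norm.mul_of_nonneg hb.norm (fun _ => norm_nonneg _) fun _ => norm_nonneg _
  have h1 : ∀ x, (∑' i, a i * xChar (p i) x) * conj (∑' i, b i * xChar (q i) x) =
      ∑' z : ι × ι, a z.1 * conj (b z.2) * xChar (p z.1 - q z.2) x := by
    intro x
    rw [Complex.conj_tsum, tsum_mul_tsum_of_summable_norm]
    · refine tsum_congr fun z => ?_
      rw [← xChar_mul_conj, map_mul]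
      ring
    · simpa only [norm_mul, norm_xChar, mul_one] using ha.norm
    · simpa only [RCLike.norm_conj, norm_mul, norm_xChar, mul_one] using hb.norm
  simp only [h1]
  have hint : ∀ z : ι × ι, IntegrableOn
      (fun x => a z.1 * conj (b z.2) * xChar (p z.1 - q z.2) x) (Set.Icc (0 : Fin g → ℝ) 1) :=
    fun z => (continuous_const.mul (continuous_xChar _)).continuousOn.integrableOn_compact
      isCompact_Icc
  have h2 := hasSum_integral_of_summable_integral_norm
    (μ := volume.restrict (Set.Icc (0 : Fin g → ℝ) 1)) hint ?_
  · rw [← h2.tsum_eq]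
    refine tsum_congr fun z => ?_
    rw [integral_const_mul, integral_xChar]
    by_cases h : p z.1 = q z.2 <;> simp [h, sub_eq_zero]
  · simp only [norm_mul, norm_xChar, mul_one, RCLike.norm_conj, integral_const]
    exact hs.mul_left _

end Unfolding

section Pairing

variable {g k : ℕ}

/-- The Gaussian `exp (k π i t Ω t)`. -/
noncomputable def thetaGauss (k : ℕ) (Ω : Matrix (Fin g) (Fin g) ℂ) (t : Fin g → ℝ) : ℂ :=
  Complex.exp (k * Real.pi * Complex.I * (ofRealVec t ⬝ᵥ Ω *ᵥ ofRealVec t))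

/-- The integral frequency `k m + l`. -/
def thetaFreq (k : ℕ) (l m : Fin g → ℤ) : Fin g → ℤ := fun j => k * m j + l j

theorem theta_term_eq (hk : k ≠ 0) (l m : Fin g → ℤ) (Ω : Matrix (Fin g) (Fin g) ℂ) (u : Cover g) :
    Complex.exp (k * Real.pi * Complex.I *
        (ofRealVec (u.2 - thetaIndex k l m) ⬝ᵥ Ω *ᵥ ofRealVec (u.2 - thetaIndex k l m)) +
      k * (2 * Real.pi * Complex.I) * ∑ j, (thetaIndex k l m j : ℂ) * (u.1 j : ℂ)) =
    thetaGauss k Ω (u.2 - thetaIndex k l m) * xChar (thetaFreq k l m) u.1 := by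
  have hk' : (k : ℂ) ≠ 0 := by exact_mod_cast hk
  rw [Complex.exp_add, thetaGauss, xChar]
  congr 2
  simp only [Finset.mul_sum, thetaIndex, thetaFreq]
  refine Finset.sum_congr rfl fun j _ => ?_
  push_cast
  field_simp

theorem thetaInt_eq_tsum (hk : k ≠ 0) (l : Fin g → ℤ) (Ω : Matrix (Fin g) (Fin g) ℂ) (u : Cover g) :
    thetaInt k l Ω u = Complex.exp (-(k * Real.pi * Complex.I) * ∑ j, (u.1 j : ℂ) * (u.2 j : ℂ)) *
      ∑' m, thetaGauss k Ω (u.2 - thetaIndex k l m) * xChar (thetaFreq k l m) u.1 := by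
  simp only [thetaInt, theta_term_eq hk]

theorem summable_thetaGauss (hk : k ≠ 0) (l : Fin g → ℤ) {Ω : Matrix (Fin g) (Fin g) ℂ}
    (hΩ : Ω ∈ siegelUpper g) (y : Fin g → ℝ) :
    Summable fun m => thetaGauss k Ω (y - thetaIndex k l m) := by
  have h1 := ((rapidDecay_thetaCoeff hk l hΩ).summable (thetaLin k Ω) (0, y)).mul_left
    (Complex.exp (thetaExponent k Ω (0, y)))
  refine h1.congr fun m => ?_
  have h2 : ofRealVec (y - thetaIndex k l m) = ofRealVec y - ofRealVec (thetaIndex k l m) := by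
    ext j; simp [ofRealVec]
  set N := thetaIndex k l m
  have h3 : ofRealVec N ⬝ᵥ Ω *ᵥ ofRealVec y = ofRealVec y ⬝ᵥ Ω *ᵥ ofRealVec N := by
    rw [dotProduct_mulVec, ← mulVec_transpose, hΩ.1, dotProduct_comm]
  have h4 : ∑ j, (N j : ℂ) * thetaLin k Ω j (0, y) = -(2 * Real.pi * Complex.I * k) *
      (ofRealVec N ⬝ᵥ Ω *ᵥ ofRealVec y) := by
    simp only [thetaLin_apply, dotProduct]
    rw [Finset.mul_sum]
    exact Finset.sum_congr rfl fun j _ => by simp [ofRealVec]; ring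
  have h5 : thetaExponent k Ω (0, y) = k * Real.pi * Complex.I *
      (ofRealVec y ⬝ᵥ Ω *ᵥ ofRealVec y) := by
    simp only [thetaExponent, dotProduct, mulVec, Finset.mul_sum, coordX_apply, coordY_apply,
      ofRealVec]
    simp only [← Finset.mul_sum]
    simp
    simp only [Finset.mul_sum]
    exact Or.inl (Finset.sum_congr rfl fun j _ => Finset.sum_congr rfl fun i _ => by ring)
  rw [thetaGauss, thetaCoeff, h2, ← Complex.exp_add, ← Complex.exp_add, h4, h5, mulVec_sub,
    dotProduct_sub, sub_dotProduct, sub_dotProduct, h3]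
  congr 1
  ring

/-- The matrix of the Gaussian that arises as the inner product of two theta functions. -/
noncomputable def pairingMatrix (k : ℕ) (Ω Ω' : Matrix (Fin g) (Fin g) ℂ) :
    Matrix (Fin g) (Fin g) ℂ :=
  ((k : ℝ) : ℂ) • (-Complex.I • Ω + (-Complex.I • Ω').map conj)

theorem smul_mem_rightHalf {A : Matrix (Fin g) (Fin g) ℂ} (hA : A ∈ rightHalf g) {c : ℝ}
    (hc : 0 < c) : (c : ℂ) • A ∈ rightHalf g := by
  refine ⟨by rw [transpose_smul, hA.1], ?_⟩
  have : ((c : ℂ) • A).map Complex.re = c • A.map Complex.re := by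
    ext i j; simp
  rw [this]
  exact hA.2.smul hc

theorem pairingMatrix_mem_rightHalf (hk : k ≠ 0) {Ω Ω' : Matrix (Fin g) (Fin g) ℂ}
    (hΩ : Ω ∈ siegelUpper g) (hΩ' : Ω' ∈ siegelUpper g) : pairingMatrix k Ω Ω' ∈ rightHalf g :=
  smul_mem_rightHalf (add_mem_rightHalf (neg_I_smul_mem_rightHalf hΩ)
    (conj_mem_rightHalf (neg_I_smul_mem_rightHalf hΩ')))
    (by exact_mod_cast Nat.pos_of_ne_zero hk)

theorem thetaGauss_mul_conj (Ω Ω' : Matrix (Fin g) (Fin g) ℂ) (t : Fin g → ℝ) :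
    thetaGauss k Ω t * conj (thetaGauss k Ω' t) =
      Complex.exp (-Real.pi * (ofRealVec t ⬝ᵥ pairingMatrix k Ω Ω' *ᵥ ofRealVec t)) := by
  have h1 : conj (ofRealVec t ⬝ᵥ Ω' *ᵥ ofRealVec t) = ofRealVec t ⬝ᵥ Ω'.map conj *ᵥ ofRealVec t := by
    simp [dotProduct, mulVec, ofRealVec]
  have h2 : (-Complex.I • Ω').map conj = Complex.I • Ω'.map conj := by
    ext i j; simp
  rw [thetaGauss, thetaGauss, ← Complex.exp_conj, ← Complex.exp_add, pairingMatrix, h2,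
    smul_mulVec, add_mulVec, smul_mulVec, smul_mulVec, dotProduct_smul, dotProduct_add,
    dotProduct_smul, dotProduct_smul, map_mul, h1]
  congr 1
  simp
  ring

theorem xChar_mul_conj_self (x y : Fin g → ℝ) :
    Complex.exp (-(k * Real.pi * Complex.I) * ∑ j, (x j : ℂ) * (y j : ℂ)) *
      conj (Complex.exp (-(k * Real.pi * Complex.I) * ∑ j, (x j : ℂ) * (y j : ℂ))) = 1 := by
  rw [← Complex.exp_conj, ← Complex.exp_add]
  simp

/-- Uniqueness of division with remainder, since the representatives lie in `[0, k)`. This is what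
makes theta functions of distinct classes orthogonal. -/
theorem thetaFreq_eq_iff (hk : k ≠ 0) {l l' : Fin g → Fin k} {m m' : Fin g → ℤ} :
    thetaFreq k (fun j => ((l j : ℕ) : ℤ)) m = thetaFreq k (fun j => ((l' j : ℕ) : ℤ)) m' ↔
      l = l' ∧ m = m' := by
  refine ⟨fun h => ?_, fun h => by rw [h.1, h.2]⟩
  have h1 : ∀ j, (k : ℤ) * m j + ((l j : ℕ) : ℤ) = k * m' j + ((l' j : ℕ) : ℤ) := fun j => congrFun h j
  have hk0 : (k : ℤ) ≠ 0 := by exact_mod_cast hk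
  have h2 : ∀ j, ((l j : ℕ) : ℤ) = ((l' j : ℕ) : ℤ) := fun j => by
    have h3 := congrArg (· % (k : ℤ)) (h1 j)
    simp only [Int.mul_add_emod_self_left] at h3
    rwa [Int.emod_eq_of_lt (by positivity) (by exact_mod_cast (l j).2),
      Int.emod_eq_of_lt (by positivity) (by exact_mod_cast (l' j).2)] at h3
  refine ⟨funext fun j => Fin.ext (by exact_mod_cast h2 j), funext fun j => ?_⟩
  have h3 := h1 j
  rw [h2 j] at h3
  exact mul_left_cancel₀ hk0 (add_right_cancel h3)

/-- Integrating over `x` first keeps only pairs of terms with equal frequency, hence equal class and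
equal `m`. The integral over `y` of the remaining single sum unfolds to a Gaussian over `ℝ^g`. -/
theorem sectionInner_thetaSection (hk : k ≠ 0) (l l' : Fin g → Fin k)
    {Ω Ω' : Matrix (Fin g) (Fin g) ℂ} (hΩ : Ω ∈ siegelUpper g) (hΩ' : Ω' ∈ siegelUpper g) :
    sectionInner (thetaSection hk (fun j => ((l j : ℕ) : ℤ)) hΩ)
      (thetaSection hk (fun j => ((l' j : ℕ) : ℤ)) hΩ') =
      if l = l' then gaussInt (pairingMatrix k Ω Ω') else 0 := by
  set L : Fin g → ℤ := fun j => ((l j : ℕ) : ℤ) with hL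
  set L' : Fin g → ℤ := fun j => ((l' j : ℕ) : ℤ) with hL'
  have hcube : unitCube g = Set.Icc (0 : Fin g → ℝ) 1 ×ˢ Set.Icc (0 : Fin g → ℝ) 1 := by
    rw [unitCube, ← Prod.mk_zero_zero, ← Prod.mk_one_one, Set.Icc_prod_eq]
  have hcont : Continuous fun u => thetaInt k L Ω u * conj (thetaInt k L' Ω' u) :=
    (contDiff_thetaInt hk L hΩ).continuous.mul
      (Complex.continuous_conj.comp (contDiff_thetaInt hk L' hΩ').continuous)
  have h1 : sectionInner (thetaSection hk L hΩ) (thetaSection hk L' hΩ') =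
      ∫ y in Set.Icc (0 : Fin g → ℝ) 1, ∫ x in Set.Icc (0 : Fin g → ℝ) 1,
        thetaInt k L Ω (x, y) * conj (thetaInt k L' Ω' (x, y)) := by
    have hI : IntegrableOn (fun u => thetaInt k L Ω u * conj (thetaInt k L' Ω' u))
        (Set.Icc (0 : Fin g → ℝ) 1 ×ˢ Set.Icc (0 : Fin g → ℝ) 1) :=
      hcont.continuousOn.integrableOn_compact (isCompact_Icc.prod isCompact_Icc)
    change ∫ u in unitCube g, thetaInt k L Ω u * conj (thetaInt k L' Ω' u) = _
    rw [hcube, Measure.volume_eq_prod, setIntegral_prod _ hI, integral_integral_swap]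
    rw [Measure.volume_eq_prod, IntegrableOn, ← Measure.prod_restrict] at hI
    exact hI
  have h2 : ∀ y : Fin g → ℝ, ∫ x in Set.Icc (0 : Fin g → ℝ) 1,
      thetaInt k L Ω (x, y) * conj (thetaInt k L' Ω' (x, y)) =
      ∑' z : (Fin g → ℤ) × (Fin g → ℤ), if l = l' ∧ z.1 = z.2 then
        thetaGauss k Ω (y - thetaIndex k L z.1) * conj (thetaGauss k Ω' (y - thetaIndex k L' z.2))
        else 0 := by
    intro y
    have h3 := integral_tsum_xChar_mul_conj (summable_thetaGauss hk L hΩ y)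
      (summable_thetaGauss hk L' hΩ' y) (thetaFreq k L) (thetaFreq k L')
    simp only [hL, hL', thetaFreq_eq_iff hk] at h3
    rw [← h3]
    refine integral_congr_ae (Filter.Eventually.of_forall fun x => ?_)
    simp only [thetaInt_eq_tsum hk, map_mul]
    rw [mul_mul_mul_comm, xChar_mul_conj_self, one_mul]
  rw [h1]
  simp only [h2]
  by_cases hll : l = l'
  · subst hll
    simp only [true_and, if_true]
    set h : (Fin g → ℝ) → ℂ := fun t =>
      Complex.exp (-Real.pi * (ofRealVec t ⬝ᵥ pairingMatrix k Ω Ω' *ᵥ ofRealVec t))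
    have hint : Integrable h := integrable_exp_quadratic (pairingMatrix_mem_rightHalf hk hΩ hΩ')
    set v : Fin g → ℝ := fun j => (L j : ℝ) / k
    have h4 : ∀ y : Fin g → ℝ, (∑' z : (Fin g → ℤ) × (Fin g → ℤ), if z.1 = z.2 then
        thetaGauss k Ω (y - thetaIndex k L z.1) * conj (thetaGauss k Ω' (y - thetaIndex k L' z.2))
        else 0) = ∑' m : Fin g → ℤ, h (y + ofIntVec m - v) := by
      intro y
      have hinj : Function.Injective fun m : Fin g → ℤ => ((m, m) : (Fin g → ℤ) × (Fin g → ℤ)) :=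
        fun a b hab => (Prod.ext_iff.1 hab).1
      rw [← hinj.tsum_eq]
      -- The theta series runs over `y - m`, the unfolding over `y + m`.
      · rw [← (Equiv.neg (Fin g → ℤ)).tsum_eq]
        refine tsum_congr fun m => ?_
        simp only [if_true, hL', hL, Equiv.neg_apply]
        rw [thetaGauss_mul_conj]
        simp only [h]
        have : y - thetaIndex k (fun j => ((l j : ℕ) : ℤ)) (-m) = y + ofIntVec m - v := by
          ext j
          simp only [thetaIndex, ofIntVec, v, hL, Pi.sub_apply, Pi.add_apply, Pi.neg_apply]
          push_cast
          ring
        rw [this]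
      · intro z hz
        by_cases hz' : z.1 = z.2
        · exact ⟨z.1, Prod.ext rfl hz'⟩
        · simp [hz'] at hz
    simp only [h4]
    rw [setIntegral_Icc_tsum (h := fun y => h (y - v)) (hint.comp_sub_right v),
      integral_sub_right_eq_self h v]
    rfl
  · simp [hll]

end Pairing

end TorusBKS

namespace TorusBKS

open MeasureTheory

/-! ### Fourier series of smooth periodic functions -/

section Torus

variable {g : ℕ}

/-- The covering map of the torus. -/
def toTorus (u : Cover g) : UnitAddTorus (Fin g ⊕ Fin g) :=
  fun i => ((Sum.elim u.1 u.2 i : ℝ) : UnitAddCircle)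

theorem isOpenQuotientMap_toTorus : IsOpenQuotientMap (toTorus (g := g)) := by
  have h1 : IsOpenQuotientMap (Pi.map fun (_ : Fin g ⊕ Fin g) (x : ℝ) => (x : UnitAddCircle)) :=
    IsOpenQuotientMap.piMap fun _ => QuotientAddGroup.isOpenQuotientMap_mk
  exact h1.comp (Homeomorph.sumArrowHomeomorphProdArrow
    (X := ℝ) (ι := Fin g) (ι' := Fin g)).symm.isOpenQuotientMap

theorem exists_latticeVec_of_toTorus_eq {u v : Cover g} (h : toTorus u = toTorus v) :
    ∃ lam : Lattice g, u = v + latticeVec lam := by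
  have h1 : ∀ i, ∃ n : ℤ, Sum.elim u.1 u.2 i = Sum.elim v.1 v.2 i + n := fun i => by
    have h2 := congrFun h i
    obtain ⟨n, hn⟩ := AddSubgroup.mem_zmultiples_iff.1 (QuotientAddGroup.eq_iff_sub_mem.1 h2)
    exact ⟨n, by rw [← sub_eq_iff_eq_add', ← hn]; simp⟩
  choose n hn using h1
  refine ⟨(fun j => n (Sum.inl j), fun j => n (Sum.inr j)), Prod.ext (funext fun j => ?_)
    (funext fun j => ?_)⟩
  · simpa [latticeVec] using hn (Sum.inl j)
  · simpa [latticeVec] using hn (Sum.inr j)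

theorem toTorus_add_latticeVec (u : Cover g) (lam : Lattice g) :
    toTorus (u + latticeVec lam) = toTorus u := by
  ext i
  rcases i with j | j <;> simp [toTorus, latticeVec]

theorem exists_lift {F : Cover g → ℂ} (hF : Continuous F)
    (hp : ∀ (lam : Lattice g) u, F (u + latticeVec lam) = F u) :
    ∃ f : C(UnitAddTorus (Fin g ⊕ Fin g), ℂ), ∀ u, f (toTorus u) = F u := by
  have hq : Topology.IsQuotientMap (⟨toTorus, isOpenQuotientMap_toTorus.continuous⟩ :
      C(Cover g, UnitAddTorus (Fin g ⊕ Fin g))) := isOpenQuotientMap_toTorus.isQuotientMap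
  have hfac : Function.FactorsThrough F (toTorus (g := g)) := fun u v h => by
    obtain ⟨lam, rfl⟩ := exists_latticeVec_of_toTorus_eq h
    exact hp lam v
  exact ⟨hq.lift ⟨F, hF⟩ hfac, fun u => DFunLike.congr_fun (hq.lift_comp ⟨F, hF⟩ hfac) u⟩

theorem unitCube_eq (g : ℕ) :
    unitCube g = Set.Icc (0 : Fin g → ℝ) 1 ×ˢ Set.Icc (0 : Fin g → ℝ) 1 := by
  rw [unitCube, ← Prod.mk_zero_zero, ← Prod.mk_one_one, Set.Icc_prod_eq]

instance : (volume : Measure (Cover g)).IsAddRightInvariant :=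
  inferInstanceAs (((volume : Measure (Fin g → ℝ)).prod volume).IsAddRightInvariant)

/-- The base point `a` of the fundamental domain is left free so that comparing two choices yields
translation invariance of integrals over the cube. -/
theorem mFourierCoeff_eq_setIntegral (f : UnitAddTorus (Fin g ⊕ Fin g) → ℂ)
    (n : Fin g ⊕ Fin g → ℤ) (a : Cover g) :
    UnitAddTorus.mFourierCoeff f n = ∫ u in unitCube g,
      UnitAddTorus.mFourier (-n) (toTorus (u + a)) • f (toTorus (u + a)) := by
  set G : (Fin g ⊕ Fin g → ℝ) → ℂ := fun x =>
    UnitAddTorus.mFourier (-n) (fun i => ((x i : ℝ) : UnitAddCircle)) • f fun i => (x i : UnitAddCircle)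
  set S : Set (Fin g ⊕ Fin g → ℝ) :=
    {x | ∀ i, x i ∈ Set.Ioc (Sum.elim a.1 a.2 i) (Sum.elim a.1 a.2 i + 1)}
  set e := (MeasurableEquiv.sumPiEquivProdPi fun _ : Fin g ⊕ Fin g => ℝ).symm
  have h1 := (volume_measurePreserving_sumPiEquivProdPi_symm
    fun _ : Fin g ⊕ Fin g => ℝ).setIntegral_preimage_emb e.measurableEmbedding G S
  have h2 := (measurePreserving_add_right (volume : Measure (Cover g)) a).setIntegral_preimage_emb
    (measurableEmbedding_addRight a) (fun z => G (e z)) (e ⁻¹' S)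
  have h3 : (fun u : Cover g => u + a) ⁻¹' (e ⁻¹' S) =ᵐ[volume] unitCube g := by
    have h4 : (fun u : Cover g => u + a) ⁻¹' (e ⁻¹' S) =
        (Set.pi Set.univ fun j => Set.Ioc ((0 : Fin g → ℝ) j) ((1 : Fin g → ℝ) j)) ×ˢ
        (Set.pi Set.univ fun j => Set.Ioc ((0 : Fin g → ℝ) j) ((1 : Fin g → ℝ) j)) := by
      ext u
      simp only [S, Set.mem_preimage, Set.mem_ofPred_eq, Sum.forall, Set.mem_prod, Set.mem_univ_pi]
      refine and_congr (forall_congr' fun j => ?_) (forall_congr' fun j => ?_)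
      · change u.1 j + a.1 j ∈ Set.Ioc (a.1 j) (a.1 j + 1) ↔ _
        simp only [Set.mem_Ioc, Pi.zero_apply, Pi.one_apply]
        constructor <;> rintro ⟨h1, h2⟩ <;> constructor <;> linarith
      · change u.2 j + a.2 j ∈ Set.Ioc (a.2 j) (a.2 j + 1) ↔ _
        simp only [Set.mem_Ioc, Pi.zero_apply, Pi.one_apply]
        constructor <;> rintro ⟨h1, h2⟩ <;> constructor <;> linarith
    rw [h4, unitCube_eq]
    exact Measure.set_prod_ae_eq Measure.univ_pi_Ioc_ae_eq_Icc Measure.univ_pi_Ioc_ae_eq_Icc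
  rw [UnitAddTorus.mFourierCoeff_eq_integral f n (Sum.elim a.1 a.2)]
  change ∫ x in S, G x = _
  rw [← h1]
  refine h2.symm.trans ?_
  rw [setIntegral_congr_set h3]
  refine integral_congr_ae (Filter.Eventually.of_forall fun u => ?_)
  have h5 : (fun i => ((e (u + a) i : ℝ) : UnitAddCircle)) = toTorus (u + a) := by
    ext i
    rcases i with j | j <;> rfl
  simp only [G, h5]

theorem setIntegral_unitCube_add {F : Cover g → ℂ} (hF : Continuous F)
    (hp : ∀ (lam : Lattice g) u, F (u + latticeVec lam) = F u) (a : Cover g) :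
    ∫ u in unitCube g, F (u + a) = ∫ u in unitCube g, F u := by
  obtain ⟨f, hf⟩ := exists_lift hF hp
  have h1 := mFourierCoeff_eq_setIntegral (g := g) f 0 a
  have h2 := mFourierCoeff_eq_setIntegral (g := g) f 0 0
  simp only [neg_zero, UnitAddTorus.mFourier_zero, ContinuousMap.one_apply, one_smul, hf,
    add_zero] at h1 h2
  rw [← h1, h2]

theorem isCompact_unitCube (g : ℕ) : IsCompact (unitCube g) := isCompact_Icc

theorem volume_unitCube (g : ℕ) : volume.real (unitCube g) = 1 := by
  rw [unitCube_eq, Measure.volume_eq_prod, measureReal_prod_prod, measureReal_def,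
    Real.volume_Icc_pi]
  simp

/-- The integral of `F (u + t v)` over a period does not depend on `t`; differentiate under the
integral sign at `t = 0`. -/
theorem setIntegral_fderiv_eq_zero {F : Cover g → ℂ} (hF : ContDiff ℝ 1 F)
    (hp : ∀ (lam : Lattice g) u, F (u + latticeVec lam) = F u) (v : Cover g) :
    ∫ u in unitCube g, fderiv ℝ F u v = 0 := by
  have hF' : Continuous fun p : ℝ × Cover g => fderiv ℝ F (p.2 + p.1 • v) v :=
    ((hF.continuous_fderiv one_ne_zero).comp
      (continuous_snd.add (continuous_fst.smul continuous_const))).clm_apply continuous_const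
  obtain ⟨C, hC⟩ := (isCompact_Icc.prod (isCompact_unitCube g)).exists_bound_of_continuousOn
    (s := Set.Icc (-1 : ℝ) 1 ×ˢ unitCube g) hF'.continuousOn
  have hfin : IsFiniteMeasure ((volume : Measure (Cover g)).restrict (unitCube g)) :=
    ⟨by simpa using (isCompact_unitCube g).measure_lt_top⟩
  have key := hasDerivAt_integral_of_dominated_loc_of_deriv_le (𝕜 := ℝ)
    (μ := (volume : Measure (Cover g)).restrict (unitCube g))
    (F := fun t u => F (u + t • v)) (F' := fun t u => fderiv ℝ F (u + t • v) v) (x₀ := 0)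
    (bound := fun _ => C) (s := Set.Icc (-1) 1) (Icc_mem_nhds (by norm_num) (by norm_num))
    ?_ ?_ ?_ ?_ ?_ ?_
  · have h0 := key.2
    simp only [setIntegral_unitCube_add hF.continuous hp, zero_smul, add_zero] at h0
    exact h0.unique (hasDerivAt_const _ _)
  · exact Filter.Eventually.of_forall fun t =>
      (hF.continuous.comp (continuous_id.add continuous_const)).aestronglyMeasurable
  · exact (hF.continuous.comp (continuous_id.add continuous_const)).continuousOn.integrableOn_compact
      (isCompact_unitCube g)
  · exact (hF'.comp (Continuous.prodMk_right 0)).aestronglyMeasurable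
  · exact (ae_restrict_iff' (isCompact_unitCube g).measurableSet).2
      (Filter.Eventually.of_forall fun u hu t ht => hC (t, u) ⟨ht, hu⟩)
  · exact integrable_const _
  · refine Filter.Eventually.of_forall fun u t _ => ?_
    have h1 : HasDerivAt (fun t : ℝ => u + t • v) v t := by
      simpa using ((hasDerivAt_id t).smul_const v).const_add u
    exact ((hF.differentiable one_ne_zero _).hasFDerivAt).comp_hasDerivAt t h1

/-- The real linear form `n·u`. -/
noncomputable def freqForm (n : Fin g ⊕ Fin g → ℤ) : Cover g →L[ℝ] ℝ :=
  ∑ j, ((n (Sum.inl j) : ℝ) • (ContinuousLinearMap.proj j).comp (ContinuousLinearMap.fst ℝ _ _) +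
    (n (Sum.inr j) : ℝ) • (ContinuousLinearMap.proj j).comp (ContinuousLinearMap.snd ℝ _ _))

theorem freqForm_apply (n : Fin g ⊕ Fin g → ℤ) (u : Cover g) :
    freqForm n u = ∑ j, ((n (Sum.inl j) : ℝ) * u.1 j + (n (Sum.inr j) : ℝ) * u.2 j) := by
  simp [freqForm, _root_.sum_apply]

/-- The characters of the torus. -/
noncomputable def torusChar (n : Fin g ⊕ Fin g → ℤ) (u : Cover g) : ℂ :=
  Complex.exp ((2 * Real.pi * Complex.I) * (freqForm n u : ℝ))

theorem mFourier_toTorus (n : Fin g ⊕ Fin g → ℤ) (u : Cover g) :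
    UnitAddTorus.mFourier n (toTorus u) = torusChar n u := by
  simp only [UnitAddTorus.mFourier, ContinuousMap.coe_mk, toTorus, fourier_coe_apply, torusChar]
  rw [← Complex.exp_sum, freqForm_apply, Fintype.sum_sum_type, Finset.sum_add_distrib]
  congr 1
  push_cast
  rw [mul_add, Finset.mul_sum, Finset.mul_sum]
  congr 1 <;> exact Finset.sum_congr rfl fun j _ => by simp; ring

theorem norm_torusChar (n : Fin g ⊕ Fin g → ℤ) (u : Cover g) : ‖torusChar n u‖ = 1 := by
  have : 2 * Real.pi * Complex.I * (freqForm n u : ℝ) =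
      ((2 * Real.pi * freqForm n u : ℝ) : ℂ) * Complex.I := by
    push_cast; ring
  rw [torusChar, this, Complex.norm_exp_ofReal_mul_I]

theorem conj_torusChar (n : Fin g ⊕ Fin g → ℤ) (u : Cover g) :
    conj (torusChar n u) = torusChar (-n) u := by
  have : freqForm (-n) u = -freqForm n u := by
    simp only [freqForm_apply, ← Finset.sum_neg_distrib]
    exact Finset.sum_congr rfl fun j _ => by simp; ring
  rw [torusChar, torusChar, ← Complex.exp_conj, this]
  congr 1
  simp [Complex.conj_ofNat]

theorem torusChar_add_vec (n : Fin g ⊕ Fin g → ℤ) (u v : Cover g) :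
    torusChar n (u + v) = torusChar n u * torusChar n v := by
  rw [torusChar, torusChar, torusChar, ← Complex.exp_add, map_add]
  congr 1
  push_cast
  ring

theorem torusChar_add_latticeVec (n : Fin g ⊕ Fin g → ℤ) (lam : Lattice g) (u : Cover g) :
    torusChar n (u + latticeVec lam) = torusChar n u := by
  rw [← mFourier_toTorus, toTorus_add_latticeVec, mFourier_toTorus]

theorem contDiff_torusChar (n : Fin g ⊕ Fin g → ℤ) : ContDiff ℝ ∞ (torusChar n) :=
  (contDiff_const.mul (Complex.ofRealCLM.contDiff.comp (freqForm n).contDiff)).cexp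

theorem hasFDerivAt_torusChar (n : Fin g ⊕ Fin g → ℤ) (u : Cover g) :
    HasFDerivAt (torusChar n) ((2 * Real.pi * Complex.I * torusChar n u) •
      (Complex.ofRealCLM.comp (freqForm n))) u := by
  have h := ((Complex.ofRealCLM.hasFDerivAt.comp u (freqForm n).hasFDerivAt).const_mul
    (2 * Real.pi * Complex.I)).cexp
  refine h.congr_fderiv ?_
  rw [smul_smul, mul_comm]
  rfl

theorem section_zero_periodic (F : SmoothSection g 0) (lam : Lattice g) (u : Cover g) :
    F.1 (u + latticeVec lam) = F.1 u := by
  rw [F.2.2]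
  simp [autFactor]

/-- A smooth periodic function as a section of the trivial bundle. -/
def periodicSection (F : Cover g → ℂ) (hF : ContDiff ℝ ∞ F)
    (hp : ∀ (lam : Lattice g) u, F (u + latticeVec lam) = F u) : SmoothSection g 0 :=
  ⟨F, hF, fun lam u => by rw [hp]; simp [autFactor]⟩

/-- The characters of the torus, as sections of the trivial bundle. -/
noncomputable def charSection (n : Fin g ⊕ Fin g → ℤ) : SmoothSection g 0 :=
  periodicSection (torusChar n) (contDiff_torusChar n) (torusChar_add_latticeVec n)

/-- The product of a smooth periodic function and a section. -/
def mulSection {n : ℤ} (F : SmoothSection g 0) (s : SmoothSection g n) : SmoothSection g n :=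
  ⟨fun u => F.1 u * s.1 u, F.2.1.mul s.2.1, fun lam u => by
    simp only [section_zero_periodic, s.2.2]; ring⟩

/-- The Fourier coefficients of a periodic function. -/
noncomputable def torusCoeff (F : Cover g → ℂ) (n : Fin g ⊕ Fin g → ℤ) : ℂ :=
  ∫ u in unitCube g, torusChar (-n) u * F u

theorem mFourierCoeff_eq_torusCoeff {F : Cover g → ℂ} {f : UnitAddTorus (Fin g ⊕ Fin g) → ℂ}
    (hf : ∀ u, f (toTorus u) = F u) (n : Fin g ⊕ Fin g → ℤ) :
    UnitAddTorus.mFourierCoeff f n = torusCoeff F n := by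
  rw [mFourierCoeff_eq_setIntegral f n 0]
  simp only [add_zero, mFourier_toTorus, hf, smul_eq_mul]
  rfl

theorem hasSum_torusCoeff (F : SmoothSection g 0) (hs : Summable (torusCoeff F.1)) (u : Cover g) :
    HasSum (fun n => torusCoeff F.1 n * torusChar n u) (F.1 u) := by
  obtain ⟨f, hf⟩ := exists_lift F.2.1.continuous (section_zero_periodic F)
  have h : UnitAddTorus.mFourierCoeff f = torusCoeff F.1 :=
    funext fun n => mFourierCoeff_eq_torusCoeff hf n
  have h1 := UnitAddTorus.hasSum_mFourier_series_apply_of_summable (f := f) (by rwa [h]) (toTorus u)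
  simpa only [h, mFourier_toTorus, hf, smul_eq_mul] using h1

/-- The coordinate vectors of `ℝ^{2g}`. -/
def coordVec (i : Fin g ⊕ Fin g) : Cover g := Sum.elim dX dY i

theorem freqForm_coordVec (n : Fin g ⊕ Fin g → ℤ) (i : Fin g ⊕ Fin g) :
    freqForm n (coordVec i) = n i := by
  rcases i with j | j <;> simp [freqForm_apply, coordVec, dX, dY, Pi.single_apply]

theorem norm_coordVec_le (i : Fin g ⊕ Fin g) : ‖coordVec i‖ ≤ 1 := by
  rcases i with j | j
  · simp only [coordVec, Sum.elim_inl, dX, Prod.norm_def, norm_zero]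
    exact max_le ((pi_norm_le_iff_of_nonneg zero_le_one).2 fun i => by
      rw [Pi.single_apply]; split_ifs <;> simp) zero_le_one
  · simp only [coordVec, Sum.elim_inr, dY, Prod.norm_def, norm_zero]
    exact max_le zero_le_one ((pi_norm_le_iff_of_nonneg zero_le_one).2 fun i => by
      rw [Pi.single_apply]; split_ifs <;> simp)

/-- The derivative of a smooth periodic function. -/
noncomputable def derivSection (F : SmoothSection g 0) (v : Cover g) : SmoothSection g 0 :=
  periodicSection (fun u => fderiv ℝ F.1 u v) (contDiff_fderiv_apply F.2.1 v) fun lam u => by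
    have h : fderiv ℝ F.1 (u + latticeVec lam) = fderiv ℝ F.1 u := by
      rw [← fderiv_comp_add_right]
      congr 1
      exact funext fun w => section_zero_periodic F lam w
    rw [h]

/-- Integration by parts: the derivative of the character times `F` integrates to zero. -/
theorem torusCoeff_derivSection (F : SmoothSection g 0) (i : Fin g ⊕ Fin g)
    (n : Fin g ⊕ Fin g → ℤ) :
    torusCoeff (derivSection F (coordVec i)).1 n =
      2 * Real.pi * Complex.I * n i * torusCoeff F.1 n := by
  have hd : Differentiable ℝ F.1 := F.2.1.differentiable (by simp)
  have h0 := setIntegral_fderiv_eq_zero (F := fun u => torusChar (-n) u * F.1 u)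
    (((contDiff_torusChar _).mul F.2.1).of_le (by exact_mod_cast le_top)) (fun lam u => by
      rw [torusChar_add_latticeVec, section_zero_periodic]) (coordVec i)
  have h1 : ∀ u, fderiv ℝ (fun u => torusChar (-n) u * F.1 u) u (coordVec i) =
      torusChar (-n) u * (derivSection F (coordVec i)).1 u -
        (2 * Real.pi * Complex.I * n i) * (torusChar (-n) u * F.1 u) := by
    intro u
    rw [((hasFDerivAt_torusChar (-n) u).fun_mul (hd u).hasFDerivAt).fderiv]
    simp only [_root_.add_apply, _root_.smul_apply, ContinuousLinearMap.comp_apply,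
      freqForm_coordVec, smul_eq_mul, Complex.ofRealCLM_apply, derivSection, periodicSection,
      Pi.neg_apply]
    push_cast
    ring
  simp only [h1] at h0
  rw [integral_sub, integral_const_mul, sub_eq_zero] at h0
  · exact h0
  · exact integrableOn_mul (charSection (-n)) (derivSection F (coordVec i))
  · exact (integrableOn_mul (charSection (-n)) F).const_mul _

theorem norm_torusCoeff_le (F : SmoothSection g 0) (n : Fin g ⊕ Fin g → ℤ) {M : ℝ}
    (h : ∀ u ∈ unitCube g, ‖F.1 u‖ ≤ M) : ‖torusCoeff F.1 n‖ ≤ M := by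
  have := norm_setIntegral_le_of_norm_le_const (μ := volume) (s := unitCube g) (C := M)
    (f := fun u => torusChar (-n) u * F.1 u) (isCompact_unitCube g).measure_lt_top
    fun u hu => by rw [norm_mul, norm_torusChar, one_mul]; exact h u hu
  simpa [torusCoeff, volume_unitCube] using this

theorem norm_iteratedFDeriv_derivSection_le (F : SmoothSection g 0) (i : Fin g ⊕ Fin g) (p : ℕ)
    (u : Cover g) : ‖iteratedFDeriv ℝ p (derivSection F (coordVec i)).1 u‖ ≤
      ‖iteratedFDeriv ℝ (p + 1) F.1 u‖ := by
  have h1 := (ContinuousLinearMap.apply ℝ ℂ (coordVec i)).norm_iteratedFDeriv_comp_left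
    (f := fderiv ℝ F.1) (x := u) (N := ∞) (n := p)
    (F.2.1.fderiv_right (m := ∞) (by simp)).contDiffAt (by exact_mod_cast le_top)
  rw [norm_iteratedFDeriv_fderiv] at h1
  have h2 : ‖ContinuousLinearMap.apply ℝ ℂ (coordVec i)‖ ≤ 1 :=
    ContinuousLinearMap.opNorm_le_bound _ zero_le_one fun L => by
      rw [one_mul]
      exact (L.le_opNorm _).trans (mul_le_of_le_one_right (norm_nonneg _) (norm_coordVec_le i))
  exact h1.trans (mul_le_of_le_one_left (norm_nonneg _) h2)

theorem pow_mul_norm_torusCoeff_le (p : ℕ) (F : SmoothSection g 0) (n : Fin g ⊕ Fin g → ℤ)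
    (i : Fin g ⊕ Fin g) {M : ℝ} (h : ∀ u ∈ unitCube g, ‖iteratedFDeriv ℝ p F.1 u‖ ≤ M) :
    |(n i : ℝ)| ^ p * ‖torusCoeff F.1 n‖ ≤ M := by
  induction p generalizing F with
  | zero => simpa using norm_torusCoeff_le F n (by simpa using h)
  | succ p ih =>
    have h1 := ih (derivSection F (coordVec i)) fun u hu =>
      (norm_iteratedFDeriv_derivSection_le F i p u).trans (h u hu)
    rw [torusCoeff_derivSection, norm_mul] at h1
    have h2 : |(n i : ℝ)| ≤ ‖(2 * Real.pi * Complex.I * n i : ℂ)‖ := by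
      have : ‖(2 * Real.pi * Complex.I * n i : ℂ)‖ = 2 * Real.pi * |(n i : ℝ)| := by
        simp [abs_of_pos Real.pi_pos]
      rw [this]
      nlinarith [Real.pi_gt_three, abs_nonneg (n i : ℝ)]
    refine le_trans ?_ h1
    rw [pow_succ, mul_assoc]
    gcongr

theorem one_add_pow_mul_norm_torusCoeff_le (p : ℕ) (F : SmoothSection g 0)
    (n : Fin g ⊕ Fin g → ℤ) {M : ℝ}
    (h : ∀ j ≤ p, ∀ u ∈ unitCube g, ‖iteratedFDeriv ℝ j F.1 u‖ ≤ M) :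
    (1 + ‖n‖) ^ p * ‖torusCoeff F.1 n‖ ≤ 2 ^ (p + 1) * M := by
  have h0 : ‖torusCoeff F.1 n‖ ≤ M :=
    norm_torusCoeff_le F n fun u hu => by simpa using h 0 (Nat.zero_le p) u hu
  have hM : 0 ≤ M := (norm_nonneg _).trans h0
  have h1 : ‖n‖ ^ p * ‖torusCoeff F.1 n‖ ≤ M := by
    rcases isEmpty_or_nonempty (Fin g ⊕ Fin g) with he | he
    · have : ‖n‖ = 0 := by rw [Subsingleton.elim n 0, norm_zero]
      rw [this]
      exact (mul_le_of_le_one_left (norm_nonneg _) (pow_le_one₀ le_rfl zero_le_one)).trans h0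
    -- The norm of `n` is the sup norm, attained at some coordinate; differentiating `p` times in
    -- that direction suffices.
    · obtain ⟨i, hi⟩ := Finite.exists_max fun i => ‖n i‖
      have : ‖n‖ = |(n i : ℝ)| := by
        refine le_antisymm ((pi_norm_le_iff_of_nonneg (abs_nonneg _)).2 fun j => ?_) ?_
        · rw [← Int.norm_eq_abs]; exact hi j
        · rw [← Int.norm_eq_abs]; exact norm_le_pi_norm n i
      rw [this]
      exact pow_mul_norm_torusCoeff_le p F n i (h p le_rfl)
  have h2 : (1 + ‖n‖) ^ p ≤ 2 ^ p * (1 + ‖n‖ ^ p) := by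
    rcases le_total ‖n‖ 1 with h3 | h3
    · calc (1 + ‖n‖) ^ p ≤ 2 ^ p := by gcongr; linarith
        _ ≤ _ := le_mul_of_one_le_right (by positivity) (by linarith [pow_nonneg (norm_nonneg n) p])
    · calc (1 + ‖n‖) ^ p ≤ (2 * ‖n‖) ^ p := by gcongr; linarith
        _ = 2 ^ p * ‖n‖ ^ p := mul_pow _ _ _
        _ ≤ _ := by gcongr; linarith
  calc (1 + ‖n‖) ^ p * ‖torusCoeff F.1 n‖ ≤ 2 ^ p * (1 + ‖n‖ ^ p) * ‖torusCoeff F.1 n‖ := by gcongr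
    _ = 2 ^ p * (‖torusCoeff F.1 n‖ + ‖n‖ ^ p * ‖torusCoeff F.1 n‖) := by ring
    _ ≤ 2 ^ p * (M + M) := by gcongr
    _ = _ := by ring

/-- The power dominates `∏ (1 + |n_i|)²`, so the series is bounded by a product of one-dimensional
convergent series. -/
theorem summable_one_add_norm_pow (ι : Type*) [Fintype ι] [DecidableEq ι] :
    Summable fun n : ι → ℤ => ((1 + ‖n‖) ^ (2 * Fintype.card ι))⁻¹ := by
  have h1 : Summable fun n : ℤ => ((1 + |(n : ℝ)|) ^ 2)⁻¹ := by
    have hN : Summable fun n : ℕ => ((1 + (n : ℝ)) ^ 2)⁻¹ := by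
      have := (summable_nat_add_iff 1).2 (Real.summable_nat_pow_inv.2 (one_lt_two))
      refine this.congr fun n => ?_
      push_cast
      rw [add_comm]
    refine Summable.of_nat_of_neg ?_ ?_ <;> simpa using hN
  refine (summable_pi_prod (fun (_ : ι) (n : ℤ) => by positivity) fun _ => h1).of_nonneg_of_le
    (fun n => by positivity) fun n => ?_
  have h2 : ∏ i, (1 + |(n i : ℝ)|) ^ 2 ≤ (1 + ‖n‖) ^ (2 * Fintype.card ι) := by
    rw [pow_mul, ← Finset.card_univ, ← Finset.prod_const]
    refine Finset.prod_le_prod (fun i _ => by positivity) fun i _ => ?_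
    have : |(n i : ℝ)| ≤ ‖n‖ := by rw [← Int.norm_eq_abs]; exact norm_le_pi_norm n i
    gcongr
  rw [Finset.prod_inv_distrib]
  exact inv_anti₀ (Finset.prod_pos fun i _ => by positivity) h2

end Torus

end TorusBKS

namespace TorusBKS

open MeasureTheory

/-! ### Distributions applied to Fourier series term by term -/

section FourierDistribution

variable {g : ℕ}

theorem norm_freqForm_le (n : Fin g ⊕ Fin g → ℤ) : ‖freqForm n‖ ≤ 2 * g * ‖n‖ := by
  refine ContinuousLinearMap.opNorm_le_bound _ (by positivity) fun u => ?_
  rw [freqForm_apply]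
  refine (norm_sum_le _ _).trans ?_
  have h1 : ∀ j ∈ Finset.univ, ‖(n (Sum.inl j) : ℝ) * u.1 j + (n (Sum.inr j) : ℝ) * u.2 j‖ ≤
      2 * (‖n‖ * ‖u‖) := fun j _ => by
    have h2 : ∀ i, ‖(n i : ℝ)‖ ≤ ‖n‖ := fun i => by
      rw [Int.norm_cast_real]; exact norm_le_pi_norm n i
    have h3 : ‖u.1 j‖ ≤ ‖u‖ := (norm_le_pi_norm u.1 j).trans (norm_fst_le u)
    have h4 : ‖u.2 j‖ ≤ ‖u‖ := (norm_le_pi_norm u.2 j).trans (norm_snd_le u)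
    refine (norm_add_le _ _).trans ?_
    rw [norm_mul, norm_mul, two_mul]
    gcongr <;> apply h2
  refine (Finset.sum_le_sum h1).trans ?_
  simp
  apply le_of_eq
  ring

/-- A derivative of a character is the character times a fixed covector of size `O(‖n‖)`, so
derivatives of order `j` grow polynomially in `n`. The added `1`s keep the base at least `1`, so the
bound increases with `j`. -/
theorem norm_iteratedFDeriv_torusChar_le (n : Fin g ⊕ Fin g → ℤ) (j : ℕ) (u : Cover g) :
    ‖iteratedFDeriv ℝ j (torusChar n) u‖ ≤ ((2 * Real.pi * (2 * g) + 1) * (1 + ‖n‖)) ^ j := by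
  induction j generalizing u with
  | zero => simp [norm_torusChar]
  | succ j ih =>
    set L : Cover g →L[ℝ] ℂ := (2 * Real.pi * Complex.I) • (Complex.ofRealCLM.comp (freqForm n))
    set S : ℂ →L[ℝ] (Cover g →L[ℝ] ℂ) := (ContinuousLinearMap.id ℝ ℂ).smulRight L
    have hL : ‖L‖ ≤ (2 * Real.pi * (2 * g) + 1) * (1 + ‖n‖) := by
      have h1 : ‖Complex.ofRealCLM.comp (freqForm n)‖ ≤ 2 * g * ‖n‖ :=
        (ContinuousLinearMap.opNorm_comp_le _ _).trans (by
          rw [Complex.ofRealCLM_norm, one_mul]; exact norm_freqForm_le n)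
      have h2 : ‖(2 * Real.pi * Complex.I : ℂ)‖ = 2 * Real.pi := by simp [abs_of_pos Real.pi_pos]
      calc ‖L‖ = 2 * Real.pi * ‖Complex.ofRealCLM.comp (freqForm n)‖ := by rw [norm_smul, h2]
        _ ≤ 2 * Real.pi * (2 * g * ‖n‖) := by gcongr
        _ ≤ _ := by
          have : 0 ≤ 2 * Real.pi * (2 * g) := by positivity
          nlinarith [norm_nonneg n]
    have hS : ‖S‖ ≤ (2 * Real.pi * (2 * g) + 1) * (1 + ‖n‖) :=
      (ContinuousLinearMap.opNorm_le_bound _ (norm_nonneg L) fun z => by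
        rw [mul_comm]; exact (norm_smul z L).le).trans hL
    have hfd : fderiv ℝ (torusChar n) = S ∘ torusChar n := funext fun u => by
      rw [(hasFDerivAt_torusChar n u).fderiv]
      change _ = torusChar n u • L
      rw [smul_smul, mul_comm]
    have h1 := S.norm_iteratedFDeriv_comp_left (f := torusChar n) (x := u) (N := ∞) (n := j)
      (contDiff_torusChar n).contDiffAt (by exact_mod_cast le_top)
    rw [← norm_iteratedFDeriv_fderiv, hfd, pow_succ']
    exact h1.trans (mul_le_mul hS (ih u) (norm_nonneg _) (by positivity))

theorem norm_iteratedFDeriv_mul_le' {f h : Cover g → ℂ} (hf : ContDiff ℝ ∞ f) (hh : ContDiff ℝ ∞ h)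
    {N j : ℕ} (hj : j ≤ N) {A B : ℝ} (u : Cover g) (hA : ∀ i ≤ N, ‖iteratedFDeriv ℝ i f u‖ ≤ A)
    (hB : ∀ i ≤ N, ‖iteratedFDeriv ℝ i h u‖ ≤ B) :
    ‖iteratedFDeriv ℝ j (fun u => f u * h u) u‖ ≤ 2 ^ N * A * B := by
  have hA0 : 0 ≤ A := (norm_nonneg _).trans (hA 0 (Nat.zero_le _))
  have hB0 : 0 ≤ B := (norm_nonneg _).trans (hB 0 (Nat.zero_le _))
  refine (norm_iteratedFDeriv_mul_le (N := ∞) hf hh u (by exact_mod_cast le_top)).trans ?_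
  have h1 : ∀ i ∈ Finset.range (j + 1), (j.choose i : ℝ) * ‖iteratedFDeriv ℝ i f u‖ *
      ‖iteratedFDeriv ℝ (j - i) h u‖ ≤ (j.choose i : ℝ) * (A * B) := fun i hi => by
    rw [mul_assoc]
    have := Finset.mem_range.1 hi
    gcongr
    · exact hA i (by omega)
    · exact hB _ (by omega)
  refine (Finset.sum_le_sum h1).trans ?_
  rw [← Finset.sum_mul, ← Nat.cast_sum, Nat.sum_range_choose, mul_assoc]
  push_cast
  gcongr
  norm_num

theorem exists_bound_iteratedFDeriv {f : Cover g → ℂ} (hf : ContDiff ℝ ∞ f) (N : ℕ) :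
    ∃ M : ℝ, ∀ j ≤ N, ∀ u ∈ unitCube g, ‖iteratedFDeriv ℝ j f u‖ ≤ M := by
  have h1 : ∀ j, ∃ M : ℝ, ∀ u ∈ unitCube g, ‖iteratedFDeriv ℝ j f u‖ ≤ M := fun j =>
    (isCompact_unitCube g).exists_bound_of_continuousOn
      (hf.continuous_iteratedFDeriv (m := j) (by exact_mod_cast le_top)).continuousOn
  choose M hM using h1
  refine ⟨∑ j ∈ Finset.range (N + 1), |M j|, fun j hj u hu => (hM j u hu).trans ?_⟩
  exact (le_abs_self _).trans (Finset.single_le_sum (f := fun j => |M j|)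
    (fun i _ => abs_nonneg _) (Finset.mem_range.2 (by omega)))

/-- Bounding `q` more derivatives than the weight requires leaves the summable factor `(1 +
‖n‖)^{-q}`. -/
theorem summable_torusCoeff_mul (F : SmoothSection g 0) (p : ℕ) :
    Summable fun n => ‖torusCoeff F.1 n‖ * (1 + ‖n‖) ^ p := by
  set q := 2 * Fintype.card (Fin g ⊕ Fin g)
  obtain ⟨M, hM⟩ := exists_bound_iteratedFDeriv F.2.1 (p + q)
  refine ((summable_one_add_norm_pow (Fin g ⊕ Fin g)).mul_left (2 ^ (p + q + 1) * M)).of_nonneg_of_le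
    (fun n => by positivity) fun n => ?_
  have h := one_add_pow_mul_norm_torusCoeff_le (p + q) F n hM
  rw [← div_eq_mul_inv, le_div_iff₀ (by positivity)]
  calc _ = (1 + ‖n‖) ^ (p + q) * ‖torusCoeff F.1 n‖ := by rw [pow_add]; ring
    _ ≤ _ := h

theorem mulSection_sub {n : ℤ} (F G : SmoothSection g 0) (s : SmoothSection g n) :
    mulSection (F - G) s = mulSection F s - mulSection G s :=
  Subtype.ext (funext fun u => sub_mul (F.1 u) (G.1 u) (s.1 u))

theorem mulSection_sum {n : ℤ} {ι : Type*} (t : Finset ι) (c : ι → ℂ) (G : ι → SmoothSection g 0)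
    (s : SmoothSection g n) :
    mulSection (∑ i ∈ t, c i • G i) s = ∑ i ∈ t, c i • mulSection (G i) s := by
  classical
  induction t using Finset.induction_on with
  | empty => exact Subtype.ext (funext fun u => zero_mul _)
  | insert i t hi ih =>
    rw [Finset.sum_insert hi, Finset.sum_insert hi, ← ih]
    refine Subtype.ext (funext fun u => ?_)
    change (c i * (G i).1 u + (∑ i ∈ t, c i • G i).1 u) * s.1 u =
      c i * ((G i).1 u * s.1 u) + (∑ i ∈ t, c i • G i).1 u * s.1 u
    ring

/-- `T` is controlled by derivatives of some finite order `N` on the cube. Up to that order the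
remainders of the Fourier series are bounded by tails of `∑ ‖c_n‖ (K (1 + ‖n‖))^N`, which converges
by rapid decay of the coefficients. -/
theorem hasSum_torusCoeff_functional {n₀ : ℤ} (T : continuousFunctionals g n₀)
    (F : SmoothSection g 0) (ψ : SmoothSection g n₀) :
    HasSum (fun n => torusCoeff F.1 n * T.1 (mulSection (charSection n) ψ))
      (T.1 (mulSection F ψ)) := by
  classical
  obtain ⟨N, C, hT⟩ := T.2
  obtain ⟨B, hB⟩ := exists_bound_iteratedFDeriv ψ.2.1 N
  set K : ℝ := 2 * Real.pi * (2 * g) + 1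
  have hK : 1 ≤ K := by
    have := Real.pi_pos
    simp only [K]
    have : 0 ≤ 2 * Real.pi * (2 * g) := by positivity
    linarith
  set v : ℕ → (Fin g ⊕ Fin g → ℤ) → ℝ := fun j n => ‖torusCoeff F.1 n‖ * (K * (1 + ‖n‖)) ^ j
  have hv : ∀ j, Summable (v j) := fun j => by
    refine ((summable_torusCoeff_mul F j).mul_left (K ^ j)).congr fun n => ?_
    simp only [v, mul_pow]; ring
  have hv0 : ∀ j n, 0 ≤ v j n := fun j n => by positivity
  have hvm : ∀ j ≤ N, ∀ n, v j n ≤ v N n := fun j hj n => by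
    simp only [v]
    gcongr
    nlinarith [norm_nonneg n]
  have hF : ∀ u, HasSum (fun n => torusCoeff F.1 n * torusChar n u) (F.1 u) :=
    hasSum_torusCoeff F (Summable.of_norm (by simpa [v] using hv 0))
  -- the remainders
  set R : Finset (Fin g ⊕ Fin g → ℤ) → SmoothSection g 0 := fun t =>
    F - ∑ n ∈ t, torusCoeff F.1 n • charSection n
  -- Written as a series over all frequencies, with zeros on `t`, the remainder can be
  -- differentiated term by term.
  have hR : ∀ t, (R t).1 = fun u => ∑' n, if n ∈ t then 0 else torusCoeff F.1 n * torusChar n u := by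
    intro t
    funext u
    have h1 : (R t).1 u = F.1 u - ∑ n ∈ t, torusCoeff F.1 n * torusChar n u := by
      have : (∑ n ∈ t, torusCoeff F.1 n • charSection n).1 u =
          ∑ n ∈ t, torusCoeff F.1 n * torusChar n u := by
        rw [AddSubmonoidClass.coe_finsetSum, Finset.sum_apply]
        rfl
      rw [← this]
      rfl
    rw [h1]
    have h2 := (hF u).sub (hasSum_sum_of_ne_finset_zero (s := t)
      (f := fun n => if n ∈ t then torusCoeff F.1 n * torusChar n u else 0)
      fun n hn => if_neg hn)
    rw [Finset.sum_congr rfl fun n hn => if_pos hn] at h2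
    rw [← h2.tsum_eq]
    refine tsum_congr fun n => ?_
    split_ifs <;> simp
  have hbound : ∀ t, ∀ j ≤ N, ∀ u, ‖iteratedFDeriv ℝ j (R t).1 u‖ ≤
      ∑' n : {n // n ∉ t}, v N n := by
    intro t j hj u
    have hd : ∀ j n u, ‖iteratedFDeriv ℝ j
        (fun u => if n ∈ t then 0 else torusCoeff F.1 n * torusChar n u) u‖ ≤
        if n ∈ t then 0 else v j n := by
      intro j n u
      split_ifs with hn
      · rw [iteratedFDeriv_fun_zero]; simp
      · have := iteratedFDeriv_const_smul_apply (𝕜 := ℝ) (i := j) (x := u) (a := torusCoeff F.1 n)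
          ((contDiff_torusChar n).of_le (m := j) (by exact_mod_cast le_top)).contDiffAt
        change ‖iteratedFDeriv ℝ j (torusCoeff F.1 n • torusChar n) u‖ ≤ _
        rw [this, norm_smul]
        exact mul_le_mul_of_nonneg_left (norm_iteratedFDeriv_torusChar_le n j u) (norm_nonneg _)
    have hvt : ∀ j, Summable fun n => if n ∈ t then 0 else v j n := fun j =>
      (hv j).of_nonneg_of_le (fun n => by split_ifs; exacts [le_rfl, hv0 j n])
        fun n => by split_ifs; exacts [hv0 j n, le_rfl]
    rw [hR, iteratedFDeriv_tsum_apply (N := ⊤) (v := fun j n => if n ∈ t then 0 else v j n)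
      (fun n => ?_) (fun j _ => hvt j) (fun j n u _ => hd j n u) (by exact_mod_cast le_top)]
    · refine (tsum_of_norm_bounded (hvt N).hasSum fun n => (hd j n u).trans ?_).trans (le_of_eq ?_)
      · split_ifs; exacts [le_rfl, hvm j hj n]
      · refine Eq.trans ?_ (tsum_subtype {n | n ∉ t} (v N)).symm
        refine tsum_congr fun n => ?_
        simp [Set.indicator_apply]
    · split_ifs
      exacts [contDiff_const, contDiff_const.mul (contDiff_torusChar n)]
  rw [HasSum]
  have hlim := tendsto_tsum_compl_atTop_zero (v N)
  rw [tendsto_iff_norm_sub_tendsto_zero]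
  refine squeeze_zero (fun _ => norm_nonneg _) (fun t => ?_)
    (by simpa using (hlim.const_mul (2 ^ N)).mul_const B |>.const_mul C)
  have h1 : ∑ n ∈ t, torusCoeff F.1 n * T.1 (mulSection (charSection n) ψ) -
      T.1 (mulSection F ψ) = -T.1 (mulSection (R t) ψ) := by
    rw [mulSection_sub, mulSection_sum, map_sub, map_sum]
    simp
  rw [h1, norm_neg]
  exact hT _ _ fun j hj u hu => norm_iteratedFDeriv_mul_le' (R t).2.1 ψ.2.1 hj u
    (fun i hi => hbound t i hi u) fun i hi => hB i hi u hu

end FourierDistribution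

end TorusBKS

namespace TorusBKS

/-! ### Differentiation of families of smooth functions -/

section Slices

variable {E : Type} [NormedAddCommGroup E] [NormedSpace ℝ E]

/-- The error of the first order expansion of `f (h, ·)` at `h = 0`. -/
noncomputable def sliceError {F : Type} [NormedAddCommGroup F] [NormedSpace ℝ F]
    (f : ℝ × E → F) (h : ℝ) (u : E) : F :=
  f (h, u) - f (0, u) - h • fderiv ℝ f (0, u) (1, 0)

theorem contDiff_slice_deriv {F : Type} [NormedAddCommGroup F] [NormedSpace ℝ F]
    {f : ℝ × E → F} (hf : ContDiff ℝ ∞ f) (w : ℝ × E) :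
    ContDiff ℝ ∞ fun p => fderiv ℝ f p w :=
  (hf.fderiv_right (m := ∞) (by simp)).clm_apply contDiff_const

theorem hasDerivAt_slice {F : Type} [NormedAddCommGroup F] [NormedSpace ℝ F]
    {f : ℝ × E → F} (hf : ContDiff ℝ ∞ f) (t : ℝ) (u : E) :
    HasDerivAt (fun t => f (t, u)) (fderiv ℝ f (t, u) (1, 0)) t :=
  (hf.differentiable (by simp) (t, u)).hasFDerivAt.comp_hasDerivAt t
    ((hasDerivAt_id t).prodMk (hasDerivAt_const t u))

theorem hasFDerivAt_slice {F : Type} [NormedAddCommGroup F] [NormedSpace ℝ F]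
    {f : ℝ × E → F} (hf : ContDiff ℝ ∞ f) (t : ℝ) (u : E) :
    HasFDerivAt (fun u => f (t, u)) ((fderiv ℝ f (t, u)).comp (ContinuousLinearMap.inr ℝ ℝ E)) u :=
  (hf.differentiable (by simp) (t, u)).hasFDerivAt.comp u (hasFDerivAt_prodMk_right t u)

/-- Taylor's formula by applying the mean value inequality twice; `C` bounds the second derivative
in the parameter on a compact set. -/
theorem norm_sliceError_le {F : Type} [NormedAddCommGroup F] [NormedSpace ℝ F]
    {f : ℝ × E → F} (hf : ContDiff ℝ ∞ f) {K : Set E} (hK : IsCompact K) :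
    ∃ C : ℝ, ∀ h ∈ Set.Icc (-1 : ℝ) 1, ∀ u ∈ K, ‖sliceError f h u‖ ≤ C * h ^ 2 := by
  set f₁ : ℝ × E → F := fun p => fderiv ℝ f p (1, 0)
  have hf₁ : ContDiff ℝ ∞ f₁ := contDiff_slice_deriv hf _
  obtain ⟨C, hC⟩ := (isCompact_Icc.prod hK).exists_bound_of_continuousOn
    (s := Set.Icc (-1 : ℝ) 1 ×ˢ K) (contDiff_slice_deriv hf₁ (1, 0)).continuous.continuousOn
  refine ⟨C, fun h hh u hu => ?_⟩
  have h0 : (0 : ℝ) ∈ Set.Icc (-1 : ℝ) 1 := by norm_num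
  have hC0 : 0 ≤ C := (norm_nonneg _).trans (hC (0, u) ⟨h0, hu⟩)
  have h1 : ∀ t ∈ Set.Icc (-1 : ℝ) 1, ‖f₁ (t, u) - f₁ (0, u)‖ ≤ C * |t| := fun t ht => by
    have := (convex_Icc (-1 : ℝ) 1).norm_image_sub_le_of_norm_hasDerivWithin_le
      (fun t _ => (hasDerivAt_slice hf₁ t u).hasDerivWithinAt) (fun t ht => hC (t, u) ⟨ht, hu⟩) h0 ht
    simpa using this
  have h2 : ∀ t ∈ Set.Icc (-|h|) |h|, HasDerivWithinAt (fun t => f (t, u) - t • f₁ (0, u))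
      (f₁ (t, u) - f₁ (0, u)) (Set.Icc (-|h|) |h|) t := fun t _ => by
    have := (hasDerivAt_slice hf t u).sub ((hasDerivAt_id t).smul_const (f₁ (0, u)))
    rw [one_smul] at this
    exact this.hasDerivWithinAt
  have h3 := (convex_Icc (-|h|) |h|).norm_image_sub_le_of_norm_hasDerivWithin_le h2
    (C := C * |h|) (x := 0) (y := h) (fun t ht => ?_) ⟨by simp, abs_nonneg _⟩
    ⟨neg_abs_le _, le_abs_self _⟩
  · have h4 : sliceError f h u = f (h, u) - h • f₁ (0, u) - (f (0, u) - (0 : ℝ) • f₁ (0, u)) := by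
      rw [sliceError, zero_smul]; abel
    rw [h4, ← sq_abs, sq, ← mul_assoc]
    simpa using h3
  · have hht : |t| ≤ |h| := abs_le.2 ht
    refine (h1 t ⟨?_, ?_⟩).trans (by gcongr)
    · have := abs_le.1 (hht.trans (abs_le.2 hh)); exact this.1
    · have := abs_le.1 (hht.trans (abs_le.2 hh)); exact this.2

/-- Differentiation in `u` commutes with taking the first order error, by symmetry of the second
derivative. -/
theorem fderiv_sliceError {F : Type} [NormedAddCommGroup F] [NormedSpace ℝ F]
    {f : ℝ × E → F} (hf : ContDiff ℝ ∞ f) (h : ℝ) :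
    fderiv ℝ (sliceError f h) =
      sliceError (fun p => (fderiv ℝ f p).comp (ContinuousLinearMap.inr ℝ ℝ E)) h := by
  funext u
  have h1 := ((hasFDerivAt_slice hf h u).sub (hasFDerivAt_slice hf 0 u)).sub
    ((hasFDerivAt_slice (contDiff_slice_deriv hf (1, 0)) 0 u).const_smul h)
  have hd : DifferentiableAt ℝ (fderiv ℝ f) (0, u) :=
    (hf.fderiv_right (m := ∞) (by simp)).differentiable (by simp) _
  refine h1.fderiv.trans ?_
  rw [sliceError]
  congr 2
  refine ContinuousLinearMap.ext fun w => ?_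
  rw [fderiv_clm_comp hd (differentiableAt_const _)]
  have hsymm := (hf.contDiffAt (x := ((0 : ℝ), u))).isSymmSndFDerivAt
    (by rw [minSmoothness_of_isRCLikeNormedField]; exact ENat.LEInfty.out)
  rw [ContinuousLinearMap.comp_apply, fderiv_clm_apply hd (differentiableAt_const _)]
  simp [hsymm.eq (1, 0) (0, w)]

/-- Each derivative in `u` replaces `f` by a family with values in continuous linear maps, so the
induction must quantify over the target space. -/
theorem norm_iteratedFDeriv_sliceError_le (j : ℕ) {K : Set E} (hK : IsCompact K) :
    ∀ {F : Type} [NormedAddCommGroup F] [NormedSpace ℝ F] {f : ℝ × E → F}, ContDiff ℝ ∞ f →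
    ∃ C : ℝ, ∀ h ∈ Set.Icc (-1 : ℝ) 1, ∀ u ∈ K,
      ‖iteratedFDeriv ℝ j (sliceError f h) u‖ ≤ C * h ^ 2 := by
  induction j with
  | zero =>
    intro F _ _ f hf
    simpa only [norm_iteratedFDeriv_zero] using norm_sliceError_le hf hK
  | succ j ih =>
    intro F _ _ f hf
    obtain ⟨C, hC⟩ := ih (f := fun p => (fderiv ℝ f p).comp (ContinuousLinearMap.inr ℝ ℝ E))
      ((hf.fderiv_right (m := ∞) (by simp)).clm_comp contDiff_const)
    refine ⟨C, fun h hh u hu => ?_⟩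
    rw [← norm_iteratedFDeriv_fderiv, fderiv_sliceError hf]
    exact hC h hh u hu

end Slices

/-! ### Differentiating a functional along a smooth family of sections -/

section Functional

variable {g : ℕ} {n : ℤ}

/-- The first order error is `O(h²)` in every `C^N` norm on the cube, and one such norm controls
`T`. -/
theorem hasDerivAt_functional (T : continuousFunctionals g n) {f : ℝ × Cover g → ℂ}
    (hf : ContDiff ℝ ∞ f) (s : ℝ → SmoothSection g n) (hs : ∀ h u, (s h).1 u = f (h, u))
    (s' : SmoothSection g n) (hs' : ∀ u, s'.1 u = fderiv ℝ f (0, u) (1, 0)) :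
    HasDerivAt (fun h => T.1 (s h)) (T.1 s') 0 := by
  obtain ⟨N, C, hT⟩ := T.2
  have h1 : ∀ j, ∃ C : ℝ, ∀ h ∈ Set.Icc (-1 : ℝ) 1, ∀ u ∈ unitCube g,
      ‖iteratedFDeriv ℝ j (sliceError f h) u‖ ≤ C * h ^ 2 :=
    fun j => norm_iteratedFDeriv_sliceError_le j (isCompact_unitCube g) hf
  choose D hD using h1
  set D' := ∑ j ∈ Finset.range (N + 1), |D j|
  have h2 : ∀ h ∈ Set.Icc (-1 : ℝ) 1, ‖T.1 (s h) - T.1 (s 0) - h • T.1 s'‖ ≤ C * (D' * h ^ 2) := by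
    intro h hh
    have h3 : T.1 (s h - s 0 - (h : ℂ) • s') = T.1 (s h) - T.1 (s 0) - h • T.1 s' := by
      rw [map_sub, map_sub, map_smul, smul_eq_mul, Complex.real_smul]
    rw [← h3]
    refine hT _ _ fun j hj u hu => ?_
    have h4 : (s h - s 0 - (h : ℂ) • s').1 = sliceError f h := by
      funext u
      change (s h).1 u - (s 0).1 u - (h : ℂ) * s'.1 u = _
      rw [hs, hs, hs', sliceError, Complex.real_smul]
    rw [h4]
    refine (hD j h hh u hu).trans (mul_le_mul_of_nonneg_right ?_ (sq_nonneg _))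
    exact (le_abs_self _).trans (Finset.single_le_sum (f := fun j => |D j|)
      (fun i _ => abs_nonneg _) (Finset.mem_range.2 (by omega)))
  rw [hasDerivAt_iff_isLittleO_nhds_zero]
  have h5 : (fun h : ℝ => T.1 (s (0 + h)) - T.1 (s 0) - h • T.1 s') =O[nhds 0] fun h : ℝ => h ^ 2 := by
    refine Asymptotics.IsBigO.of_bound (C * D') ?_
    filter_upwards [Icc_mem_nhds (a := (-1 : ℝ)) (b := 1) (x := 0) (by norm_num) (by norm_num)]
      with h hh
    rw [zero_add, mul_assoc, Real.norm_of_nonneg (sq_nonneg h)]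
    exact h2 h hh
  exact h5.trans_isLittleO (Asymptotics.isLittleO_pow_id one_lt_two)

end Functional

end TorusBKS

namespace TorusBKS

open Matrix

/-! ### Parallel transport along translations -/

section Transport

variable {g k : ℕ}

theorem omega_add_left (u v w : Cover g) : omega (u + v) w = omega u w + omega v w := by
  simp only [omega, Prod.fst_add, Prod.snd_add, Pi.add_apply, ← Finset.sum_add_distrib]
  exact Finset.sum_congr rfl fun j _ => by ring

theorem omega_smul_left (c : ℝ) (u v : Cover g) : omega (c • u) v = c * omega u v := by
  simp only [omega, Prod.smul_fst, Prod.smul_snd, Pi.smul_apply, smul_eq_mul, Finset.mul_sum]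
  exact Finset.sum_congr rfl fun j _ => by ring

theorem omega_comm (u v : Cover g) : omega u v = -omega v u := by
  simp only [omega, ← Finset.sum_neg_distrib]
  exact Finset.sum_congr rfl fun j _ => by ring

theorem omega_add_right (u v w : Cover g) : omega u (v + w) = omega u v + omega u w := by
  rw [omega_comm, omega_add_left, neg_add, ← omega_comm, ← omega_comm]

theorem omega_smul_right (c : ℝ) (u v : Cover g) : omega u (c • v) = c * omega u v := by
  rw [omega_comm, omega_smul_left, omega_comm v u]
  ring

theorem omega_self (u : Cover g) : omega u u = 0 := by
  have := omega_comm u u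
  linarith

/-- Contraction of the symplectic form, with values in `ℂ`. -/
noncomputable def omegaLin (v : Cover g) : Cover g →L[ℝ] ℂ :=
  ∑ j, ((v.2 j : ℂ) • coordX j - (v.1 j : ℂ) • coordY j)

theorem omegaLin_apply (v u : Cover g) : omegaLin v u = (omega v u : ℝ) := by
  simp only [omegaLin, _root_.sum_apply, _root_.sub_apply, _root_.smul_apply, coordX_apply,
    coordY_apply, smul_eq_mul, omega]
  push_cast
  rfl

theorem dirDeriv_omegaLin (v u : Cover g) (w : ComplexTangent g) :
    dirDeriv (fun u => omegaLin v u) u w = connForm v w := by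
  rw [dirDeriv_clm, connForm]
  refine Finset.sum_congr rfl fun j _ => ?_
  rw [omegaLin_apply, omegaLin_apply, omega_comm, omega_dX, omega_comm, omega_dY]
  push_cast
  ring

/-- The parallel transport of sections of `L^{-k}` along the translation by `v`. -/
noncomputable def transport (v : Cover g) (φ : SmoothSection g (-(k : ℤ))) :
    SmoothSection g (-(k : ℤ)) :=
  ⟨fun u => Complex.exp (-(k * Real.pi * Complex.I) * omegaLin v u) * φ.1 (u + v),
    (contDiff_const.mul (omegaLin v).contDiff).cexp.mul
      (φ.2.1.comp (contDiff_id.add contDiff_const)), fun lam u => by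
    beta_reduce
    rw [add_right_comm, φ.2.2, map_add]
    simp only [autFactor, omegaLin_apply, omega_add_left, Complex.ofReal_add, mul_add,
      Complex.exp_add]
    rw [show -(k * Real.pi * Complex.I) * (omega v (latticeVec lam) : ℂ) =
      -(-((-(k : ℤ) : ℤ) * Real.pi * Complex.I) * (omega v (latticeVec lam) : ℂ)) by push_cast; ring,
      Complex.exp_neg]
    field_simp⟩

theorem transport_apply (v : Cover g) (φ : SmoothSection g (-(k : ℤ))) (u : Cover g) :
    (transport v φ).1 u =
      Complex.exp (-(k * Real.pi * Complex.I) * (omega v u : ℝ)) * φ.1 (u + v) := by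
  rw [← omegaLin_apply]; rfl

theorem transport_zero (φ : SmoothSection g (-(k : ℤ))) : transport 0 φ = φ := by
  refine Subtype.ext (funext fun u => ?_)
  rw [transport_apply]
  simp [omega]

/-- The Heisenberg relation: transports compose up to a phase given by the symplectic form, which is
trivial for parallel vectors. -/
theorem transport_transport (v w : Cover g) (φ : SmoothSection g (-(k : ℤ))) :
    transport v (transport w φ) =
      Complex.exp (-(k * Real.pi * Complex.I) * (omega w v : ℝ)) • transport (v + w) φ := by
  refine Subtype.ext (funext fun u => ?_)
  change _ = _ * (transport (v + w) φ).1 u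
  rw [transport_apply, transport_apply, transport_apply, ← mul_assoc, ← mul_assoc,
    ← Complex.exp_add, ← Complex.exp_add, omega_add_right, omega_add_left, add_assoc]
  congr 2
  push_cast
  ring

/-- A real tangent vector as a complex one. -/
def complexVec (v : Cover g) : ComplexTangent g := (fun j => (v.1 j : ℂ), fun j => (v.2 j : ℂ))

theorem connForm_complexVec (u v : Cover g) : connForm u (complexVec v) = (omega u v : ℝ) := by
  simp only [connForm, complexVec, omega]
  push_cast
  rfl

theorem dirDeriv_complexVec (f : Cover g → ℂ) (u v : Cover g) :
    dirDeriv f u (complexVec v) = fderiv ℝ f u v := by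
  have h : v = ∑ j, (v.1 j • dX j + v.2 j • dY j) := by
    refine Prod.ext (funext fun i => ?_) (funext fun i => ?_) <;>
      simp [dX, dY, Prod.fst_sum, Prod.snd_sum, Finset.sum_apply, Pi.single_apply]
  conv_rhs => rw [h]
  simp only [dirDeriv, complexVec, map_sum, map_add, map_smul, Complex.real_smul]

theorem covDeriv_constField_add {n : ℤ} (w w' : ComplexTangent g) (s : SmoothSection g n) :
    covDeriv (constField (w + w')) s = covDeriv (constField w) s + covDeriv (constField w') s := by
  refine Subtype.ext (funext fun u => ?_)
  change dirDeriv s.1 u (w + w') - _ * connForm u (w + w') =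
    (dirDeriv s.1 u w - _ * connForm u w) + (dirDeriv s.1 u w' - _ * connForm u w')
  have h1 : dirDeriv s.1 u (w + w') = dirDeriv s.1 u w + dirDeriv s.1 u w' := by
    simp only [dirDeriv, ← Finset.sum_add_distrib]
    exact Finset.sum_congr rfl fun j _ => by
      simp only [Prod.fst_add, Prod.snd_add, Pi.add_apply]; ring
  have h2 : connForm u (w + w') = connForm u w + connForm u w' := by
    simp only [connForm, ← Finset.sum_add_distrib]
    exact Finset.sum_congr rfl fun j _ => by
      simp only [Prod.fst_add, Prod.snd_add, Pi.add_apply]; ring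
  rw [h1, h2]
  ring

/-- The curvature is constant, so covariant differentiation and transport commute up to a scalar,
the complex bilinear extension of the symplectic form at `(v, w)`. -/
theorem covDeriv_transport (w : ComplexTangent g) (v : Cover g) (φ : SmoothSection g (-(k : ℤ))) :
    covDeriv (constField w) (transport v φ) = transport v (covDeriv (constField w) φ) -
      (2 * Real.pi * Complex.I * k * connForm v w) • transport v φ := by
  refine Subtype.ext (funext fun u => ?_)
  change _ = (transport v (covDeriv (constField w) φ)).1 u - _ * (transport v φ).1 u
  rw [covDeriv_apply, transport_apply v φ, transport_apply, covDeriv_apply]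
  have hω : DifferentiableAt ℝ (fun u => omegaLin v u) u := (omegaLin v).differentiableAt
  have hφ : DifferentiableAt ℝ (fun u => φ.1 (u + v)) u :=
    (differentiable_section φ).comp (differentiable_id.add_const v) u
  have h1 : dirDeriv (fun u => φ.1 (u + v)) u w = dirDeriv φ.1 (u + v) w := by
    simp only [dirDeriv, fderiv_comp_add_right]
  have h2 : connForm (u + v) w = connForm u w + connForm v w := by
    simp only [connForm, ← Finset.sum_add_distrib]
    exact Finset.sum_congr rfl fun j _ => by
      simp only [Prod.fst_add, Prod.snd_add, Pi.add_apply]; push_cast; ring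
  have h3 : dirDeriv (transport v φ).1 u w =
      dirDeriv (fun u => Complex.exp (-(k * Real.pi * Complex.I) * omegaLin v u) * φ.1 (u + v)) u w :=
    rfl
  change dirDeriv (transport v φ).1 u w - _ * connForm u w = _ * (dirDeriv φ.1 (u + v) w -
    _ * connForm (u + v) w) - _
  rw [h3, dirDeriv_mul (hω.const_mul _).cexp hφ, dirDeriv_cexp (hω.const_mul _),
    dirDeriv_const_mul hω, dirDeriv_omegaLin, h1, h2, omegaLin_apply]
  push_cast
  ring

theorem hasDerivAt_functional_transport_zero (T : continuousFunctionals g (-(k : ℤ)))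
    (v : Cover g) (φ : SmoothSection g (-(k : ℤ))) :
    HasDerivAt (fun h : ℝ => T.1 (transport (h • v) φ))
      (T.1 (covDeriv (constField (complexVec v)) φ)) 0 := by
  set f : ℝ × Cover g → ℂ := fun p =>
    Complex.exp (-(k * Real.pi * Complex.I) * (p.1 * omegaLin v p.2)) * φ.1 (p.2 + p.1 • v)
  have hf : ContDiff ℝ ∞ f := by
    refine (contDiff_const.mul ((Complex.ofRealCLM.contDiff.comp contDiff_fst).mul
      ((omegaLin v).contDiff.comp contDiff_snd))).cexp.mul (φ.2.1.comp ?_)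
    exact contDiff_snd.add (contDiff_fst.smul contDiff_const)
  refine hasDerivAt_functional T hf _ (fun h u => ?_) _ fun u => ?_
  · rw [transport_apply, omega_smul_left]
    simp only [f, omegaLin_apply]
    push_cast
    rfl
  · have h1 : HasDerivAt (fun h : ℝ => u + h • v) v 0 := by
      simpa using ((hasDerivAt_id (0 : ℝ)).smul_const v).const_add u
    have h2 : HasDerivAt (fun h : ℝ => φ.1 (u + h • v)) (fderiv ℝ φ.1 u v) 0 := by
      have := (differentiable_section φ (u + (0 : ℝ) • v)).hasFDerivAt.comp_hasDerivAt (0 : ℝ) h1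
      rw [zero_smul, add_zero] at this
      exact this
    have h3 : HasDerivAt (fun h : ℝ => -(k * Real.pi * Complex.I) * ((h : ℂ) * omegaLin v u))
        (-(k * Real.pi * Complex.I) * omegaLin v u) 0 := by
      have := ((hasDerivAt_id (0 : ℝ)).ofReal_comp.mul_const (omegaLin v u)).const_mul
        (-(k * Real.pi * Complex.I) : ℂ)
      simpa using this
    have h4 := (hasDerivAt_slice hf 0 u).unique (h3.cexp.mul h2)
    rw [h4, covDeriv_apply]
    change dirDeriv φ.1 u (complexVec v) - _ * connForm u (complexVec v) = _
    rw [dirDeriv_complexVec, connForm_complexVec, omegaLin_apply, omega_comm u v]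
    simp
    ring

/-- Transports along multiples of one vector form a one-parameter group, as `ω(v, v) = 0`; this
reduces to the derivative at `0`. -/
theorem hasDerivAt_functional_transport (T : continuousFunctionals g (-(k : ℤ)))
    (v : Cover g) (φ : SmoothSection g (-(k : ℤ))) (t : ℝ) :
    HasDerivAt (fun h : ℝ => T.1 (transport (h • v) φ))
      (T.1 (covDeriv (constField (complexVec v)) (transport (t • v) φ))) t := by
  have h1 := hasDerivAt_functional_transport_zero T v (transport (t • v) φ)
  have h2 : ∀ h : ℝ, transport (h • v) (transport (t • v) φ) = transport ((h + t) • v) φ := by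
    intro h
    rw [transport_transport, omega_smul_left, omega_smul_right, omega_self, add_smul]
    simp
  simp only [h2] at h1
  have h3 := HasDerivAt.comp_sub_const (f := fun h : ℝ => T.1 (transport ((h + t) • v) φ)) t t
    (by rwa [sub_self])
  simpa using h3

/-- The antiholomorphic vector of the polarization `P_τ` with parameter `p`. -/
noncomputable def antiholVec (τ : Matrix (Fin g) (Fin g) ℂ) (p : Fin g → ℂ) : ComplexTangent g :=
  (Complex.I • ((1 - τ) *ᵥ p), (1 + τ) *ᵥ p)

/-- The spanning vectors of the polarization `P_τ`. -/
noncomputable def polVec (τ : Matrix (Fin g) (Fin g) ℂ) (m : Fin g) : ComplexTangent g :=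
  (fun l => -Complex.I * (1 - τ.map conj) l m, fun l => (1 + τ.map conj) l m)

theorem conjTangent_antiholVec (τ : Matrix (Fin g) (Fin g) ℂ) (p : Fin g → ℂ) :
    conjTangent (antiholVec τ p) = ∑ m, conj (p m) • polVec τ m := by
  have hc : ∀ l m, conj ((1 : Matrix (Fin g) (Fin g) ℂ) l m) = (1 : Matrix _ _ ℂ) l m :=
    fun l m => by rw [Matrix.one_apply]; split_ifs <;> simp
  refine Prod.ext (funext fun l => ?_) (funext fun l => ?_)
  · simp only [conjTangent, antiholVec, polVec, Prod.fst_sum, Finset.sum_apply, Prod.smul_fst,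
      Pi.smul_apply, smul_eq_mul, mulVec, dotProduct, map_mul, map_sum, Complex.conj_I,
      Finset.mul_sum, Matrix.sub_apply, Matrix.map_apply, map_sub, hc]
    exact Finset.sum_congr rfl fun m _ => by ring
  · simp only [conjTangent, antiholVec, polVec, Prod.snd_sum, Finset.sum_apply, Prod.smul_snd,
      Pi.smul_apply, smul_eq_mul, mulVec, dotProduct, map_mul, map_sum,
      Matrix.add_apply, Matrix.map_apply, map_add, hc]
    exact Finset.sum_congr rfl fun m _ => by ring

theorem conjTangent_antiholVec_mem (τ : Matrix (Fin g) (Fin g) ℂ) (p : Fin g → ℂ) :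
    conjTangent (antiholVec τ p) ∈ polarization τ := by
  rw [conjTangent_antiholVec]
  exact Submodule.sum_mem _ fun m _ => Submodule.smul_mem _ _ (Submodule.subset_span ⟨m, rfl⟩)

/-- For a constant field the divergence vanishes, so weak covariant constancy says that `T`
annihilates covariant derivatives of test sections. -/
theorem eval_covDeriv_antiholVec {τ : Matrix (Fin g) (Fin g) ℂ} {T : DistSection g k}
    (hT : T ∈ covConstSections g k τ) (p : Fin g → ℂ) (φ : SmoothSection g (-(k : ℤ))) :
    T.1 (covDeriv (constField (antiholVec τ p)) φ) = 0 := by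
  have h := hT (constField (conjTangent (antiholVec τ p)))
    (fun _ => conjTangent_antiholVec_mem τ p) φ
  have h1 : (constField (conjTangent (antiholVec τ p))).conj = constField (antiholVec τ p) := by
    simp only [VectorField.conj, constField, conjTangent_conjTangent]
  have h2 : divMul (constField (antiholVec τ p)) φ = 0 := by
    refine Subtype.ext (funext fun u => ?_)
    simp [divMul, VectorField.div, constField]
  rw [h1, weakCovDeriv, h2, zero_add, neg_eq_zero] at h
  exact h

/-- The holomorphic coordinate `y - i x` at `τ = 0`. -/
noncomputable def zVec (v : Cover g) : Fin g → ℂ := fun j => (v.2 j : ℂ) - Complex.I * (v.1 j : ℂ)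

/-- The exponent of the transport of the Gaussian vacuum in the polarization `P_τ`. -/
noncomputable def weightExponent (k : ℕ) (τ : Matrix (Fin g) (Fin g) ℂ) (v : Cover g) : ℂ :=
  -(Real.pi * k / 2) * ((normSqVec (zVec v) : ℝ) - zVec v ⬝ᵥ τ *ᵥ zVec v)

/-- The direction `v` is split into an antiholomorphic vector, whose derivatives `T` kills, and a
vector `w = (-i q, q)`, along which `φ` is flat. The function `f t = T (transport (t v) φ)` then
satisfies `f' = -t c f`, so `f 1 = f 0 * exp (-c / 2)`. Neither invertibility of `1 + τ` nor
interiority of `τ` is needed. -/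
theorem eval_transport {τ : Matrix (Fin g) (Fin g) ℂ} {T : DistSection g k}
    (hT : T ∈ covConstSections g k τ) {φ : SmoothSection g (-(k : ℤ))}
    (hφ : ∀ q : Fin g → ℂ, covDeriv (constField (-Complex.I • q, q)) φ = 0) (v : Cover g) :
    T.1 (transport v φ) = T.1 φ * Complex.exp (weightExponent k τ v) := by
  set z := zVec v with hz
  -- The map `(a, b) ↦ b - i a` kills `(-i q, q)` and sends `antiholVec τ p` to `2 p` and `v` to
  -- `z`, which forces `p = z / 2` and hence `q`.
  set q : Fin g → ℂ := ofRealVec v.2 - (1 / 2 : ℂ) • (z + τ *ᵥ z)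
  set w : ComplexTangent g := (-Complex.I • q, q)
  have hv : complexVec v = antiholVec τ ((1 / 2 : ℂ) • z) + w := by
    refine Prod.ext (funext fun j => ?_) (funext fun j => ?_)
    · simp only [complexVec, antiholVec, w, q, Prod.fst_add, Pi.add_apply, Pi.smul_apply,
        Pi.sub_apply, sub_mulVec, one_mulVec, mulVec_smul, smul_eq_mul, ofRealVec, hz, zVec]
      linear_combination (v.1 j : ℂ) * Complex.I_sq
    · simp only [complexVec, antiholVec, w, q, Prod.snd_add, Pi.add_apply, Pi.smul_apply,
        Pi.sub_apply, add_mulVec, one_mulVec, mulVec_smul, smul_eq_mul, ofRealVec]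
      ring
  set c : ℂ := 2 * Real.pi * Complex.I * k * connForm v w
  have hc : -c / 2 = weightExponent k τ v := by
    have h1 : connForm v w = -Complex.I * (z ⬝ᵥ q) := by
      simp only [connForm, dotProduct, Finset.mul_sum, w, Pi.smul_apply, smul_eq_mul, hz, zVec]
      exact Finset.sum_congr rfl fun j _ => by
        linear_combination (-(v.1 j : ℂ) * q j) * Complex.I_sq
    have h2 : (2 : ℂ) * (z ⬝ᵥ ofRealVec v.2) = z ⬝ᵥ z + (normSqVec z : ℝ) := by
      simp only [dotProduct, normSqVec, Finset.mul_sum, Complex.ofReal_sum,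
        ← Finset.sum_add_distrib]
      refine Finset.sum_congr rfl fun j _ => ?_
      rw [← Complex.mul_conj, ofRealVec]
      have : conj (z j) = (v.2 j : ℂ) + Complex.I * v.1 j := by simp [hz, zVec]
      rw [this, hz, zVec]
      ring
    have h3 : (2 : ℂ) * (z ⬝ᵥ q) = (normSqVec z : ℝ) - z ⬝ᵥ τ *ᵥ z := by
      simp only [q, dotProduct_sub, dotProduct_smul, dotProduct_add, smul_eq_mul]
      linear_combination h2
    simp only [c, h1, weightExponent, ← hz]
    linear_combination (Real.pi * k * (z ⬝ᵥ q)) * Complex.I_sq - (Real.pi * k / 2) * h3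
  have hf : ∀ t : ℝ, HasDerivAt (fun t : ℝ => T.1 (transport (t • v) φ))
      (-(t * c) * T.1 (transport (t • v) φ)) t := fun t => by
    have h1 := hasDerivAt_functional_transport T v φ t
    -- Only the curvature scalar of `covDeriv_transport` survives, and it is linear in `t`.
    rw [hv, covDeriv_constField_add, map_add, eval_covDeriv_antiholVec hT, zero_add,
      covDeriv_transport, hφ] at h1
    have h2 : transport (t • v) (0 : SmoothSection g (-(k : ℤ))) = 0 :=
      Subtype.ext (funext fun u => mul_zero _)
    have h3 : connForm (t • v) w = t * connForm v w := by
      simp only [connForm, Finset.mul_sum, Prod.smul_fst, Prod.smul_snd, Pi.smul_apply, smul_eq_mul]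
      exact Finset.sum_congr rfl fun j _ => by push_cast; ring
    rw [h2, zero_sub, map_neg, map_smul, h3, smul_eq_mul] at h1
    convert h1 using 1
    simp only [c]
    ring
  have he : ∀ t : ℝ, HasDerivAt (fun t : ℝ => Complex.exp (t ^ 2 * (c / 2)))
      (Complex.exp (t ^ 2 * (c / 2)) * (t * c)) t := fun t => by
    have h1 : HasDerivAt (fun t : ℝ => (t : ℂ) ^ 2 * (c / 2)) (t * c) t := by
      have h2 : HasDerivAt (fun t : ℝ => (t : ℂ)) 1 t := (hasDerivAt_id t).ofReal_comp
      refine ((h2.fun_pow 2).mul_const (c / 2)).congr_deriv ?_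
      simp
      ring
    exact h1.cexp
  have hconst : ∀ t : ℝ, HasDerivAt (fun t : ℝ => T.1 (transport (t • v) φ) *
      Complex.exp (t ^ 2 * (c / 2))) 0 t := fun t => by
    refine ((hf t).fun_mul (he t)).congr_deriv ?_
    ring
  have h1 := is_const_of_deriv_eq_zero (fun t => (hconst t).differentiableAt)
    (fun t => (hconst t).deriv) 1 0
  simp only [one_smul, zero_smul, transport_zero, Complex.ofReal_one, Complex.ofReal_zero, one_pow,
    one_mul, ne_eq, OfNat.ofNat_ne_zero, not_false_eq_true, zero_pow, zero_mul, Complex.exp_zero,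
    mul_one] at h1
  rw [← hc, ← h1, mul_assoc, ← Complex.exp_add]
  have : c / 2 + -c / 2 = 0 := by ring
  rw [this, Complex.exp_zero, mul_one]

end Transport

end TorusBKS

namespace TorusBKS

open Matrix

/-! ### The Gaussian vacua and multiplication by characters -/

section Vacuum

variable {g k : ℕ}

/-- The Gaussian vacuum sections of `L^{-k}`: conjugates of the theta functions at `τ = 0`. -/
noncomputable def vacuum (hk : k ≠ 0) (l : Fin g → ℤ) : SmoothSection g (-(k : ℤ)) :=
  conjSection (thetaSection hk l (I_smul_one_mem_siegelUpper g))

theorem vacuum_apply (hk : k ≠ 0) (l : Fin g → ℤ) (u : Cover g) :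
    (vacuum hk l).1 u = conj (thetaInt k l (Complex.I • (1 : Matrix (Fin g) (Fin g) ℂ)) u) := rfl

theorem covDeriv_vacuum (hk : k ≠ 0) (l : Fin g → ℤ) (q : Fin g → ℂ) :
    covDeriv (constField (-Complex.I • q, q)) (vacuum hk l) = 0 := by
  rw [vacuum, covDeriv_conjSection, covDeriv_thetaSection]
  · exact Subtype.ext (funext fun u => map_zero _)
  · funext j
    simp [conjTangent, smul_mulVec]

theorem vacuum_add_mul (hk : k ≠ 0) (l b : Fin g → ℤ) :
    vacuum hk (fun j => l j + k * b j) = vacuum hk l :=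
  Subtype.ext (funext fun u => by rw [vacuum_apply, vacuum_apply, thetaInt_add_mul hk])

/-- The class modulo `k` of `-n_1`, for a frequency `n = (n_1, n_2)`. -/
def freqClass (hk : k ≠ 0) (n : Fin g ⊕ Fin g → ℤ) : Fin g → Fin k := fun j =>
  ⟨((-n (Sum.inl j)) % k).toNat, by
    have hk' : (k : ℤ) ≠ 0 := by exact_mod_cast hk
    have h1 := Int.emod_nonneg (-n (Sum.inl j)) hk'
    have h2 := Int.emod_lt_of_pos (-n (Sum.inl j)) (by omega : (0 : ℤ) < k)
    omega⟩

/-- The vacuum section attached to a class modulo `k`. -/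
noncomputable def classVacuum (hk : k ≠ 0) (l : Fin g → Fin k) : SmoothSection g (-(k : ℤ)) :=
  vacuum hk fun j => ((l j : ℕ) : ℤ)

theorem vacuum_eq_classVacuum (hk : k ≠ 0) (n : Fin g ⊕ Fin g → ℤ) :
    vacuum hk (fun j => -n (Sum.inl j)) = classVacuum hk (freqClass hk n) := by
  rw [classVacuum, ← vacuum_add_mul hk (fun j => ((freqClass hk n j : ℕ) : ℤ))
    fun j => -n (Sum.inl j) / k]
  congr 1
  funext j
  have hk' : (k : ℤ) ≠ 0 := by exact_mod_cast hk
  rw [freqClass, Int.toNat_of_nonneg (Int.emod_nonneg _ hk'), Int.emod_add_mul_ediv]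

/-- The translation vector corresponding to multiplication by a character. -/
noncomputable def freqVec (k : ℕ) (n : Fin g ⊕ Fin g → ℤ) : Cover g :=
  fracVec k (fun j => n (Sum.inr j), fun j => -n (Sum.inl j))

theorem omega_freqVec (hk : k ≠ 0) (n : Fin g ⊕ Fin g → ℤ) (u : Cover g) :
    k * omega u (freqVec k n) = freqForm n u := by
  have hk' : (k : ℝ) ≠ 0 := by exact_mod_cast hk
  rw [freqForm_apply, omega, Finset.mul_sum]
  refine Finset.sum_congr rfl fun j _ => ?_
  simp only [freqVec, fracVec]
  push_cast
  field_simp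
  ring

/-- The quadratic phase `-∑ n_1 n_2 / k`. -/
noncomputable def freqPhase (k : ℕ) (n : Fin g ⊕ Fin g → ℤ) : ℝ :=
  -∑ j, (n (Sum.inl j) : ℝ) * n (Sum.inr j) / k

/-- The vector `(n_2, -n_1) / k` is chosen so that `k ω(u, ·)` is the linear form `n·u`. The phase
of the transport and the phase from translating the theta function each contribute `exp (π i n·u)`,
half of the character, and the translation takes the class `-n_1` to `0`. -/
theorem mulSection_charSection_vacuum (hk : k ≠ 0) (n : Fin g ⊕ Fin g → ℤ) :
    mulSection (charSection n) (vacuum hk 0) =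
      Complex.exp ((Real.pi * Complex.I) * (freqPhase k n : ℝ)) •
        transport (freqVec k n) (classVacuum hk (freqClass hk n)) := by
  rw [← vacuum_eq_classVacuum]
  refine Subtype.ext (funext fun u => ?_)
  change torusChar n u * (vacuum hk 0).1 u = _ * (transport _ _).1 u
  have h1 := thetaInt_add_fracVec hk (fun j => -n (Sum.inl j))
    (fun j => n (Sum.inr j), fun j => -n (Sum.inl j))
    (Complex.I • (1 : Matrix (Fin g) (Fin g) ℂ)) u
  have h2 : (fun j => -n (Sum.inl j)) - (fun j => -n (Sum.inl j)) = (0 : Fin g → ℤ) := sub_self _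
  change thetaInt k _ _ (u + freqVec k n) = _ at h1
  change _ = Complex.exp (_ * ((k * omega u (freqVec k n) : ℝ) : ℂ) + _) * _ at h1
  rw [omega_freqVec hk] at h1
  rw [transport_apply, vacuum_apply, vacuum_apply, h1, h2, map_mul, ← Complex.exp_conj, torusChar,
    ← mul_assoc, ← mul_assoc, ← Complex.exp_add, ← Complex.exp_add, omega_comm]
  congr 2
  have h3 : (k : ℂ) * (omega u (freqVec k n) : ℝ) = (freqForm n u : ℝ) := by
    rw [← omega_freqVec hk]; push_cast; ring
  have h4 : conj (∑ j : Fin g, (2 * ((-n (Sum.inl j) : ℤ) : ℂ) * (n (Sum.inr j) : ℂ) / k -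
      (n (Sum.inr j) : ℂ) * ((-n (Sum.inl j) : ℤ) : ℂ) / k)) = (freqPhase k n : ℝ) := by
    rw [freqPhase]
    push_cast
    rw [map_sum, ← Finset.sum_neg_distrib]
    refine Finset.sum_congr rfl fun j _ => ?_
    simp only [map_sub, map_div₀, map_mul, map_neg, map_intCast, map_natCast, Complex.conj_ofNat]
    ring
  simp only [map_add, map_mul, map_neg, Complex.conj_ofReal, Complex.conj_I, h4]
  push_cast
  linear_combination (-(Real.pi * Complex.I)) * h3

/-- The phase by which a character acts on a transported vacuum. -/
noncomputable def charPhase (k : ℕ) (n : Fin g ⊕ Fin g → ℤ) (v : Cover g) : ℝ :=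
  -(2 * freqForm n v) + freqPhase k n - k * omega (freqVec k n) v

/-- Moving the character through the transport costs its value at `-v`; the two transports are then
composed by the Heisenberg relation. -/
theorem mulSection_charSection_transport_vacuum (hk : k ≠ 0) (n : Fin g ⊕ Fin g → ℤ)
    (v : Cover g) :
    mulSection (charSection n) (transport v (vacuum hk 0)) =
      Complex.exp ((Real.pi * Complex.I) * (charPhase k n v : ℝ)) •
        transport (v + freqVec k n) (classVacuum hk (freqClass hk n)) := by
  have h1 : mulSection (charSection n) (transport v (vacuum hk 0)) =
      torusChar (-n) v • transport v (mulSection (charSection n) (vacuum hk 0)) := by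
    refine Subtype.ext (funext fun u => ?_)
    change torusChar n u * (transport v _).1 u = torusChar (-n) v * (transport v _).1 u
    rw [transport_apply, transport_apply]
    change _ = torusChar (-n) v * (_ * (torusChar n (u + v) * _))
    have h2 : torusChar (-n) v * torusChar n v = 1 := by
      rw [← conj_torusChar, mul_comm, Complex.mul_conj, Complex.normSq_eq_norm_sq, norm_torusChar]
      simp
    rw [torusChar_add_vec]
    linear_combination (-(torusChar n u * Complex.exp (-(k * Real.pi * Complex.I) *
      (omega v u : ℝ)) * (vacuum hk 0).1 (u + v))) * h2
  have h3 : ∀ (c : ℂ) (ψ : SmoothSection g (-(k : ℤ))), transport v (c • ψ) = c • transport v ψ :=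
    fun c ψ => Subtype.ext (funext fun u => mul_left_comm _ _ _)
  rw [h1, mulSection_charSection_vacuum, h3, transport_transport, smul_smul, smul_smul]
  congr 1
  rw [← conj_torusChar, torusChar, ← Complex.exp_conj, ← Complex.exp_add, ← Complex.exp_add]
  congr 1
  simp only [charPhase, map_mul, Complex.conj_ofReal, Complex.conj_I, Complex.conj_ofNat]
  push_cast
  ring

theorem norm_exp_pi_I_mul (x : ℝ) : ‖Complex.exp ((Real.pi * Complex.I) * (x : ℝ))‖ = 1 := by
  have : (Real.pi * Complex.I) * (x : ℝ) = ((Real.pi * x : ℝ) : ℂ) * Complex.I := by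
    push_cast; ring
  rw [this, Complex.norm_exp_ofReal_mul_I]

end Vacuum

/-! ### Test sections as combinations of transported vacua -/

section Partition

variable {g k : ℕ}

/-- The function `φ s` on the torus, for sections `φ` of `L^{-k}` and `s` of `L^k`. -/
def contractSection (φ : SmoothSection g (-(k : ℤ))) (s : SmoothSection g (k : ℤ)) :
    SmoothSection g 0 :=
  periodicSection (fun u => φ.1 u * s.1 u) (φ.2.1.mul s.2.1) fun lam u => by
    have h : autFactor (-(k : ℤ)) lam u * autFactor (k : ℤ) lam u = 1 := by
      have h0 : semichar lam ≠ 0 := zpow_ne_zero _ (by norm_num)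
      simp only [autFactor]
      rw [mul_mul_mul_comm, ← zpow_add₀ h0, ← Complex.exp_add]
      simp
    rw [φ.2.2, s.2.2]
    linear_combination (φ.1 u * s.1 u) * h

theorem norm_autFactor (n : ℤ) (lam : Lattice g) (u : Cover g) : ‖autFactor n lam u‖ = 1 := by
  have h : -(n * Real.pi * Complex.I) * (omega u (latticeVec lam) : ℝ) =
      (Real.pi * Complex.I) * ((-(n * omega u (latticeVec lam)) : ℝ) : ℂ) := by
    push_cast; ring
  rw [autFactor, norm_mul, h, norm_exp_pi_I_mul, mul_one, semichar]
  simp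

theorem exists_add_latticeVec_mem_unitCube (u : Cover g) :
    ∃ lam : Lattice g, u + latticeVec lam ∈ unitCube g := by
  refine ⟨(fun j => -⌊u.1 j⌋, fun j => -⌊u.2 j⌋), ⟨⟨fun j => ?_, fun j => ?_⟩,
    ⟨fun j => ?_, fun j => ?_⟩⟩⟩
  · change 0 ≤ u.1 j + ((-⌊u.1 j⌋ : ℤ) : ℝ)
    push_cast; linarith [Int.floor_le (u.1 j)]
  · change 0 ≤ u.2 j + ((-⌊u.2 j⌋ : ℤ) : ℝ)
    push_cast; linarith [Int.floor_le (u.2 j)]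
  · change u.1 j + ((-⌊u.1 j⌋ : ℤ) : ℝ) ≤ 1
    push_cast; linarith [Int.lt_floor_add_one (u.1 j)]
  · change u.2 j + ((-⌊u.2 j⌋ : ℤ) : ℝ) ≤ 1
    push_cast; linarith [Int.lt_floor_add_one (u.2 j)]

/-- The squared norm of the underlying theta function is a nonzero Gaussian integral. -/
theorem exists_vacuum_ne_zero (hk : k ≠ 0) : ∃ u, (vacuum (g := g) hk 0).1 u ≠ 0 := by
  by_contra! h
  have hk0 : 0 < k := Nat.pos_of_ne_zero hk
  have hΩ := I_smul_one_mem_siegelUpper g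
  have h1 := sectionInner_thetaSection hk (fun _ => ⟨0, hk0⟩) (fun _ => ⟨0, hk0⟩) hΩ hΩ
  rw [if_pos rfl] at h1
  refine gaussInt_ne_zero (pairingMatrix_mem_rightHalf hk hΩ hΩ) (h1.symm.trans ?_)
  rw [sectionInner]
  refine (MeasureTheory.integral_congr_ae (Filter.Eventually.of_forall fun u => ?_)).trans
    (MeasureTheory.integral_zero _ _)
  have h2 : conj (thetaInt k 0 (Complex.I • (1 : Matrix (Fin g) (Fin g) ℂ)) u) = 0 := h u
  change _ * conj (thetaInt k 0 _ u) = 0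
  rw [h2, mul_zero]

/-- Transporting by `u₀ - u` makes `φ` nonzero at `u`. Compactness of the cube selects finitely many
transports, and automorphy extends the conclusion to all points. -/
theorem exists_finset_transport_ne_zero {φ : SmoothSection g (-(k : ℤ))} (hφ : ∃ u, φ.1 u ≠ 0) :
    ∃ t : Finset (Cover g), ∀ u, ∃ v ∈ t, (transport v φ).1 u ≠ 0 := by
  obtain ⟨u₀, hu₀⟩ := hφ
  obtain ⟨t, ht⟩ := (isCompact_unitCube g).elim_finite_subcover
    (fun v : Cover g => {u | (transport v φ).1 u ≠ 0})
    (fun v => isOpen_ne_fun (transport v φ).2.1.continuous continuous_const)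
    (fun u _ => Set.mem_iUnion.2 ⟨u₀ - u, by
      rw [Set.mem_ofPred_eq, transport_apply, add_sub_cancel]
      exact mul_ne_zero (Complex.exp_ne_zero _) hu₀⟩)
  refine ⟨t, fun u => ?_⟩
  obtain ⟨lam, hlam⟩ := exists_add_latticeVec_mem_unitCube u
  obtain ⟨v, hv, hne⟩ := Set.mem_iUnion₂.1 (ht hlam)
  refine ⟨v, hv, ?_⟩
  rw [Set.mem_ofPred_eq, (transport v φ).2.2] at hne
  exact right_ne_zero_of_mul hne

/-- Take `conj ψ_i / ∑ |ψ_j|²`; the denominator is periodic because the factors of automorphy are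
unimodular. -/
theorem exists_dual_family {ι : Type*} (t : Finset ι) (ψ : ι → SmoothSection g (-(k : ℤ)))
    (h : ∀ u, ∃ i ∈ t, (ψ i).1 u ≠ 0) :
    ∃ G : ι → SmoothSection g (k : ℤ), ∀ u, ∑ i ∈ t, (ψ i).1 u * (G i).1 u = 1 := by
  set S : Cover g → ℂ := fun u => ∑ i ∈ t, (ψ i).1 u * conj ((ψ i).1 u) with hS
  have hS' : ∀ u, S u = ((∑ i ∈ t, ‖(ψ i).1 u‖ ^ 2 : ℝ) : ℂ) := fun u => by
    simp only [hS, Complex.mul_conj, Complex.normSq_eq_norm_sq, Complex.ofReal_sum]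
  have hS0 : ∀ u, S u ≠ 0 := fun u => by
    obtain ⟨i, hi, hne⟩ := h u
    rw [hS', Complex.ofReal_ne_zero]
    exact (Finset.sum_pos' (fun i _ => by positivity) ⟨i, hi, by positivity⟩).ne'
  have hconj : ContDiff ℝ ∞ (fun z : ℂ => conj z) := Complex.conjCLE.contDiff
  have hSc : ContDiff ℝ ∞ S :=
    ContDiff.sum fun i _ => (ψ i).2.1.mul (hconj.comp (ψ i).2.1)
  have hSp : ∀ (lam : Lattice g) u, S (u + latticeVec lam) = S u := fun lam u => by
    rw [hS', hS']
    simp only [(ψ _).2.2, norm_mul, norm_autFactor, one_mul]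
  refine ⟨fun i => ⟨fun u => conj ((ψ i).1 u) * (S u)⁻¹,
    (hconj.comp (ψ i).2.1).mul (hSc.inv hS0), fun lam u => ?_⟩, fun u => ?_⟩
  · beta_reduce
    rw [hSp, (ψ i).2.2, map_mul, conj_autFactor, neg_neg, mul_assoc]
  · simp only [← mul_assoc, ← Finset.sum_mul]
    exact mul_inv_cancel₀ (hS0 u)

end Partition

end TorusBKS

namespace TorusBKS

open Matrix

/-! ### Expansion of covariantly constant distributions in continuous kernels -/

section Kernel

variable {g k : ℕ}

theorem summable_norm_torusCoeff (F : SmoothSection g 0) :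
    Summable fun n => ‖torusCoeff F.1 n‖ := by
  simpa using summable_torusCoeff_mul F 0

theorem summable_torusCoeff_mul_of_norm_le_one (F : SmoothSection g 0)
    {w : (Fin g ⊕ Fin g → ℤ) → ℂ} (hw : ∀ n, ‖w n‖ ≤ 1) :
    Summable fun n => torusCoeff F.1 n * w n :=
  Summable.of_norm_bounded (summable_norm_torusCoeff F) fun n => by
    rw [norm_mul]; exact mul_le_of_le_one_right (norm_nonneg _) (hw n)

theorem torusCoeff_contractSection_add (φ ψ : SmoothSection g (-(k : ℤ)))
    (G : SmoothSection g (k : ℤ)) (n : Fin g ⊕ Fin g → ℤ) :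
    torusCoeff (contractSection (φ + ψ) G).1 n =
      torusCoeff (contractSection φ G).1 n + torusCoeff (contractSection ψ G).1 n := by
  refine Eq.trans ?_ (MeasureTheory.integral_add
    (integrableOn_mul (charSection (-n)) (contractSection φ G))
    (integrableOn_mul (charSection (-n)) (contractSection ψ G)))
  refine MeasureTheory.integral_congr_ae (Filter.Eventually.of_forall fun u => ?_)
  change torusChar (-n) u * ((φ.1 u + ψ.1 u) * G.1 u) =
    torusChar (-n) u * (φ.1 u * G.1 u) + torusChar (-n) u * (ψ.1 u * G.1 u)
  ring

theorem torusCoeff_contractSection_smul (c : ℂ) (φ : SmoothSection g (-(k : ℤ)))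
    (G : SmoothSection g (k : ℤ)) (n : Fin g ⊕ Fin g → ℤ) :
    torusCoeff (contractSection (c • φ) G).1 n = c * torusCoeff (contractSection φ G).1 n := by
  rw [torusCoeff, torusCoeff, ← MeasureTheory.integral_const_mul]
  refine MeasureTheory.integral_congr_ae (Filter.Eventually.of_forall fun u => ?_)
  change torusChar (-n) u * ((c * φ.1 u) * G.1 u) = c * (torusChar (-n) u * (φ.1 u * G.1 u))
  ring

/-- The distributional section `φ ↦ ∑ w_n (φ G)^(n)`, for bounded weights `w`. -/
noncomputable def weightedFourier (G : SmoothSection g (k : ℤ)) (w : (Fin g ⊕ Fin g → ℤ) → ℂ)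
    (hw : ∀ n, ‖w n‖ ≤ 1) : DistSection g k :=
  ⟨{ toFun := fun φ => ∑' n, torusCoeff (contractSection φ G).1 n * w n
     map_add' := fun φ ψ => by
      rw [← (summable_torusCoeff_mul_of_norm_le_one (contractSection φ G) hw).tsum_add
        (summable_torusCoeff_mul_of_norm_le_one (contractSection ψ G) hw)]
      exact tsum_congr fun n => by rw [torusCoeff_contractSection_add]; ring
     map_smul' := fun c φ => by
      rw [RingHom.id_apply, smul_eq_mul, ← tsum_mul_left]
      exact tsum_congr fun n => by rw [torusCoeff_contractSection_smul]; ring },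
   by
    -- With `q` derivatives of `φ G` bounded, its coefficients are `O((1 + ‖n‖)^{-q})`, which is
    -- summable; the estimate is uniform in `w`.
    set q := 2 * Fintype.card (Fin g ⊕ Fin g)
    obtain ⟨B, hB⟩ := exists_bound_iteratedFDeriv G.2.1 q
    have hs := summable_one_add_norm_pow (Fin g ⊕ Fin g)
    refine ⟨q, 2 ^ (q + 1) * (2 ^ q * B) *
      ∑' n : Fin g ⊕ Fin g → ℤ, ((1 + ‖n‖) ^ q)⁻¹, fun φ M hM => ?_⟩
    have hC := (hs.mul_left (2 ^ (q + 1) * (2 ^ q * M * B))).hasSum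
    rw [tsum_mul_left] at hC
    refine (tsum_of_norm_bounded hC fun n => ?_).trans (le_of_eq (by ring))
    have h := one_add_pow_mul_norm_torusCoeff_le q (contractSection φ G) n
      (M := 2 ^ q * M * B) fun j hj u hu => norm_iteratedFDeriv_mul_le' φ.2.1 G.2.1 hj u
        (fun i hi => hM i hi u hu) fun i hi => hB i hi u hu
    rw [norm_mul, ← div_eq_mul_inv, le_div_iff₀ (by positivity)]
    calc ‖torusCoeff (contractSection φ G).1 n‖ * ‖w n‖ * (1 + ‖n‖) ^ q
        ≤ ‖torusCoeff (contractSection φ G).1 n‖ * 1 * (1 + ‖n‖) ^ q := by gcongr; exact hw n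
      _ = (1 + ‖n‖) ^ q * ‖torusCoeff (contractSection φ G).1 n‖ := by ring
      _ ≤ _ := h⟩

theorem eval_weightedFourier (G : SmoothSection g (k : ℤ)) {w : (Fin g ⊕ Fin g → ℤ) → ℂ}
    (hw : ∀ n, ‖w n‖ ≤ 1) (φ : SmoothSection g (-(k : ℤ))) :
    (weightedFourier G w hw).eval φ = ∑' n, torusCoeff (contractSection φ G).1 n * w n := rfl

theorem continuous_distSection_iff {X : Type*} [TopologicalSpace X] {f : X → DistSection g k} :
    Continuous f ↔ ∀ φ, Continuous fun x => (f x).eval φ :=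
  continuous_induced_rng.trans continuous_pi_iff

/-- The Fourier coefficients of each test function give a summable majorant independent of `x`. -/
theorem continuous_weightedFourier {X : Type*} [TopologicalSpace X] (G : SmoothSection g (k : ℤ))
    {w : X → (Fin g ⊕ Fin g → ℤ) → ℂ} (hw : ∀ x n, ‖w x n‖ ≤ 1)
    (hc : ∀ n, Continuous fun x => w x n) :
    Continuous fun x => weightedFourier G (w x) (hw x) := by
  refine continuous_distSection_iff.2 fun φ => ?_
  refine continuous_tsum (fun n => continuous_const.mul (hc n))
    (summable_norm_torusCoeff (contractSection φ G)) fun n x => ?_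
  rw [norm_mul]
  exact mul_le_of_le_one_right (norm_nonneg _) (hw x n)

theorem eval_sum {ι : Type*} (s : Finset ι) (T : ι → DistSection g k)
    (φ : SmoothSection g (-(k : ℤ))) : (∑ i ∈ s, T i).eval φ = ∑ i ∈ s, (T i).eval φ :=
  map_sum (⟨⟨fun T => T.eval φ, rfl⟩, fun S T => eval_add S T φ⟩ : DistSection g k →+ ℂ) T s

/-- The real part of `z·τz` is at most `|z|²` for a contraction. On the boundary the factor may stop
decaying, but it stays bounded, and rapid decay of Fourier coefficients does the rest. -/
theorem norm_exp_weightExponent_le {τ : Matrix (Fin g) (Fin g) ℂ} (hτ : τ ∈ closedDisc g)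
    (v : Cover g) : ‖Complex.exp (weightExponent k τ v)‖ ≤ 1 := by
  rw [Complex.norm_exp, Real.exp_le_one_iff, weightExponent]
  have h1 := (Complex.re_le_norm _).trans 
    (norm_dotProduct_mulVec_le_normSqVec (normSqVec_mulVec_le hτ (zVec v)))
  have h2 : -(Real.pi * k / 2 : ℂ) = ((-(Real.pi * k / 2) : ℝ) : ℂ) := by push_cast; ring
  rw [h2, Complex.re_ofReal_mul, Complex.sub_re, Complex.ofReal_re]
  have : 0 ≤ Real.pi * k / 2 := by positivity
  nlinarith

theorem continuous_weightExponent (v : Cover g) :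
    Continuous fun τ : Matrix (Fin g) (Fin g) ℂ => weightExponent k τ v :=
  continuous_const.mul (continuous_const.sub
    (continuous_const.dotProduct (continuous_id.matrix_mulVec continuous_const)))

/-- The weights of the kernel of the class `l`. -/
noncomputable def kernelWeight (hk : k ≠ 0) (v : Cover g) (l : Fin g → Fin k)
    (τ : Matrix (Fin g) (Fin g) ℂ) (n : Fin g ⊕ Fin g → ℤ) : ℂ :=
  if freqClass hk n = l then Complex.exp ((Real.pi * Complex.I) * (charPhase k n v : ℝ)) *
    Complex.exp (weightExponent k τ (v + freqVec k n)) else 0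

theorem norm_kernelWeight_le (hk : k ≠ 0) (v : Cover g) (l : Fin g → Fin k)
    {τ : Matrix (Fin g) (Fin g) ℂ} (hτ : τ ∈ closedDisc g) (n : Fin g ⊕ Fin g → ℤ) :
    ‖kernelWeight hk v l τ n‖ ≤ 1 := by
  rw [kernelWeight]
  split_ifs
  · rw [norm_mul, norm_exp_pi_I_mul, one_mul]
    exact norm_exp_weightExponent_le hτ _
  · simp

/-- Write `φ = ∑ v, (φ G_v) ψ_v` with `ψ_v` transports of the vacuum of class `0`, and expand `φ
G_v` in characters. Each character times `ψ_v` is a phase times the transport of a vacuum of class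
`freqClass n`, on which `T` is known by `eval_transport`. Grouping frequencies by class gives
kernels that do not depend on `T`. -/
theorem exists_kernel (hk : k ≠ 0) : ∃ K : (Fin g → Fin k) → closedDisc g → DistSection g k,
    (∀ l, Continuous (K l)) ∧ ∀ (τ : closedDisc g), ∀ T ∈ covConstSections g k τ.1,
      T = ∑ l, T.eval (classVacuum hk l) • K l τ := by
  obtain ⟨t, ht⟩ := exists_finset_transport_ne_zero (exists_vacuum_ne_zero (g := g) hk)
  obtain ⟨G, hG⟩ := exists_dual_family t (fun v => transport v (vacuum hk 0)) ht
  refine ⟨fun l τ => ∑ v ∈ t, weightedFourier (G v) (kernelWeight hk v l τ.1)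
    (norm_kernelWeight_le hk v l τ.2), fun l => ?_, fun τ T hT => ?_⟩
  · refine continuous_distSection_iff.2 fun φ => ?_
    simp only [eval_sum]
    refine continuous_finsetSum _ fun v _ => ?_
    refine continuous_distSection_iff.1 (continuous_weightedFourier (G v)
      (fun τ => norm_kernelWeight_le hk v l τ.2) fun n => ?_) φ
    simp only [kernelWeight]
    split_ifs
    · exact continuous_const.mul
        ((continuous_weightExponent _).comp continuous_subtype_val).cexp
    · exact continuous_const
  · refine Subtype.ext (LinearMap.ext fun φ => ?_)
    change T.eval φ = (∑ l, T.eval (classVacuum hk l) • ∑ v ∈ t, _ : DistSection g k).eval φ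
    simp only [eval_sum, eval_smul, eval_weightedFourier]
    have h1 : φ = ∑ v ∈ t, mulSection (contractSection φ (G v)) (transport v (vacuum hk 0)) := by
      refine Subtype.ext (funext fun u => ?_)
      rw [AddSubmonoidClass.coe_finsetSum, Finset.sum_apply]
      refine (mul_one (φ.1 u)).symm.trans ?_
      rw [← hG u, Finset.mul_sum]
      refine Finset.sum_congr rfl fun v _ => ?_
      change φ.1 u * ((transport v (vacuum hk 0)).1 u * (G v).1 u) =
        φ.1 u * (G v).1 u * (transport v (vacuum hk 0)).1 u
      ring
    have h2 : ∀ v, T.1 (mulSection (contractSection φ (G v)) (transport v (vacuum hk 0))) =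
        ∑ l, T.eval (classVacuum hk l) *
          ∑' n, torusCoeff (contractSection φ (G v)).1 n * kernelWeight hk v l τ.1 n := by
      intro v
      -- For each frequency only one class has a nonzero weight, so the finite sum over classes
      -- recovers the single Fourier term.
      have h3 := hasSum_sum (s := Finset.univ) fun l (_ : l ∈ Finset.univ) =>
        ((summable_torusCoeff_mul_of_norm_le_one (contractSection φ (G v))
          (norm_kernelWeight_le hk v l τ.2)).hasSum.mul_left (T.eval (classVacuum hk l)))
      refine (hasSum_torusCoeff_functional T (contractSection φ (G v)) _).unique
        (HasSum.congr_fun h3 fun n => ?_)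
      have h4 := eval_transport hT (φ := classVacuum hk (freqClass hk n)) (covDeriv_vacuum hk _)
        (v + freqVec k n)
      rw [mulSection_charSection_transport_vacuum, map_smul, h4,
        Finset.sum_eq_single (freqClass hk n)]
      · rw [kernelWeight, if_pos rfl, smul_eq_mul]
        change _ * (_ * (T.eval (classVacuum hk (freqClass hk n)) * _)) = _
        ring
      · intro l _ hl
        rw [kernelWeight, if_neg hl.symm, mul_zero, mul_zero]
      · exact fun h => absurd (Finset.mem_univ _) h
    conv_lhs => rw [h1]
    refine (map_sum T.1 _ _).trans ?_
    simp only [h2, Finset.mul_sum]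
    exact Finset.sum_comm

end Kernel

end TorusBKS

namespace TorusBKS

open Matrix MeasureTheory

/-! ### Covariantly constant distributions and the frame over the closed disc -/

section CovariantlyConstant

variable {g k : ℕ}

theorem dirDeriv_sum_smul {ι : Type*} (s : Finset ι) (f : Cover g → ℂ) (u : Cover g) (c : ι → ℂ)
    (w : ι → ComplexTangent g) :
    dirDeriv f u (∑ i ∈ s, c i • w i) = ∑ i ∈ s, c i * dirDeriv f u (w i) := by
  simp only [dirDeriv, Prod.fst_sum, Prod.snd_sum, Finset.sum_apply, Prod.smul_fst, Prod.smul_snd,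
    Pi.smul_apply, smul_eq_mul, Finset.sum_mul, Finset.mul_sum, ← Finset.sum_add_distrib]
  rw [Finset.sum_comm]
  exact Finset.sum_congr rfl fun i _ => Finset.sum_congr rfl fun j _ => by ring

theorem connForm_sum_smul {ι : Type*} (s : Finset ι) (u : Cover g) (c : ι → ℂ)
    (w : ι → ComplexTangent g) :
    connForm u (∑ i ∈ s, c i • w i) = ∑ i ∈ s, c i * connForm u (w i) := by
  simp only [connForm, Prod.fst_sum, Prod.snd_sum, Finset.sum_apply, Prod.smul_fst, Prod.smul_snd,
    Pi.smul_apply, smul_eq_mul, Finset.mul_sum, ← Finset.sum_sub_distrib]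
  rw [Finset.sum_comm]
  exact Finset.sum_congr rfl fun i _ => Finset.sum_congr rfl fun j _ => by ring

/-- Since `(a, b) ↦ b - i a` sends `antiholVec τ p` to `2 p`, the parameter `p` is recovered by a
linear formula independent of `τ`. Thus coefficients of vector fields in the polarization are smooth
and periodic. -/
theorem conjTangent_eq_of_mem {τ : Matrix (Fin g) (Fin g) ℂ} {x : ComplexTangent g}
    (hx : x ∈ polarization τ) :
    conjTangent x = antiholVec τ fun m =>
      (1 / 2 : ℂ) * ((conjTangent x).2 m - Complex.I * (conjTangent x).1 m) := by
  obtain ⟨c, hc⟩ := (Submodule.mem_span_range_iff_exists_fun ℂ).1 hx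
  have h1 : conjTangent x = antiholVec τ fun m => conj (c m) := by
    rw [← conjTangent_conjTangent (antiholVec τ fun m => conj (c m)), conjTangent_antiholVec, ← hc]
    simp only [Complex.conj_conj]
    rfl
  rw [h1]
  congr 1
  funext m
  simp only [antiholVec, Pi.smul_apply, smul_eq_mul, add_mulVec, sub_mulVec, one_mulVec,
    Pi.add_apply, Pi.sub_apply]
  linear_combination ((1 / 2 : ℂ) * (conj (c m) - (τ *ᵥ fun m => conj (c m)) m)) * Complex.I_sq

theorem antiholVec_eq_sum (τ : Matrix (Fin g) (Fin g) ℂ) (p : Fin g → ℂ) :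
    antiholVec τ p = ∑ m, p m • antiholVec τ (Pi.single m 1) := by
  refine Prod.ext (funext fun l => ?_) (funext fun l => ?_)
  · simp only [antiholVec, Prod.fst_sum, Prod.smul_fst, Finset.sum_apply, Pi.smul_apply,
      smul_eq_mul, mulVec_single_one, mulVec, dotProduct, Finset.mul_sum, col_apply]
    exact Finset.sum_congr rfl fun m _ => by ring
  · simp only [antiholVec, Prod.snd_sum, Prod.smul_snd, Finset.sum_apply, Pi.smul_apply,
      smul_eq_mul, mulVec_single_one, mulVec, dotProduct, col_apply]
    exact Finset.sum_congr rfl fun m _ => by ring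

theorem div_eq_sum_dirDeriv {ι : Type*} [Fintype ι] (ξ : VectorField g) (F : ι → Cover g → ℂ)
    (w : ι → ComplexTangent g) (hF : ∀ i, Differentiable ℝ (F i))
    (h : ∀ u, ξ.toFun u = ∑ i, F i u • w i) (u : Cover g) :
    ξ.div u = ∑ i, dirDeriv (F i) u (w i) := by
  have h1 : HasFDerivAt ξ.toFun (∑ i, (fderiv ℝ (F i) u).smulRight (w i)) u := by
    rw [funext h]
    exact HasFDerivAt.fun_sum fun i _ => ((hF i u).hasFDerivAt.smul_const (w i))
  simp only [VectorField.div, h1.fderiv, dirDeriv, _root_.sum_apply,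
    ContinuousLinearMap.smulRight_apply, Prod.fst_sum, Prod.snd_sum, Finset.sum_apply,
    Prod.smul_fst, Prod.smul_snd, Pi.smul_apply, smul_eq_mul, ← Finset.sum_add_distrib]
  rw [Finset.sum_comm]
  exact Finset.sum_congr rfl fun i _ => Finset.sum_congr rfl fun j _ => by ring

/-- For a field `∑ F_i w_i` with constant `w_i`, the divergence supplies the derivatives of the
`F_i` in the Leibniz rule. -/
theorem divMul_add_covDeriv {n : ℤ} {ι : Type*} [Fintype ι] (ξ : VectorField g)
    (F : ι → SmoothSection g 0) (w : ι → ComplexTangent g)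
    (h : ∀ u, ξ.toFun u = ∑ i, (F i).1 u • w i) (φ : SmoothSection g n) :
    divMul ξ φ + covDeriv ξ φ = ∑ i, covDeriv (constField (w i)) (mulSection (F i) φ) := by
  refine Subtype.ext (funext fun u => ?_)
  rw [AddSubmonoidClass.coe_finsetSum, Finset.sum_apply]
  change ξ.div u * φ.1 u + (covDeriv ξ φ).1 u = _
  have h1 : ∀ i, (covDeriv (constField (w i)) (mulSection (F i) φ)).1 u =
      (F i).1 u * dirDeriv φ.1 u (w i) + φ.1 u * dirDeriv (F i).1 u (w i) -
        n * Real.pi * Complex.I * ((F i).1 u * φ.1 u) * connForm u (w i) := fun i => by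
    rw [covDeriv_apply]
    change dirDeriv (fun u => (F i).1 u * φ.1 u) u (w i) - _ * ((F i).1 u * φ.1 u) *
      connForm u (w i) = _
    rw [dirDeriv_mul (differentiable_section (F i) u) (differentiable_section φ u)]
  rw [Finset.sum_congr rfl fun i _ => h1 i, covDeriv_apply,
    div_eq_sum_dirDeriv ξ (fun i => (F i).1) w (fun i => differentiable_section (F i)) h, h,
    dirDeriv_sum_smul, connForm_sum_smul, Finset.sum_mul, Finset.mul_sum, ← Finset.sum_sub_distrib,
    ← Finset.sum_add_distrib]
  exact Finset.sum_congr rfl fun i _ => by ring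

/-- Constant antiholomorphic fields suffice: a general field is a combination of them with smooth
periodic coefficients, which can be absorbed into the test section. -/
theorem mem_covConstSections_of {τ : Matrix (Fin g) (Fin g) ℂ} {T : DistSection g k}
    (hT : ∀ p φ, T.eval (covDeriv (constField (antiholVec τ p)) φ) = 0) :
    T ∈ covConstSections g k τ := by
  intro ξ hξ φ
  have hs : ContDiff ℝ ∞ ξ.conj.toFun := ξ.conj.smooth
  set F : Fin g → SmoothSection g 0 := fun m => periodicSection
    (fun u => (1 / 2 : ℂ) * ((ξ.conj.toFun u).2 m - Complex.I * (ξ.conj.toFun u).1 m))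
    (contDiff_const.mul ((contDiff_snd_apply ξ.conj m).sub
      (contDiff_const.mul (contDiff_fst_apply ξ.conj m))))
    (fun lam u => by rw [ξ.conj.periodic])
  rw [weakCovDeriv, divMul_add_covDeriv ξ.conj F (fun m => antiholVec τ (Pi.single m 1)), neg_eq_zero]
  · exact (map_sum T.1 _ _).trans (Finset.sum_eq_zero fun m _ => hT _ _)
  · intro u
    exact (conjTangent_eq_of_mem (hξ u)).trans (antiholVec_eq_sum τ _)

theorem setIntegral_dirDeriv_eq_zero (F : SmoothSection g 0) (w : ComplexTangent g) :
    ∫ u in unitCube g, dirDeriv F.1 u w = 0 := by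
  have hF : ContDiff ℝ 1 F.1 := F.2.1.of_le (by exact_mod_cast le_top)
  have hi : ∀ (c : ℂ) (v : Cover g), IntegrableOn (fun u => c * fderiv ℝ F.1 u v) (unitCube g) :=
    fun c v => (continuous_const.mul ((hF.continuous_fderiv one_ne_zero).clm_apply
      continuous_const)).continuousOn.integrableOn_compact (isCompact_unitCube g)
  simp only [dirDeriv]
  rw [integral_finsetSum _ fun j _ => by exact (hi (w.1 j) (dX j)).add (hi (w.2 j) (dY j))]
  refine Finset.sum_eq_zero fun j _ => ?_
  rw [integral_add (hi _ _) (hi _ _), integral_const_mul, integral_const_mul,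
    setIntegral_fderiv_eq_zero hF (section_zero_periodic F),
    setIntegral_fderiv_eq_zero hF (section_zero_periodic F), mul_zero, mul_zero, add_zero]

theorem eval_smoothToDist (s : SmoothSection g (k : ℤ)) (φ : SmoothSection g (-(k : ℤ))) :
    (smoothToDist s).eval φ = ∫ u in unitCube g, s.1 u * φ.1 u := rfl

/-- Integration by parts on the torus; the connection terms of `L^k` and `L^{-k}` cancel in the
product. -/
theorem eval_smoothToDist_covDeriv (s : SmoothSection g (k : ℤ)) (φ : SmoothSection g (-(k : ℤ)))
    (w : ComplexTangent g) :
    (smoothToDist s).eval (covDeriv (constField w) φ) =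
      -(smoothToDist (covDeriv (constField w) s)).eval φ := by
  rw [eq_neg_iff_add_eq_zero, eval_smoothToDist, eval_smoothToDist,
    ← integral_add (integrableOn_mul _ _) (integrableOn_mul _ _),
    ← setIntegral_dirDeriv_eq_zero (contractSection φ s) w]
  refine integral_congr_ae (Filter.Eventually.of_forall fun u => ?_)
  beta_reduce
  rw [covDeriv_apply, covDeriv_apply]
  change _ = dirDeriv (fun u => φ.1 u * s.1 u) u w
  rw [dirDeriv_mul (differentiable_section φ u) (differentiable_section s u)]
  change s.1 u * (dirDeriv φ.1 u w - _) + (dirDeriv s.1 u w - _) * φ.1 u = _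
  push_cast
  ring

theorem smoothToDist_thetaSection_mem (hk : k ≠ 0) (l : Fin g → ℤ)
    {τ : Matrix (Fin g) (Fin g) ℂ} (hτ : τ ∈ openDisc g) :
    smoothToDist (thetaSection hk l (period_mem_siegelUpper hτ)) ∈ covConstSections g k τ := by
  refine mem_covConstSections_of fun p φ => ?_
  rw [eval_smoothToDist_covDeriv, covDeriv_thetaSection hk l (period_mem_siegelUpper hτ), neg_eq_zero,
    eval_smoothToDist]
  · refine (integral_congr_ae (Filter.Eventually.of_forall fun u => ?_)).trans
      (integral_zero _ _)
    exact zero_mul _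
  · simp only [antiholVec]
    rw [mulVec_mulVec, period_mul_one_add hτ, smul_mulVec]

theorem eval_smoothToDist_conjSection (s s' : SmoothSection g (k : ℤ)) :
    (smoothToDist s).eval (conjSection s') = sectionInner s s' := rfl

/-- The vacuum is the conjugate theta function at `Ω = i`, so the pairing matrix is `2k (1 + τ)⁻¹`,
and `gaussInt_inv_mul` converts its Gaussian integral to the chosen root of `det (1 + τ)`. -/
theorem eval_smoothToDist_thetaSection (hk : k ≠ 0) (l l' : Fin g → Fin k)
    {τ : Matrix (Fin g) (Fin g) ℂ} (hτ : τ ∈ openDisc g) :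
    (smoothToDist (thetaSection hk (fun j => ((l j : ℕ) : ℤ)) (period_mem_siegelUpper hτ))).eval
      (classVacuum hk l') =
      if l = l' then ((Real.sqrt (2 * k) ^ g)⁻¹ : ℝ) * sqrtDetOneAdd τ else 0 := by
  rw [classVacuum, vacuum, eval_smoothToDist_conjSection, sectionInner_thetaSection]
  congr 1
  have hk0 : (0 : ℝ) < 2 * k := by
    have : (0 : ℝ) < k := by exact_mod_cast Nat.pos_of_ne_zero hk
    linarith
  have h1 : pairingMatrix k (period τ) (Complex.I • 1) = ((2 * k : ℝ) : ℂ) • (1 + τ)⁻¹ := by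
    have h2 : -Complex.I • (Complex.I • (1 : Matrix (Fin g) (Fin g) ℂ)) = 1 := by
      rw [smul_smul]; simp
    have h3 : (1 : Matrix (Fin g) (Fin g) ℂ).map conj = 1 :=
      Matrix.map_one _ (map_zero _) (map_one _)
    rw [pairingMatrix, h2, h3, add_comm, one_add_neg_I_smul_period hτ, smul_smul]
    push_cast
    rw [mul_comm]
  rw [h1, gaussInt_smul hk0, sqrtDetOneAdd]
  congr 1
  exact eq_inv_of_mul_eq_one_left (gaussInt_inv_mul (one_add_mem_rightHalf hτ))

theorem covDeriv_constField_sum_smul {n : ℤ} {ι : Type*} (t : Finset ι) (c : ι → ℂ)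
    (w : ι → ComplexTangent g) (φ : SmoothSection g n) :
    covDeriv (constField (∑ i ∈ t, c i • w i)) φ = ∑ i ∈ t, c i • covDeriv (constField (w i)) φ := by
  refine Subtype.ext (funext fun u => ?_)
  rw [AddSubmonoidClass.coe_finsetSum, Finset.sum_apply, covDeriv_apply]
  change dirDeriv φ.1 u (∑ i ∈ t, c i • w i) - _ * connForm u (∑ i ∈ t, c i • w i) =
    ∑ i ∈ t, c i * (dirDeriv φ.1 u (w i) - _ * connForm u (w i))
  rw [dirDeriv_sum_smul, connForm_sum_smul, Finset.mul_sum, ← Finset.sum_sub_distrib]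
  exact Finset.sum_congr rfl fun i _ => by ring

/-- The coordinate vectors of `ℂ^{2g}`. -/
def complexCoordVec (i : Fin g ⊕ Fin g) : ComplexTangent g :=
  Sum.elim (fun j => (Pi.single j 1, 0)) (fun j => (0, Pi.single j 1)) i

theorem eq_sum_complexCoordVec (w : ComplexTangent g) :
    w = ∑ i, Sum.elim w.1 w.2 i • complexCoordVec i := by
  rw [Fintype.sum_sum_type]
  refine Prod.ext (funext fun i => ?_) (funext fun i => ?_) <;>
    simp [complexCoordVec, Prod.fst_sum, Prod.snd_sum, Finset.sum_apply, Pi.single_apply]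

theorem dense_openDisc (g : ℕ) : Dense {τ : closedDisc g | τ.1 ∈ openDisc g} := by
  rw [Subtype.dense_iff]
  refine (le_of_eq rfl : closedDisc g ⊆ closure (openDisc g)).trans (closure_mono fun τ hτ => ?_)
  exact ⟨⟨τ, subset_closure hτ⟩, hτ, rfl⟩

/-- The topology is that of pointwise convergence, so it controls fixed test sections only.
Expanding `w x` in coordinate vectors moves the dependence on `x` into scalars. -/
theorem continuous_eval_covDeriv {X : Type*} [TopologicalSpace X] {T : X → DistSection g k}
    {w : X → ComplexTangent g} (hT : Continuous T) (hw : Continuous w)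
    (φ : SmoothSection g (-(k : ℤ))) :
    Continuous fun x => (T x).eval (covDeriv (constField (w x)) φ) := by
  have h : ∀ x, (T x).eval (covDeriv (constField (w x)) φ) =
      ∑ i, Sum.elim (w x).1 (w x).2 i *
        (T x).eval (covDeriv (constField (complexCoordVec i)) φ) := fun x => by
    conv_lhs => rw [eq_sum_complexCoordVec (w x), covDeriv_constField_sum_smul]
    refine (map_sum (T x).1 _ _).trans (Finset.sum_congr rfl fun i _ => ?_)
    exact map_smul (T x).1 _ _
  simp only [h]
  refine continuous_finsetSum _ fun i _ => Continuous.mul ?_ (continuous_distSection_iff.1 hT _)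
  rcases i with j | j
  · exact (continuous_apply j).comp hw.fst
  · exact (continuous_apply j).comp hw.snd

/-- The kernels `K^l_τ` are covariantly constant and dual to the vacua. -/
theorem exists_frame (hk : k ≠ 0) : ∃ K : (Fin g → Fin k) → closedDisc g → DistSection g k,
    (∀ l, Continuous (K l)) ∧ (∀ l τ, K l τ ∈ covConstSections g k τ.1) ∧
    (∀ l l' τ, (K l τ).eval (classVacuum hk l') = if l = l' then 1 else 0) ∧
    (∀ (τ : closedDisc g), ∀ T ∈ covConstSections g k τ.1,
      T = ∑ l, T.eval (classVacuum hk l) • K l τ) ∧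
    ∀ l (τ : closedDisc g) (hτ : τ.1 ∈ openDisc g),
      smoothToDist (thetaSection hk (fun j => ((l j : ℕ) : ℤ)) (period_mem_siegelUpper hτ)) =
      (((Real.sqrt (2 * k) ^ g)⁻¹ : ℝ) * sqrtDetOneAdd τ.1) • K l τ := by
  obtain ⟨K, hK, hexp⟩ := exists_kernel (g := g) hk
  have hc : ∀ l φ, Continuous fun τ => (K l τ).eval φ := fun l => continuous_distSection_iff.1 (hK l)
  have hdense := dense_openDisc g
  have hint : ∀ l (τ : closedDisc g) (hτ : τ.1 ∈ openDisc g),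
      smoothToDist (thetaSection hk (fun j => ((l j : ℕ) : ℤ)) (period_mem_siegelUpper hτ)) =
      (((Real.sqrt (2 * k) ^ g)⁻¹ : ℝ) * sqrtDetOneAdd τ.1) • K l τ := by
    intro l τ hτ
    -- The theta section is covariantly constant, so its expansion applies; orthogonality leaves one
    -- vacuum.
    refine (hexp τ _ (smoothToDist_thetaSection_mem hk _ hτ)).trans ?_
    rw [Finset.sum_eq_single l]
    · rw [eval_smoothToDist_thetaSection hk l l hτ, if_pos rfl]
    · intro l' _ hl'
      rw [eval_smoothToDist_thetaSection hk l l' hτ, if_neg hl'.symm, zero_smul]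
    · exact fun h => absurd (Finset.mem_univ _) h
  have hne : ∀ τ : closedDisc g, τ.1 ∈ openDisc g →
      (((Real.sqrt (2 * k) ^ g)⁻¹ : ℝ) * sqrtDetOneAdd τ.1 : ℂ) ≠ 0 := fun τ hτ => by
    have hk0 : (0 : ℝ) < 2 * k := by
      have : (0 : ℝ) < k := by exact_mod_cast Nat.pos_of_ne_zero hk
      linarith
    have := Real.sqrt_pos.2 hk0
    refine mul_ne_zero (Complex.ofReal_ne_zero.2 (by positivity)) (sqrtDetOneAdd_ne_zero hτ)
  refine ⟨K, hK, fun l τ => ?_, fun l l' τ => ?_, hexp, hint⟩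
  · refine mem_covConstSections_of fun p φ => ?_
    have hw : Continuous fun τ : closedDisc g => antiholVec τ.1 p := by
      simp only [antiholVec, sub_mulVec, add_mulVec, one_mulVec]
      have h1 : Continuous fun τ : closedDisc g => τ.1 *ᵥ p :=
        continuous_subtype_val.matrix_mulVec continuous_const
      exact ((continuous_const.sub h1).const_smul Complex.I).prodMk (continuous_const.add h1)
    -- Both sides are continuous in `τ`, and over the dense open disc `K l τ` is a nonzero multiple
    -- of a covariantly constant theta section.
    have : (fun τ => (K l τ).eval (covDeriv (constField (antiholVec τ.1 p)) φ)) = fun _ => 0 := by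
      refine Continuous.ext_on hdense (continuous_eval_covDeriv (hK l) hw φ) continuous_const
        fun τ hτ => ?_
      have h1 := eval_covDeriv_antiholVec (smoothToDist_thetaSection_mem hk
        (fun j => ((l j : ℕ) : ℤ)) hτ) p φ
      change (smoothToDist _).eval _ = 0 at h1
      rw [hint l τ hτ, eval_smul] at h1
      exact (mul_eq_zero.1 h1).resolve_left (hne τ hτ)
    exact congrFun this τ
  · have : (fun τ => (K l τ).eval (classVacuum hk l')) = fun _ => if l = l' then 1 else 0 := by
      refine Continuous.ext_on hdense (hc l (classVacuum hk l')) continuous_const fun τ hτ => ?_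
      have h1 := eval_smoothToDist_thetaSection hk l l' hτ
      rw [hint l τ hτ, eval_smul] at h1
      split_ifs at h1 ⊢
      · exact mul_left_cancel₀ (hne τ hτ) (h1.trans (mul_one _).symm)
      · exact (mul_eq_zero.1 h1).resolve_left (hne τ hτ)
    exact congrFun this τ

end CovariantlyConstant

end TorusBKS

namespace TorusBKS

/-! ### The frame of the quantum bundle, the pairing and the pairing maps -/

section QuantumSpaces

variable {g k : ℕ}

theorem toDist_tmul {τ : Matrix (Fin g) (Fin g) ℂ} (T : covConstSections g k τ) (μ : HalfForm τ) :
    QuantumSpace.toDist (T ⊗ₜ[ℂ] μ : QuantumSpace g k τ) = HalfForm.coeff τ μ • T.1 := by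
  simp [QuantumSpace.toDist]

theorem toDist_injective {τ : Matrix (Fin g) (Fin g) ℂ} :
    Function.Injective (QuantumSpace.toDist (g := g) (k := k) (τ := τ)) := by
  have h : (QuantumSpace.toDist (g := g) (k := k) (τ := τ) : _ → DistSection g k) =
      Subtype.val ∘ (TensorProduct.rid ℂ (covConstSections g k τ)) ∘
        (TensorProduct.congr (LinearEquiv.refl ℂ (covConstSections g k τ)) (HalfForm.coeff τ)) := rfl
  rw [h]
  exact Subtype.val_injective.comp ((LinearEquiv.injective _).comp (LinearEquiv.injective _))

theorem toDist_mem {τ : Matrix (Fin g) (Fin g) ℂ} (a : QuantumSpace g k τ) :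
    QuantumSpace.toDist a ∈ covConstSections g k τ := Subtype.prop _

theorem continuous_base_toDist : Continuous fun q : QuantumBundle g k =>
    ((q.base, QuantumSpace.toDist q.vec) : closedDisc g × DistSection g k) :=
  continuous_induced_dom

theorem continuous_toDist : Continuous fun q : QuantumBundle g k => QuantumSpace.toDist q.vec :=
  continuous_snd.comp continuous_base_toDist

theorem continuous_section_iff {σ : ∀ τ : closedDisc g, QuantumSpace g k τ.1} :
    (Continuous fun τ => (⟨τ, σ τ⟩ : QuantumBundle g k)) ↔
      Continuous fun τ => QuantumSpace.toDist (σ τ) := by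
  refine ⟨fun h => ?_, fun h => ?_⟩
  · have h2 := Continuous.comp (continuous_toDist (g := g) (k := k)) h
    exact h2
  · have h1 : Continuous fun τ => ((τ, QuantumSpace.toDist (σ τ)) : closedDisc g × DistSection g k) :=
      continuous_id.prodMk h
    exact (continuous_induced_rng
      (f := fun q : QuantumBundle g k => (q.base, QuantumSpace.toDist q.vec))).2 h1

instance : T2Space (DistSection g k) :=
  T2Space.of_injective_continuous (f := fun T φ => DistSection.eval T φ)
    (fun _ _ h => Subtype.ext (LinearMap.ext fun φ => congrFun h φ)) continuous_induced_dom

/-- A frame of covariantly constant sections dual to the vacua. -/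
noncomputable def kernelFrame (hk : k ≠ 0) : (Fin g → Fin k) → closedDisc g → DistSection g k :=
  Classical.choose (exists_frame hk)

theorem kernelFrame_spec (hk : k ≠ 0) :
    (∀ l, Continuous (kernelFrame (g := g) hk l)) ∧
    (∀ l τ, kernelFrame (g := g) hk l τ ∈ covConstSections g k τ.1) ∧
    (∀ l l' τ, (kernelFrame (g := g) hk l τ).eval (classVacuum hk l') = if l = l' then 1 else 0) ∧
    (∀ (τ : closedDisc g), ∀ T ∈ covConstSections g k τ.1,
      T = ∑ l, T.eval (classVacuum hk l) • kernelFrame hk l τ) ∧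
    ∀ l (τ : closedDisc g) (hτ : τ.1 ∈ openDisc g),
      smoothToDist (thetaSection hk (fun j => ((l j : ℕ) : ℤ)) (period_mem_siegelUpper hτ)) =
      (((Real.sqrt (2 * k) ^ g)⁻¹ : ℝ) * sqrtDetOneAdd τ.1) • kernelFrame hk l τ :=
  Classical.choose_spec (exists_frame hk)

/-- The normalization of the frame. -/
noncomputable def frameConst (g k : ℕ) : ℝ := (Real.sqrt (2 * k) ^ g)⁻¹

theorem frameConst_pos (hk : k ≠ 0) : 0 < frameConst g k := by
  have h1 : (0 : ℝ) < k := by exact_mod_cast Nat.pos_of_ne_zero hk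
  have := Real.sqrt_pos.2 (by positivity : (0 : ℝ) < 2 * k)
  exact inv_pos.2 (pow_pos this g)

theorem frameConst_ne_zero (hk : k ≠ 0) : (frameConst g k : ℂ) ≠ 0 :=
  Complex.ofReal_ne_zero.2 (frameConst_pos hk).ne'

/-- The sections `σ^l_τ` over the closed disc. -/
noncomputable def frameVec (hk : k ≠ 0) (l : Fin g → Fin k) (τ : closedDisc g) :
    QuantumSpace g k τ.1 :=
  (⟨kernelFrame hk l τ, (kernelFrame_spec hk).2.1 l τ⟩ : covConstSections g k τ.1) ⊗ₜ[ℂ]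
    (HalfForm.coeff τ.1).symm (frameConst g k : ℂ)

theorem toDist_frameVec (hk : k ≠ 0) (l : Fin g → Fin k) (τ : closedDisc g) :
    QuantumSpace.toDist (frameVec hk l τ) = (frameConst g k : ℂ) • kernelFrame hk l τ := by
  rw [frameVec, toDist_tmul, LinearEquiv.apply_symm_apply]

/-- The coordinates with respect to the frame. -/
noncomputable def frameCoord (hk : k ≠ 0) (l : Fin g → Fin k) (τ : closedDisc g) :
    QuantumSpace g k τ.1 →ₗ[ℂ] ℂ where
  toFun a := (frameConst g k : ℂ)⁻¹ * (QuantumSpace.toDist a).eval (classVacuum hk l)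
  map_add' a b := by rw [map_add, eval_add, mul_add]
  map_smul' c a := by
    rw [map_smul, eval_smul, RingHom.id_apply, smul_eq_mul]
    ring

theorem frameCoord_apply (hk : k ≠ 0) (l : Fin g → Fin k) (τ : closedDisc g)
    (a : QuantumSpace g k τ.1) : frameCoord hk l τ a =
      (frameConst g k : ℂ)⁻¹ * (QuantumSpace.toDist a).eval (classVacuum hk l) := rfl

theorem continuous_frameCoord (hk : k ≠ 0) (l : Fin g → Fin k) :
    Continuous fun q : QuantumBundle g k => frameCoord hk l q.base q.vec :=
  continuous_const.mul (continuous_distSection_iff.1 continuous_toDist _)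

theorem frameCoord_frameVec (hk : k ≠ 0) (l l' : Fin g → Fin k) (τ : closedDisc g) :
    frameCoord hk l τ (frameVec hk l' τ) = if l' = l then 1 else 0 := by
  rw [frameCoord_apply, toDist_frameVec, eval_smul, (kernelFrame_spec hk).2.2.1, ← mul_assoc,
    inv_mul_cancel₀ (frameConst_ne_zero hk), one_mul]

theorem eq_sum_frameVec (hk : k ≠ 0) (τ : closedDisc g) (a : QuantumSpace g k τ.1) :
    a = ∑ l, frameCoord hk l τ a • frameVec hk l τ := by
  refine toDist_injective ?_
  rw [map_sum]
  refine ((kernelFrame_spec hk).2.2.2.1 τ _ (toDist_mem a)).trans ?_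
  refine Finset.sum_congr rfl fun l _ => ?_
  rw [map_smul, toDist_frameVec, smul_smul, frameCoord_apply, mul_right_comm,
    inv_mul_cancel₀ (frameConst_ne_zero hk), one_mul]

theorem toDist_tmul_sqrtDz {τ : Matrix (Fin g) (Fin g) ℂ} (T : covConstSections g k τ) :
    QuantumSpace.toDist (T ⊗ₜ[ℂ] sqrtDz τ : QuantumSpace g k τ) = (sqrtDetOneAdd τ)⁻¹ • T.1 := by
  rw [toDist_tmul, sqrtDz, LinearEquiv.apply_symm_apply]

/-- The half-form cancels the factor `sqrtDetOneAdd τ`, leaving a constant multiple of a kernel that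
extends to the boundary. -/
theorem toDist_theta_sqrtDz (hk : k ≠ 0) (l : Fin g → Fin k) (τ : closedDisc g)
    (hτ : τ.1 ∈ openDisc g) :
    (sqrtDetOneAdd τ.1)⁻¹ • smoothToDist (thetaSection hk (fun j => ((l j : ℕ) : ℤ))
      (period_mem_siegelUpper hτ)) = QuantumSpace.toDist (frameVec hk l τ) := by
  rw [(kernelFrame_spec hk).2.2.2.2 l τ hτ, toDist_frameVec, smul_smul, mul_left_comm,
    inv_mul_cancel₀ (sqrtDetOneAdd_ne_zero hτ), mul_one]
  rfl

theorem isThetaFrame_frameVec (hk : k ≠ 0) : IsThetaFrame (frameVec (g := g) hk) where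
  interior l τ hτ := by
    refine ⟨thetaSection hk (fun j => ((l j : ℕ) : ℤ)) (period_mem_siegelUpper hτ),
      smoothToDist_thetaSection_mem hk _ hτ, fun u => ?_, toDist_injective ?_⟩
    · rw [thetaFun_eq_thetaInt]; rfl
    · rw [toDist_tmul_sqrtDz, toDist_theta_sqrtDz hk l τ hτ]
  continuous l := by
    rw [continuous_section_iff]
    simp only [toDist_frameVec]
    refine continuous_distSection_iff.2 fun φ => ?_
    exact continuous_const.mul (continuous_distSection_iff.1 ((kernelFrame_spec hk).1 l) φ)

/-- Two continuous sections that agree over the dense open disc agree, as the space of distributions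
is Hausdorff. -/
theorem IsThetaFrame.eq_frameVec (hk : k ≠ 0)
    {σ : (Fin g → Fin k) → ∀ τ : closedDisc g, QuantumSpace g k τ.1} (hσ : IsThetaFrame σ) :
    σ = frameVec hk := by
  have h1 : ∀ l, (fun τ => QuantumSpace.toDist (σ l τ)) =
      fun τ => QuantumSpace.toDist (frameVec hk l τ) := fun l => by
    refine Continuous.ext_on (dense_openDisc g) (continuous_section_iff.1 (hσ.continuous l))
      (continuous_section_iff.1 ((isThetaFrame_frameVec hk).continuous l)) fun τ hτ => ?_
    obtain ⟨s, hs, hsu, h⟩ := hσ.interior l τ hτ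
    have h2 : s = thetaSection hk (fun j => ((l j : ℕ) : ℤ)) (period_mem_siegelUpper hτ) :=
      Subtype.ext (funext fun u => by rw [hsu, thetaFun_eq_thetaInt]; rfl)
    rw [h, toDist_tmul_sqrtDz, ← toDist_theta_sqrtDz hk l τ hτ, ← h2]
  exact funext fun l => funext fun τ => toDist_injective (congrFun (h1 l) τ)

/-- The normalization of the pairing. -/
noncomputable def pairingConst (g k : ℕ) : ℝ := (Real.sqrt (2 * k ^ 2) ^ g)⁻¹

theorem two_mul_sq_pos (hk : k ≠ 0) : (0 : ℝ) < 2 * k ^ 2 := by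
  have h1 : (0 : ℝ) < k := by exact_mod_cast Nat.pos_of_ne_zero hk
  positivity

theorem pairingConst_pos (hk : k ≠ 0) : 0 < pairingConst g k :=
  inv_pos.2 (pow_pos (Real.sqrt_pos.2 (two_mul_sq_pos hk)) g)

/-- The pairing matrix is `2k²` times the matrix in the half-form pairing. The two Gaussian
integrals cancel up to scaling, with no ambiguity of branch and no dependence on `Ω` or `Ω'`. -/
theorem gaussInt_pairingMatrix_mul_sqrtDetDiff (hk : k ≠ 0) {Ω Ω' : Matrix (Fin g) (Fin g) ℂ}
    (hΩ : Ω ∈ siegelUpper g) (hΩ' : Ω' ∈ siegelUpper g) :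
    gaussInt (pairingMatrix k Ω Ω') * sqrtDetDiff k Ω Ω' = pairingConst g k := by
  have hk0 : (k : ℂ) ≠ 0 := by exact_mod_cast hk
  have h0 := two_mul_sq_pos hk
  set A := (1 / (2 * k * Complex.I) : ℂ) • (Ω - Ω'.map conj) with hA
  have h1 : pairingMatrix k Ω Ω' = ((2 * k ^ 2 : ℝ) : ℂ) • A := by
    ext i j
    simp only [hA, pairingMatrix, Matrix.smul_apply, Matrix.add_apply, Matrix.sub_apply,
      Matrix.map_apply, smul_eq_mul, map_mul, map_neg, Complex.conj_I]
    push_cast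
    field_simp
    linear_combination (-(Ω i j - conj (Ω' i j))) * Complex.I_sq
  have h2 : A ∈ rightHalf g := by
    have h3 : A = (((2 * k ^ 2 : ℝ)⁻¹ : ℝ) : ℂ) • pairingMatrix k Ω Ω' := by
      rw [h1, smul_smul, ← Complex.ofReal_mul, inv_mul_cancel₀ h0.ne', Complex.ofReal_one, one_smul]
    rw [h3]
    exact smul_mem_rightHalf (pairingMatrix_mem_rightHalf hk hΩ hΩ') (inv_pos.2 h0)
  rw [h1, gaussInt_smul h0, sqrtDetDiff, ← hA, mul_assoc, mul_inv_cancel₀ (gaussInt_ne_zero h2),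
    mul_one]
  rfl

/-- The pairing for which the frames are dual up to a constant. -/
noncomputable def framePairing (hk : k ≠ 0) : PairingFamily g k := fun τ τ' =>
  LinearMap.mk₂'ₛₗ (RingHom.id ℂ) (starRingEnd ℂ)
    (fun a b => (pairingConst g k : ℂ) * ∑ l, frameCoord hk l τ a * conj (frameCoord hk l τ' b))
    (fun a a' b => by simp only [map_add, add_mul, Finset.sum_add_distrib, mul_add])
    (fun c a b => by
      simp only [map_smul, smul_eq_mul, RingHom.id_apply, Finset.mul_sum]
      exact Finset.sum_congr rfl fun l _ => by ring)
    (fun a b b' => by simp only [map_add, mul_add, Finset.sum_add_distrib])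
    (fun c a b => by
      simp only [map_smul, smul_eq_mul, map_mul, Finset.mul_sum]
      exact Finset.sum_congr rfl fun l _ => by ring)

theorem framePairing_apply (hk : k ≠ 0) (τ τ' : closedDisc g) (a : QuantumSpace g k τ.1)
    (b : QuantumSpace g k τ'.1) : framePairing hk τ τ' a b =
      (pairingConst g k : ℂ) * ∑ l, frameCoord hk l τ a * conj (frameCoord hk l τ' b) := rfl

theorem sectionInner_conj {n : ℤ} (s s' : SmoothSection g n) :
    conj (sectionInner s s') = sectionInner s' s := by
  rw [sectionInner, sectionInner, ← integral_conj]
  refine MeasureTheory.integral_congr_ae (Filter.Eventually.of_forall fun u => ?_)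
  simp [mul_comm]

theorem smoothToDist_eq_sum_theta (hk : k ≠ 0) (τ : closedDisc g) (hτ : τ.1 ∈ openDisc g)
    {T : DistSection g k} (hT : T ∈ covConstSections g k τ.1) (φ : SmoothSection g (-(k : ℤ))) :
    T.eval φ = ∑ l, T.eval (classVacuum hk l) * ((frameConst g k * sqrtDetOneAdd τ.1)⁻¹ *
      (smoothToDist (thetaSection hk (fun j => ((l j : ℕ) : ℤ))
        (period_mem_siegelUpper hτ))).eval φ) := by
  have hne : (frameConst g k * sqrtDetOneAdd τ.1 : ℂ) ≠ 0 :=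
    mul_ne_zero (frameConst_ne_zero hk) (sqrtDetOneAdd_ne_zero hτ)
  conv_lhs => rw [(kernelFrame_spec hk).2.2.2.1 τ T hT, eval_sum]
  refine Finset.sum_congr rfl fun l _ => ?_
  rw [eval_smul, (kernelFrame_spec hk).2.2.2.2 l τ hτ, eval_smul]
  change _ = _ * (_ * ((frameConst g k * sqrtDetOneAdd τ.1) * _))
  rw [inv_mul_cancel_left₀ hne]

/-- Both sections are expanded in theta sections, whose coefficients are values on the vacua; the
Gaussian factor is common to all classes. -/
theorem sectionInner_eq_sum (hk : k ≠ 0) (τ τ' : closedDisc g) (hτ : τ.1 ∈ openDisc g)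
    (hτ' : τ'.1 ∈ openDisc g) (s s' : SmoothSection g (k : ℤ))
    (hs : smoothToDist s ∈ covConstSections g k τ.1)
    (hs' : smoothToDist s' ∈ covConstSections g k τ'.1) :
    sectionInner s s' = (frameConst g k * sqrtDetOneAdd τ.1)⁻¹ *
      conj (frameConst g k * sqrtDetOneAdd τ'.1)⁻¹ *
      gaussInt (pairingMatrix k (period τ.1) (period τ'.1)) *
      ∑ l, (smoothToDist s).eval (classVacuum hk l) *
        conj ((smoothToDist s').eval (classVacuum hk l)) := by
  have h1 := smoothToDist_eq_sum_theta hk τ hτ hs (conjSection s')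
  have h2 : ∀ l : Fin g → Fin k, sectionInner s' (thetaSection hk (fun j => ((l j : ℕ) : ℤ))
      (period_mem_siegelUpper hτ)) = (smoothToDist s').eval (classVacuum hk l) *
        ((frameConst g k * sqrtDetOneAdd τ'.1)⁻¹ *
          gaussInt (pairingMatrix k (period τ'.1) (period τ.1))) := fun l => by
    have h3 := smoothToDist_eq_sum_theta hk τ' hτ' hs' (conjSection (thetaSection hk
      (fun j => ((l j : ℕ) : ℤ)) (period_mem_siegelUpper hτ)))
    simp only [eval_smoothToDist_conjSection, sectionInner_thetaSection] at h3
    rw [h3, Finset.sum_eq_single l]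
    · rw [if_pos rfl]
    · intro m _ hm
      rw [if_neg hm, mul_zero, mul_zero]
    · exact fun h => absurd (Finset.mem_univ _) h
  have h4 : conj (gaussInt (pairingMatrix k (period τ'.1) (period τ.1))) =
      gaussInt (pairingMatrix k (period τ.1) (period τ'.1)) := by
    have hk0 : 0 < k := Nat.pos_of_ne_zero hk
    have h5 := sectionInner_thetaSection hk (fun _ => ⟨0, hk0⟩) (fun _ => ⟨0, hk0⟩)
      (period_mem_siegelUpper hτ) (period_mem_siegelUpper hτ')
    have h6 := sectionInner_thetaSection hk (fun _ => ⟨0, hk0⟩) (fun _ => ⟨0, hk0⟩)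
      (period_mem_siegelUpper hτ') (period_mem_siegelUpper hτ)
    rw [if_pos rfl] at h5 h6
    rw [← h5, ← h6, sectionInner_conj]
  rw [eval_smoothToDist_conjSection] at h1
  rw [h1, Finset.mul_sum]
  refine Finset.sum_congr rfl fun l _ => ?_
  rw [eval_smoothToDist_conjSection, ← sectionInner_conj, h2, map_mul, map_mul, h4]
  ring

theorem isBKSPairing_framePairing (hk : k ≠ 0) : IsBKSPairing (framePairing (g := g) hk) where
  interior τ τ' hτ hτ' s s' hs hs' μ μ' := by
    have hd := sqrtDetOneAdd_ne_zero hτ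
    have hd' : conj (sqrtDetOneAdd τ'.1) ≠ 0 :=
      (map_ne_zero _).2 (sqrtDetOneAdd_ne_zero hτ')
    have hc := frameConst_ne_zero (g := g) hk
    rw [sectionInner_eq_sum hk τ τ' hτ hτ' s s' hs hs', framePairing_apply, halfFormPairing,
      ← gaussInt_pairingMatrix_mul_sqrtDetDiff hk (period_mem_siegelUpper hτ)
        (period_mem_siegelUpper hτ')]
    simp only [frameCoord_apply, toDist_tmul, eval_smul, map_mul, map_inv₀, Complex.conj_ofReal]
    rw [Finset.mul_sum, Finset.mul_sum, Finset.sum_mul]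
    refine Finset.sum_congr rfl fun l _ => ?_
    field_simp
  continuous := by
    simp only [framePairing_apply]
    refine continuous_const.mul (continuous_finsetSum _ fun l _ => ?_)
    exact ((continuous_frameCoord hk l).comp continuous_fst).mul
      (Complex.continuous_conj.comp ((continuous_frameCoord hk l).comp continuous_snd))

theorem sesquilinear_eq_sum (hk : k ≠ 0) {τ τ' : closedDisc g}
    (L : QuantumSpace g k τ.1 →ₗ[ℂ] QuantumSpace g k τ'.1 →ₗ⋆[ℂ] ℂ) (a : QuantumSpace g k τ.1)
    (b : QuantumSpace g k τ'.1) : L a b = ∑ l, ∑ l', frameCoord hk l τ a *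
      (conj (frameCoord hk l' τ' b) * L (frameVec hk l τ) (frameVec hk l' τ')) := by
  conv_lhs => rw [eq_sum_frameVec hk τ a, LinearMap.map_sum₂]
  refine Finset.sum_congr rfl fun l _ => ?_
  rw [LinearMap.map_smul₂, smul_eq_mul, ← Finset.mul_sum]
  congr 1
  conv_lhs => rw [eq_sum_frameVec hk τ' b, map_sum]
  exact Finset.sum_congr rfl fun l' _ => LinearMap.map_smulₛₗ _ _ _

theorem IsBKSPairing.continuous_frameVec (hk : k ≠ 0) {P : PairingFamily g k}
    (hP : IsBKSPairing P) (l l' : Fin g → Fin k) :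
    Continuous fun p : closedDisc g × closedDisc g =>
      P p.1 p.2 (frameVec hk l p.1) (frameVec hk l' p.2) := by
  have h1 : Continuous fun p : closedDisc g × closedDisc g =>
      (⟨p.1, frameVec hk l p.1⟩ : QuantumBundle g k) :=
    Continuous.comp ((isThetaFrame_frameVec hk).continuous l) continuous_fst
  have h2 : Continuous fun p : closedDisc g × closedDisc g =>
      (⟨p.2, frameVec hk l' p.2⟩ : QuantumBundle g k) :=
    Continuous.comp ((isThetaFrame_frameVec hk).continuous l') continuous_snd
  have h3 := Continuous.comp hP.continuous (h1.prodMk h2)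
  exact h3

/-- A pairing is determined by its values on frames, which depend continuously on `(τ, τ')` and are
prescribed on a dense set. -/
theorem IsBKSPairing.unique (hk : k ≠ 0) {P P' : PairingFamily g k} (hP : IsBKSPairing P)
    (hP' : IsBKSPairing P') : P = P' := by
  have h1 : ∀ l l' : Fin g → Fin k, ∀ p : closedDisc g × closedDisc g,
      P p.1 p.2 (frameVec hk l p.1) (frameVec hk l' p.2) =
      P' p.1 p.2 (frameVec hk l p.1) (frameVec hk l' p.2) := fun l l' => by
    have hc := hP.continuous_frameVec hk l l'
    have hc' := hP'.continuous_frameVec hk l l'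
    have hi : ∀ p ∈ {τ : closedDisc g | τ.1 ∈ openDisc g} ×ˢ {τ : closedDisc g | τ.1 ∈ openDisc g},
        P p.1 p.2 (frameVec hk l p.1) (frameVec hk l' p.2) =
        P' p.1 p.2 (frameVec hk l p.1) (frameVec hk l' p.2) := by
      rintro ⟨τ, τ'⟩ ⟨hτ, hτ'⟩
      obtain ⟨s, hs, -, h⟩ := (isThetaFrame_frameVec hk).interior l τ hτ
      obtain ⟨s', hs', -, h'⟩ := (isThetaFrame_frameVec hk).interior l' τ' hτ'
      rw [h, h', hP.interior τ τ' hτ hτ', hP'.interior τ τ' hτ hτ']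
    exact congrFun (Continuous.ext_on ((dense_openDisc g).prod (dense_openDisc g)) hc hc' hi)
  funext τ τ'
  refine LinearMap.ext fun a => LinearMap.ext fun b => ?_
  rw [sesquilinear_eq_sum hk (P τ τ'), sesquilinear_eq_sum hk (P' τ τ')]
  exact Finset.sum_congr rfl fun l _ => Finset.sum_congr rfl fun l' _ => by
    rw [h1 l l' (τ, τ')]

theorem framePairing_conj (hk : k ≠ 0) (τ τ' : closedDisc g) (a : QuantumSpace g k τ.1)
    (b : QuantumSpace g k τ'.1) :
    framePairing hk τ' τ b a = conj (framePairing hk τ τ' a b) := by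
  simp only [framePairing_apply, map_mul, map_sum, Complex.conj_ofReal, Complex.conj_conj]
  congr 1
  exact Finset.sum_congr rfl fun l _ => mul_comm _ _

theorem framePairing_self_pos (hk : k ≠ 0) (τ : closedDisc g) (a : QuantumSpace g k τ.1)
    (ha : a ≠ 0) : 0 < (framePairing hk τ τ a a).re := by
  rw [framePairing_apply, Complex.re_ofReal_mul]
  refine mul_pos (pairingConst_pos hk) ?_
  simp only [Complex.mul_conj, Complex.re_sum, Complex.ofReal_re]
  obtain ⟨l, hl⟩ : ∃ l, frameCoord hk l τ a ≠ 0 := by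
    by_contra! h
    refine ha ((eq_sum_frameVec hk τ a).trans (Finset.sum_eq_zero fun l _ => ?_))
    rw [h, zero_smul]
  exact Finset.sum_pos' (fun _ _ => Complex.normSq_nonneg _)
    ⟨l, Finset.mem_univ _, Complex.normSq_pos.2 hl⟩

theorem linearIndependent_frameVec (hk : k ≠ 0) (τ : closedDisc g) :
    LinearIndependent ℂ fun l => frameVec hk l τ := by
  refine Fintype.linearIndependent_iff.2 fun c hc l => ?_
  have h := congrArg (frameCoord hk l τ) hc
  simpa [frameCoord_frameVec] using h

theorem span_frameVec (hk : k ≠ 0) (τ : closedDisc g) :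
    Submodule.span ℂ (Set.range fun l => frameVec hk l τ) = ⊤ := by
  refine Submodule.eq_top_iff'.2 fun a => ?_
  rw [eq_sum_frameVec hk τ a]
  exact Submodule.sum_mem _ fun l _ => Submodule.smul_mem _ _ (Submodule.subset_span ⟨l, rfl⟩)

/-- The linear maps identifying the frames. -/
noncomputable def frameMap (hk : k ≠ 0) (τ τ' : closedDisc g) :
    QuantumSpace g k τ.1 →ₗ[ℂ] QuantumSpace g k τ'.1 :=
  ∑ l, (frameCoord hk l τ).smulRight (frameVec hk l τ')

theorem frameMap_apply (hk : k ≠ 0) (τ τ' : closedDisc g) (a : QuantumSpace g k τ.1) :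
    frameMap hk τ τ' a = ∑ l, frameCoord hk l τ a • frameVec hk l τ' := by
  simp [frameMap]

theorem frameCoord_frameMap (hk : k ≠ 0) (l : Fin g → Fin k) (τ τ' : closedDisc g)
    (a : QuantumSpace g k τ.1) :
    frameCoord hk l τ' (frameMap hk τ τ' a) = frameCoord hk l τ a := by
  simp [frameMap_apply, frameCoord_frameVec]

theorem ext_frameCoord (hk : k ≠ 0) {τ : closedDisc g} {a b : QuantumSpace g k τ.1}
    (h : ∀ l, frameCoord hk l τ a = frameCoord hk l τ b) : a = b := by
  rw [eq_sum_frameVec hk τ a, eq_sum_frameVec hk τ b]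
  simp only [h]

theorem isPairingMap_frameMap (hk : k ≠ 0) :
    IsPairingMap (framePairing (g := g) hk) (frameMap hk) := fun τ τ' a b => by
  simp only [framePairing_apply, frameCoord_frameMap]

theorem IsPairingMap.eq_frameMap (hk : k ≠ 0)
    {B : ∀ τ τ' : closedDisc g, QuantumSpace g k τ.1 →ₗ[ℂ] QuantumSpace g k τ'.1}
    (hB : IsPairingMap (framePairing hk) B) : B = frameMap hk := by
  funext τ τ'
  refine LinearMap.ext fun a => ?_
  by_contra hne
  -- Pairing the difference with itself gives zero, against positive definiteness.
  set b := B τ τ' a - frameMap hk τ τ' a with hb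
  have h := framePairing_self_pos hk τ' b (sub_ne_zero.2 hne)
  have h1 : framePairing hk τ' τ' b b = framePairing hk τ' τ' (B τ τ' a) b -
      framePairing hk τ' τ' (frameMap hk τ τ' a) b := LinearMap.map_sub₂ _ _ _ _
  rw [h1, hB, isPairingMap_frameMap hk, sub_self] at h
  exact lt_irrefl _ h

theorem frameMap_comp (hk : k ≠ 0) (τ τ' τ'' : closedDisc g) :
    frameMap hk τ' τ'' ∘ₗ frameMap hk τ τ' = frameMap hk τ τ'' :=
  LinearMap.ext fun a => ext_frameCoord hk fun l => by
    rw [LinearMap.comp_apply, frameCoord_frameMap, frameCoord_frameMap, frameCoord_frameMap]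

theorem frameMap_self (hk : k ≠ 0) (τ : closedDisc g) (a : QuantumSpace g k τ.1) :
    frameMap hk τ τ a = a :=
  ext_frameCoord hk fun l => by rw [frameCoord_frameMap]

theorem frameMap_bijective (hk : k ≠ 0) (τ τ' : closedDisc g) :
    Function.Bijective (frameMap hk τ τ') := by
  have h : ∀ τ τ' : closedDisc g, ∀ a, frameMap hk τ' τ (frameMap hk τ τ' a) = a := fun τ τ' a => by
    rw [← LinearMap.comp_apply, frameMap_comp, frameMap_self]
  exact Function.bijective_iff_has_inverse.2 ⟨frameMap hk τ' τ, h τ τ', h τ' τ⟩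

theorem frameMap_frameVec (hk : k ≠ 0) (l : Fin g → Fin k) (τ τ' : closedDisc g) :
    frameMap hk τ τ' (frameVec hk l τ) = frameVec hk l τ' :=
  ext_frameCoord hk fun m => by
    rw [frameCoord_frameMap, frameCoord_frameVec, frameCoord_frameVec]

end QuantumSpaces

end TorusBKS

theorem mainTheorem4 (g k : ℕ) (hk : 1 ≤ k) :
    -- the branch of the square root of `det (1 + τ)` used for half-forms is the stated one
    (ContinuousOn (TorusBKS.sqrtDetOneAdd (g := g)) (TorusBKS.openDisc g) ∧
      (∀ τ ∈ TorusBKS.openDisc g, TorusBKS.sqrtDetOneAdd τ ^ 2 = (1 + τ).det) ∧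
      TorusBKS.sqrtDetOneAdd (0 : Matrix (Fin g) (Fin g) ℂ) = 1) ∧
    -- the BKS pairing and the frame over the closed disc exist and are unique
    (∃! P : TorusBKS.PairingFamily g k, TorusBKS.IsBKSPairing P) ∧
    (∃! σ : (Fin g → Fin k) → ∀ τ : TorusBKS.closedDisc g, TorusBKS.QuantumSpace g k τ.1,
      TorusBKS.IsThetaFrame σ) ∧
    ∀ (P : TorusBKS.PairingFamily g k)
      (σ : (Fin g → Fin k) → ∀ τ : TorusBKS.closedDisc g, TorusBKS.QuantumSpace g k τ.1),
      TorusBKS.IsBKSPairing P → TorusBKS.IsThetaFrame σ →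
      -- the pairing of `Q_τ` with itself is an inner product
      (∀ (τ : TorusBKS.closedDisc g) (a b : TorusBKS.QuantumSpace g k τ.1),
        P τ τ b a = starRingEnd ℂ (P τ τ a b)) ∧
      (∀ (τ : TorusBKS.closedDisc g) (a : TorusBKS.QuantumSpace g k τ.1),
        a ≠ 0 → 0 < (P τ τ a a).re) ∧
      -- the `σ^l_τ` form a basis of `Q_τ`
      (∀ τ : TorusBKS.closedDisc g, LinearIndependent ℂ (fun l => σ l τ) ∧
        Submodule.span ℂ (Set.range fun l => σ l τ) = ⊤) ∧
      -- the pairing maps exist, are unique, unitary and transitive, and the frame is parallel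
      (∃! B : ∀ τ τ' : TorusBKS.closedDisc g,
          TorusBKS.QuantumSpace g k τ.1 →ₗ[ℂ] TorusBKS.QuantumSpace g k τ'.1,
        TorusBKS.IsPairingMap P B) ∧
      ∀ B : ∀ τ τ' : TorusBKS.closedDisc g,
          TorusBKS.QuantumSpace g k τ.1 →ₗ[ℂ] TorusBKS.QuantumSpace g k τ'.1,
        TorusBKS.IsPairingMap P B →
        (∀ τ τ' : TorusBKS.closedDisc g, Function.Bijective (B τ τ') ∧
          ∀ a b : TorusBKS.QuantumSpace g k τ.1,
            P τ' τ' (B τ τ' a) (B τ τ' b) = P τ τ a b) ∧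
        (∀ τ τ' τ'' : TorusBKS.closedDisc g, B τ' τ'' ∘ₗ B τ τ' = B τ τ'') ∧
        (∀ (l : Fin g → Fin k) (τ τ' : TorusBKS.closedDisc g), B τ τ' (σ l τ) = σ l τ') := by
  have hk0 : k ≠ 0 := by omega
  refine ⟨⟨TorusBKS.continuousOn_sqrtDetOneAdd g, fun τ hτ => TorusBKS.sqrtDetOneAdd_sq hτ, TorusBKS.sqrtDetOneAdd_zero g⟩,
    ⟨TorusBKS.framePairing hk0, TorusBKS.isBKSPairing_framePairing hk0,
      fun P hP => TorusBKS.IsBKSPairing.unique hk0 hP (TorusBKS.isBKSPairing_framePairing hk0)⟩,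
    ⟨TorusBKS.frameVec hk0, TorusBKS.isThetaFrame_frameVec hk0, fun σ hσ => TorusBKS.IsThetaFrame.eq_frameVec hk0 hσ⟩, ?_⟩
  intro P σ hP hσ
  -- By uniqueness the given pairing, frame and, below, pairing maps are the constructed ones.
  obtain rfl := TorusBKS.IsBKSPairing.unique hk0 hP (TorusBKS.isBKSPairing_framePairing hk0)
  obtain rfl := TorusBKS.IsThetaFrame.eq_frameVec hk0 hσ
  refine ⟨fun τ a b => TorusBKS.framePairing_conj hk0 τ τ a b, TorusBKS.framePairing_self_pos hk0,
    fun τ => ⟨TorusBKS.linearIndependent_frameVec hk0 τ, TorusBKS.span_frameVec hk0 τ⟩,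
    ⟨TorusBKS.frameMap hk0, TorusBKS.isPairingMap_frameMap hk0, fun B hB => TorusBKS.IsPairingMap.eq_frameMap hk0 hB⟩, ?_⟩
  intro B hB
  obtain rfl := TorusBKS.IsPairingMap.eq_frameMap hk0 hB
  refine ⟨fun τ τ' => ⟨TorusBKS.frameMap_bijective hk0 τ τ', fun a b => ?_⟩, TorusBKS.frameMap_comp hk0,
    fun l τ τ' => TorusBKS.frameMap_frameVec hk0 l τ τ'⟩
  simp only [TorusBKS.framePairing_apply, TorusBKS.frameCoord_frameMap]
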